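/- All manifolds are finite-dimensional, smooth and without boundary, and maps between them are smooth. Let $\mathcal H\rightrightarrows N$ and $\mathcal G\rightrightarrows M$ be Lie groupoids with source $s$, target $t$, unit $u$, inversion $i$ and multiplication written $gh$ (defined if $s(g)=t(h)$), where $M$ and $N$ are Hausdorff ($\mathcal G$ and $\mathcal H$ need not be). Let $A_{\mathcal G}=\ker(ds)|_{M}$ be the Lie algebroid of $\mathcal G$, with fibre $\ker(d_{u(x)}s)\subset T_{u(x)}\mathcal G$ at $x\in M$. For $g\in\mathcal G$ let $r_g$ and $l_g$ be the differentials of the right translation $R_g\colon s^{-1}(t(g))\to s^{-1}(s(g))$, $R_g(k)=kg$, and of the left translation $L_g\colon t^{-1}(s(g))\to t^{-1}(t(g))$, $L_g(k)=gk$. Let $(\Phi_0,\phi_0)$ be a morphism of Lie groupoids from $\mathcal H$ to $\mathcal G$, with base map $\phi_0\colon N\to M$. A *deformation* of it is a pair of smooth maps $\mathcal H\times I\to\mathcal G$, $(h,\varepsilon)\mapsto\Phi_\varepsilon(h)$, and $N\times I\to M$, $(y,\varepsilon)\mapsto\phi_\varepsilon(y)$, where $I$ is an open interval containing $0$, such that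 every $(\Phi_\varepsilon,\phi_\varepsilon)$ is a morphism of Lie groupoids and at $\varepsilon=0$ it is the given one. Its deformation cocycles are $X_\varepsilon(h)=\frac{d}{d\varepsilon}\Phi_\varepsilon(h)\in T_{\Phi_\varepsilon(h)}\mathcal G$. A *bisection* of $\mathcal G$ is a smooth map $\sigma\colon M\to\mathcal G$ with $s\circ\sigma=\mathrm{id}_M$ and $t\circ\sigma$ a diffeomorphism of $M$; put $I_\sigma(g)=\sigma(t(g))\,g\,\sigma(s(g))^{-1}$. The deformation is *strongly trivial* if there are an open interval $J\subseteq I$ containing $0$ and a family of bisections $\sigma_\varepsilon$, $\varepsilon\in J$, smooth as a map $M\times J\to\mathcal G$, with $\sigma_0=u$ and $\Phi_\varepsilon=I_{\sigma_\varepsilon}\circ\Phi_0$ for all $\varepsilon\in J$. The *variation complex* of $(\Phi_\varepsilon,\phi_\varepsilon)$ has the degree $0$ cochains $\phi_\varepsilon^*(\Gamma(A_{\mathcal G}))\subset\Gamma(\phi_\varepsilon^*A_{\mathcal G})$, with differential $$\delta_{\Phi_\varepsilon}(\beta)(h)=r_{\Phi_\varepsilon(h)}\bigl(\beta(t(h))\bigr)+l_{\Phi_\varepsilon(h)}\bigl(di(\beta(s(h)))\bigr),\qquad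 h\in\mathcal H .$$ The cocycles $X_\varepsilon$ are *smoothly exact in the variation complex* if there are an open interval $J\subseteq I$ containing $0$ and a smooth family of sections $\alpha_\varepsilon\in\Gamma(A_{\mathcal G})$, $\varepsilon\in J$ (that is, $\alpha_\varepsilon(x)$ depends smoothly on $(x,\varepsilon)\in M\times J$), such that $X_\varepsilon=\delta_{\Phi_\varepsilon}(\phi_\varepsilon^*\alpha_\varepsilon)$ for all $\varepsilon\in J$. **Theorem.** Assume that $N$ is compact. Then the deformation $(\Phi_\varepsilon,\phi_\varepsilon)$ is strongly trivial if and only if its cocycles $X_\varepsilon$ are smoothly exact in the variation complex. -/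

import Mathlib

open Set
open scoped Manifold ContDiff

noncomputable section

/-- A Lie groupoid `G ⇉ M` (arrows `g : source g ⟶ target g`), over finite-dimensional manifolds
without boundary. Neither `G` nor `M` is required here to be Hausdorff.
The multiplication is a total function `mul`, whose values matter only on composable pairs
`source g = target h`; smoothness of the multiplication is smoothness along the (embedded)
submanifold of composable pairs of `G × G`. -/
structure LieGroupoid (EG G EM M : Type*)
    [NormedAddCommGroup EG] [NormedSpace ℝ EG] [TopologicalSpace G] [ChartedSpace EG G]
    [NormedAddCommGroup EM] [NormedSpace ℝ EM] [TopologicalSpace M] [ChartedSpace EM M] where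
  source : G → M
  target : G → M
  unit : M → G
  inv : G → G
  mul : G → G → G
  source_unit : ∀ x, source (unit x) = x
  target_unit : ∀ x, target (unit x) = x
  source_inv : ∀ g, source (inv g) = target g
  target_inv : ∀ g, target (inv g) = source g
  source_mul : ∀ g h, source g = target h → source (mul g h) = source h
  target_mul : ∀ g h, source g = target h → target (mul g h) = target g
  mul_assoc : ∀ g h k, source g = target h → source h = target k →
    mul (mul g h) k = mul g (mul h k)
  unit_mul : ∀ g, mul (unit (target g)) g = g
  mul_unit : ∀ g, mul g (unit (source g)) = g
  inv_mul : ∀ g, mul (inv g) g = unit (source g)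
  mul_inv : ∀ g, mul g (inv g) = unit (target g)
  submersion_source : Manifold.IsSubmersion 𝓘(ℝ, EG) 𝓘(ℝ, EM) ∞ source
  submersion_target : Manifold.IsSubmersion 𝓘(ℝ, EG) 𝓘(ℝ, EM) ∞ target
  smooth_unit : ContMDiff 𝓘(ℝ, EM) 𝓘(ℝ, EG) ∞ unit
  smooth_inv : ContMDiff 𝓘(ℝ, EG) 𝓘(ℝ, EG) ∞ inv
  smooth_mul : ContMDiffOn (𝓘(ℝ, EG).prod 𝓘(ℝ, EG)) 𝓘(ℝ, EG) ∞
    (fun p : G × G => mul p.1 p.2) {p : G × G | source p.1 = target p.2}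

/-- An open interval of `ℝ` (possibly unbounded) containing `0`. -/
def IsOpenIntervalAroundZero (I : Set ℝ) : Prop :=
  IsOpen I ∧ I.OrdConnected ∧ (0 : ℝ) ∈ I

/-- The identification `T_p G = T_q G` along an equality of points `p = q`. -/
def tangentCast {EG G : Type*} [NormedAddCommGroup EG] [NormedSpace ℝ EG] [TopologicalSpace G]
    [ChartedSpace EG G] {p q : G} (h : p = q) (v : TangentSpace 𝓘(ℝ, EG) p) :
    TangentSpace 𝓘(ℝ, EG) q :=
  h ▸ v

namespace LieGroupoid

section Groupoid

variable {EG G EM M : Type*}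
  [NormedAddCommGroup EG] [NormedSpace ℝ EG] [TopologicalSpace G] [ChartedSpace EG G]
  [NormedAddCommGroup EM] [NormedSpace ℝ EM] [TopologicalSpace M] [ChartedSpace EM M]
  (𝓖 : LieGroupoid EG G EM M)

theorem inv_unit (x : M) : 𝓖.inv (𝓖.unit x) = 𝓖.unit x := by
  have h1 := 𝓖.mul_unit (𝓖.inv (𝓖.unit x))
  have h2 := 𝓖.inv_mul (𝓖.unit x)
  rw [𝓖.source_inv, 𝓖.target_unit] at h1
  rw [𝓖.source_unit] at h2
  exact h1.symm.trans h2

/-- A (global) bisection: a smooth section `σ` of the source map for which `target ∘ σ` is a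
diffeomorphism of `M`. -/
def IsBisection (σ : M → G) : Prop :=
  ContMDiff 𝓘(ℝ, EM) 𝓘(ℝ, EG) ∞ σ ∧ (∀ x, 𝓖.source (σ x) = x) ∧
    ∃ e : M ≃ₘ^∞⟮𝓘(ℝ, EM), 𝓘(ℝ, EM)⟯ M, ∀ x, e x = 𝓖.target (σ x)

/-- A smooth family `σ_ε`, `ε ∈ J`, of bisections. -/
def IsSmoothBisectionFamily (J : Set ℝ) (σ : ℝ → M → G) : Prop :=
  ContMDiffOn (𝓘(ℝ, EM).prod 𝓘(ℝ, ℝ)) 𝓘(ℝ, EG) ∞ (fun p : M × ℝ => σ p.2 p.1) (univ ×ˢ J) ∧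
    ∀ ε ∈ J, 𝓖.IsBisection (σ ε)

/-- Conjugation `I_σ(g) = σ(t(g)) g σ(s(g))⁻¹`. -/
def conj (σ : M → G) (g : G) : G :=
  𝓖.mul (𝓖.mul (σ (𝓖.target g)) g) (𝓖.inv (σ (𝓖.source g)))

/-- The fibre at `x` of the Lie algebroid `A_G`: the kernel of `ds` in `T_{1_x} G`. -/
def algebroidFiber (x : M) : Submodule ℝ (TangentSpace 𝓘(ℝ, EG) (𝓖.unit x)) :=
  LinearMap.ker
    (mfderiv 𝓘(ℝ, EG) 𝓘(ℝ, EM) 𝓖.source (𝓖.unit x)).toLinearMap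

/-- A smooth family `α_ε ∈ Γ(A_G)`, `ε ∈ J`: smoothness is joint in the point of `M` and in `ε`,
i.e. `α` is a smooth section of the algebroid of `G × J ⇉ M × J`. -/
def IsSmoothSectionFamily [IsManifold 𝓘(ℝ, EG) ∞ G] (J : Set ℝ) (α : ℝ → (x : M) → 𝓖.algebroidFiber x) : Prop :=
  ContMDiffOn (𝓘(ℝ, EM).prod 𝓘(ℝ, ℝ)) 𝓘(ℝ, EG).tangent ∞
    (fun p : M × ℝ =>
      (⟨𝓖.unit p.1, (α p.2 p.1 : TangentSpace 𝓘(ℝ, EG) (𝓖.unit p.1))⟩ : TangentBundle 𝓘(ℝ, EG) G))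
    (univ ×ˢ J)

/-- `r_g(a) ∈ T_g G` for `a ∈ T_{1_x} G` tangent to the source fibre and `x = t(g)`: the
differential at `1_x` of the right translation `R_g : s⁻¹(x) → G`, `k ↦ k g`.
The derivative is taken within the submanifold `s⁻¹(x)`, so it is canonical on vectors tangent to
that submanifold; it is only applied to such vectors. -/
def rightTranslate (g : G) {x : M} (hx : 𝓖.target g = x)
    (a : TangentSpace 𝓘(ℝ, EG) (𝓖.unit x)) : TangentSpace 𝓘(ℝ, EG) g :=
  tangentCast (by subst hx; exact 𝓖.unit_mul g)
    (mfderivWithin 𝓘(ℝ, EG) 𝓘(ℝ, EG) (fun k => 𝓖.mul k g) {k | 𝓖.source k = x} (𝓖.unit x) a)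

/-- `l_g(b) ∈ T_g G` for `b` tangent at `1_x = (1_x)⁻¹` to the target fibre and `x = s(g)`: the
differential of the left translation `L_g : t⁻¹(x) → G`, `k ↦ g k`.
The derivative is taken within the submanifold `t⁻¹(x)`, so it is canonical on vectors tangent to
that submanifold; it is only applied to such vectors. -/
def leftTranslate (g : G) {x : M} (hx : 𝓖.source g = x)
    (b : TangentSpace 𝓘(ℝ, EG) (𝓖.inv (𝓖.unit x))) : TangentSpace 𝓘(ℝ, EG) g :=
  tangentCast (by subst hx; rw [𝓖.inv_unit]; exact 𝓖.mul_unit g)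
    (mfderivWithin 𝓘(ℝ, EG) 𝓘(ℝ, EG) (fun k => 𝓖.mul g k) {k | 𝓖.target k = x}
      (𝓖.inv (𝓖.unit x)) b)

end Groupoid

section Morphism

variable {EH H EN N EG G EM M : Type*}
  [NormedAddCommGroup EH] [NormedSpace ℝ EH] [TopologicalSpace H] [ChartedSpace EH H]
  [NormedAddCommGroup EN] [NormedSpace ℝ EN] [TopologicalSpace N] [ChartedSpace EN N]
  [NormedAddCommGroup EG] [NormedSpace ℝ EG] [TopologicalSpace G] [ChartedSpace EG G]
  [NormedAddCommGroup EM] [NormedSpace ℝ EM] [TopologicalSpace M] [ChartedSpace EM M]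

/-- `(Φ, φ)` is a morphism of Lie groupoids from `𝓗` to `𝓖`, with base map `φ`. -/
structure IsMorphism (𝓗 : LieGroupoid EH H EN N) (𝓖 : LieGroupoid EG G EM M)
    (Φ : H → G) (φ : N → M) : Prop where
  smooth_arrows : ContMDiff 𝓘(ℝ, EH) 𝓘(ℝ, EG) ∞ Φ
  smooth_base : ContMDiff 𝓘(ℝ, EN) 𝓘(ℝ, EM) ∞ φ
  map_source : ∀ h, 𝓖.source (Φ h) = φ (𝓗.source h)
  map_target : ∀ h, 𝓖.target (Φ h) = φ (𝓗.target h)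
  map_mul : ∀ h k, 𝓗.source h = 𝓗.target k → Φ (𝓗.mul h k) = 𝓖.mul (Φ h) (Φ k)

/-- A deformation `(Φ_ε, φ_ε)`, `ε ∈ I`, of `(Φ₀, φ₀)`. The values of `arrows` and `base` for
`ε ∉ I` are irrelevant. -/
structure Deformation (𝓗 : LieGroupoid EH H EN N) (𝓖 : LieGroupoid EG G EM M)
    (Φ₀ : H → G) (φ₀ : N → M) where
  I : Set ℝ
  isOpenInterval : IsOpenIntervalAroundZero I
  arrows : ℝ → H → G
  base : ℝ → N → M
  smooth_arrows : ContMDiffOn (𝓘(ℝ, EH).prod 𝓘(ℝ, ℝ)) 𝓘(ℝ, EG) ∞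
    (fun p : H × ℝ => arrows p.2 p.1) (univ ×ˢ I)
  smooth_base : ContMDiffOn (𝓘(ℝ, EN).prod 𝓘(ℝ, ℝ)) 𝓘(ℝ, EM) ∞
    (fun p : N × ℝ => base p.2 p.1) (univ ×ˢ I)
  isMorphism : ∀ ε ∈ I, IsMorphism 𝓗 𝓖 (arrows ε) (base ε)
  arrows_zero : arrows 0 = Φ₀
  base_zero : base 0 = φ₀

/-- The differential `δ_Φ : C⁰_def(Φ) = Γ(φ^* A_G) → C¹_def(Φ)`,
`δ_Φ(β)(h) = r_{Φ(h)}(β(t(h))) + l_{Φ(h)}(di(β(s(h))))`. -/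
def coboundary {𝓗 : LieGroupoid EH H EN N} {𝓖 : LieGroupoid EG G EM M} {Φ : H → G} {φ : N → M}
    (hΦ : IsMorphism 𝓗 𝓖 Φ φ) (β : (y : N) → 𝓖.algebroidFiber (φ y)) (h : H) :
    TangentSpace 𝓘(ℝ, EG) (Φ h) :=
  𝓖.rightTranslate (Φ h) (hΦ.map_target h) (β (𝓗.target h)) +
    𝓖.leftTranslate (Φ h) (hΦ.map_source h)
      (mfderiv 𝓘(ℝ, EG) 𝓘(ℝ, EG) 𝓖.inv (𝓖.unit (φ (𝓗.source h))) (β (𝓗.source h)))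

namespace Deformation

variable {𝓗 : LieGroupoid EH H EN N} {𝓖 : LieGroupoid EG G EM M} {Φ₀ : H → G} {φ₀ : N → M}

/-- The constant deformation `Φ_ε = Φ₀`, `ε ∈ ℝ`. -/
def const (h₀ : IsMorphism 𝓗 𝓖 Φ₀ φ₀) : Deformation 𝓗 𝓖 Φ₀ φ₀ where
  I := univ
  isOpenInterval := ⟨isOpen_univ, ordConnected_univ, mem_univ _⟩
  arrows := fun _ => Φ₀
  base := fun _ => φ₀
  smooth_arrows := (h₀.smooth_arrows.comp contMDiff_fst).contMDiffOn
  smooth_base := (h₀.smooth_base.comp contMDiff_fst).contMDiffOn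
  isMorphism := fun _ _ => h₀
  arrows_zero := rfl
  base_zero := rfl

/-- Strong equivalence of deformations: `Φ_ε = I_{σ_ε} ∘ Φ'_ε` for all `ε` in some open interval
containing `0`, for a smooth family of bisections `σ_ε` with `σ_0` the identity bisection. -/
def StronglyEquivalent (D D' : Deformation 𝓗 𝓖 Φ₀ φ₀) : Prop :=
  ∃ J : Set ℝ, IsOpenIntervalAroundZero J ∧ J ⊆ D.I ∧ J ⊆ D'.I ∧
    ∃ σ : ℝ → M → G, 𝓖.IsSmoothBisectionFamily J σ ∧ σ 0 = 𝓖.unit ∧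
      ∀ ε ∈ J, ∀ h, D.arrows ε h = 𝓖.conj (σ ε) (D'.arrows ε h)

/-- A deformation is strongly trivial if it is strongly equivalent to the constant deformation. -/
def StronglyTrivial (D : Deformation 𝓗 𝓖 Φ₀ φ₀) (h₀ : IsMorphism 𝓗 𝓖 Φ₀ φ₀) : Prop :=
  D.StronglyEquivalent (const h₀)

/-- The deformation cocycle `X_ε(h) = d/dε Φ_ε(h) ∈ T_{Φ_ε(h)} G`. -/
def cocycle (D : Deformation 𝓗 𝓖 Φ₀ φ₀) (ε : ℝ) (h : H) :
    TangentSpace 𝓘(ℝ, EG) (D.arrows ε h) :=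
  mfderiv 𝓘(ℝ, ℝ) 𝓘(ℝ, EG) (fun l : ℝ => D.arrows l h) ε (1 : ℝ)

/-- A family `β_ε ∈ Γ(φ_ε^* A_G)`, `ε ∈ J`, is a smooth family of degree `0` cochains of the
variation complex if `β_ε = φ_ε^* α_ε` for a smooth family `α_ε ∈ Γ(A_G)`. -/
def IsSmoothVariationCochainFamily [IsManifold 𝓘(ℝ, EG) ∞ G]
    (D : Deformation 𝓗 𝓖 Φ₀ φ₀) (J : Set ℝ)
    (β : (ε : ℝ) → (y : N) → 𝓖.algebroidFiber (D.base ε y)) : Prop :=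
  ∃ α : ℝ → (x : M) → 𝓖.algebroidFiber x, 𝓖.IsSmoothSectionFamily J α ∧
    ∀ ε ∈ J, ∀ y, β ε y = α ε (D.base ε y)

/-- The deformation cocycles are smoothly exact in the variation complex: for `ε` in some open
interval containing `0`, `X_ε = δ_{Φ_ε}(β_ε)` for a smooth family `β_ε` of degree `0` cochains of
the variation complex. -/
def CocyclesSmoothlyExactInVariation [IsManifold 𝓘(ℝ, EG) ∞ G]
    (D : Deformation 𝓗 𝓖 Φ₀ φ₀) : Prop :=
  ∃ J : Set ℝ, IsOpenIntervalAroundZero J ∧ ∃ hJ : J ⊆ D.I,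
    ∃ β : (ε : ℝ) → (y : N) → 𝓖.algebroidFiber (D.base ε y),
      D.IsSmoothVariationCochainFamily J β ∧
        ∀ (ε : ℝ) (hε : ε ∈ J) (h : H),
          D.cocycle ε h = coboundary (D.isMorphism ε (hJ hε)) (β ε) h

end Deformation

end Morphism

end LieGroupoid

end

/-! The two directions differentiate and integrate one relation.

Suppose Φ_ε = I_{σ_ε} ∘ Φ₀. By `conj_eq_mul_conj_mul`, Φ_l arises from Φ_ε by conjugation with σ_l
σ_ε⁻¹, which is a unit at l = ε. Differentiating there (`hasVelocityAt_mul_mul_inv`) gives X_ε =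
δ(φ_ε^* α_ε), where α_ε is the logarithmic derivative of σ_ε. It is indexed by the target of σ_ε, so
its smoothness needs the inverse of t ∘ σ_ε to be smooth in ε as well
(`IsSmoothBisectionFamily.exists_section`).

Conversely, let X_ε = δ(φ_ε^* α_ε). Only the values of α_ε on φ_ε(N) matter. Since N is compact,
these sets lie in one compact set for small ε, and α can be cut off to compact support. The
right-invariant field of α then integrates, for a time uniform in x, to bisections σ_ε
(`exists_bisectionFamily_of_compact_support`). The curves t(σ_ε(φ₀(y))) and φ_ε(y) solve the same
equation on M, so they agree. Hence σ_ε⁻¹ Φ_ε σ_ε is defined; it has zero velocity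
(`hasVelocityAt_zero_of_conj`), so it stays equal to Φ₀.

The arrows may be non-Hausdorff. Uniqueness of integral curves is therefore used only on M; on
arrows it is replaced by the constancy of stationary curves (`eq_of_hasVelocityAt_zero`). Velocities
of products are found by exchanging factors for tangent curves whose product can be simplified
algebraically. Smooth dependence of flows comes from the implicit function theorem applied to the
Picard operator. -/

open scoped Topology

/-! ### Composition operators on spaces of continuous maps -/

section Nemytskii

universe u

variable {K : Type*} [TopologicalSpace K] [CompactSpace K]
  {E F : Type u} [NormedAddCommGroup E] [NormedSpace ℝ E] [NormedAddCommGroup F] [NormedSpace ℝ F]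

/-- Pointwise application of a continuous family of operators to a continuous map. -/
noncomputable def pointwiseApply (K : Type*) [TopologicalSpace K] [CompactSpace K] (E F : Type u)
    [NormedAddCommGroup E] [NormedSpace ℝ E] [NormedAddCommGroup F] [NormedSpace ℝ F] :
    C(K, E →L[ℝ] F) →L[ℝ] C(K, E) →L[ℝ] C(K, F) :=
  LinearMap.mkContinuous₂
    (LinearMap.mk₂ ℝ (fun (A : C(K, E →L[ℝ] F)) (h : C(K, E)) =>
        (⟨fun s => A s (h s), by fun_prop⟩ : C(K, F)))
      (fun _ _ _ => by ext; simp) (fun _ _ _ => by ext; simp)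
      (fun _ _ _ => by ext; simp) (fun _ _ _ => by ext; simp)) 1
    (fun A h => by
      rw [one_mul]
      refine (ContinuousMap.norm_le _ (by positivity)).2 fun s => ?_
      refine (ContinuousLinearMap.le_opNorm _ _).trans ?_
      gcongr
      · exact A.norm_coe_le_norm s
      · exact h.norm_coe_le_norm s)

@[simp]
theorem pointwiseApply_apply (A : C(K, E →L[ℝ] F)) (h : C(K, E)) (s : K) :
    pointwiseApply K E F A h s = A s (h s) := rfl

/-- The Nemytskii operator `γ ↦ f ∘ γ` on continuous maps is differentiable. -/
theorem hasFDerivAt_postcomp (f : C(E, F)) (f' : C(E, E →L[ℝ] F))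
    (hf : ∀ x, HasFDerivAt f (f' x) x) (γ : C(K, E)) :
    HasFDerivAt (fun η : C(K, E) => f.comp η) (pointwiseApply K E F (f'.comp γ)) γ := by
  rw [hasFDerivAt_iff_isLittleO_nhds_zero, Asymptotics.isLittleO_iff]
  intro c hc
  have hcont : Continuous (fun η : C(K, E) => f'.comp η) := ContinuousMap.continuous_postcomp f'
  obtain ⟨δ, hδ, hη⟩ := (Metric.continuous_iff (f := fun η : C(K, E) => f'.comp η)).1 hcont γ c hc
  filter_upwards [Metric.ball_mem_nhds (0 : C(K, E)) hδ] with h hh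
  rw [mem_ball_zero_iff] at hh
  refine (ContinuousMap.norm_le _ (by positivity)).2 fun s => ?_
  -- Testing continuity of η ↦ f' ∘ η on constant translates of γ bounds f' y - f' (γ s) uniformly
  -- in s; the mean value inequality then controls the remainder.
  have key : ∀ y ∈ Metric.closedBall (γ s) ‖h‖, ‖f' y - f' (γ s)‖ ≤ c := by
    intro y hy
    have h1 := hη (γ + ContinuousMap.const K (y - γ s)) (by
      rw [dist_eq_norm, add_sub_cancel_left]
      refine lt_of_le_of_lt ?_ hh
      refine (ContinuousMap.norm_le _ (norm_nonneg _)).2 fun _ => ?_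
      simpa [dist_eq_norm] using hy)
    have h2 := (ContinuousMap.dist_apply_le_dist s).trans h1.le
    simpa [dist_eq_norm] using h2
  have hball : γ s + h s ∈ Metric.closedBall (γ s) ‖h‖ := by
    simpa [dist_eq_norm] using h.norm_coe_le_norm s
  have h3 := (convex_closedBall (γ s) ‖h‖).norm_image_sub_le_of_norm_hasFDerivWithin_le'
    (fun y _ => (hf y).hasFDerivWithinAt) key
    (Metric.mem_closedBall_self (norm_nonneg _)) hball
  have h4 : ‖f (γ s + h s) - f (γ s) - f' (γ s) (h s)‖ ≤ c * ‖h s‖ := by simpa using h3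
  refine le_trans (by simpa using h4) ?_
  gcongr
  exact h.norm_coe_le_norm s

/-- The derivative is composition with f' followed by a continuous linear map, so induction applies
with the operator space as new target. This is why F is quantified inside and shares its universe
with E. -/
theorem contDiff_postcomp_nat (n : ℕ) : ∀ {F : Type u} [NormedAddCommGroup F] [NormedSpace ℝ F]
    (f : C(E, F)), ContDiff ℝ n f → ContDiff ℝ n (fun η : C(K, E) => f.comp η) := by
  induction n with
  | zero =>
    intro F _ _ f _
    exact contDiff_zero.2 (ContinuousMap.continuous_postcomp f)
  | succ n ih =>
    intro F _ _ f hf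
    have hf' := contDiff_succ_iff_fderiv.1 (show ContDiff ℝ ((n : WithTop ℕ∞) + 1) f from hf)
    let f' : C(E, E →L[ℝ] F) := ⟨fderiv ℝ f, hf'.2.2.continuous⟩
    have hd := hasFDerivAt_postcomp (K := K) f f' (fun x => (hf'.1 x).hasFDerivAt)
    refine (contDiff_succ_iff_fderiv (n := (n : WithTop ℕ∞))).2
      ⟨fun γ => (hd γ).differentiableAt, by simp, ?_⟩
    have : fderiv ℝ (fun η : C(K, E) => f.comp η)
        = fun γ => pointwiseApply K E F (f'.comp γ) := funext fun γ => (hd γ).fderiv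
    rw [this]
    exact (pointwiseApply K E F).contDiff.comp (ih f' hf'.2.2)

theorem contDiff_postcomp (f : C(E, F)) (hf : ContDiff ℝ ∞ f) :
    ContDiff ℝ ∞ (fun η : C(K, E) => f.comp η) :=
  contDiff_infty.2 fun n => contDiff_postcomp_nat n f (contDiff_infty.1 hf n)

end Nemytskii

/-! ### Smooth flows of globally Lipschitz vector fields -/

section Flow

universe u

variable {E : Type u} [NormedAddCommGroup E] [NormedSpace ℝ E] [CompleteSpace E]

theorem isInvertible_one_sub_of_norm_lt_one (T : E →L[ℝ] E) (hT : ‖T‖ < 1) :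
    (1 - T).IsInvertible := by
  obtain ⟨u, hu⟩ : IsUnit (1 - T) := isUnit_one_sub_of_norm_lt_one hT
  exact ⟨ContinuousLinearEquiv.ofUnit u, hu⟩

/-- The primitive vanishing at `0`, as an operator on continuous functions on `[-1, 1]`. -/
noncomputable def primitiveCLM (E : Type u) [NormedAddCommGroup E] [NormedSpace ℝ E]
    [CompleteSpace E] : C(Icc (-1 : ℝ) 1, E) →L[ℝ] C(Icc (-1 : ℝ) 1, E) :=
  LinearMap.mkContinuous
    { toFun := fun γ =>
        ⟨fun s => ∫ r in (0 : ℝ)..s, γ (projIcc (-1) 1 (by norm_num) r), by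
          have h : Continuous fun r : ℝ => γ (projIcc (-1) 1 (by norm_num) r) := by fun_prop
          exact (intervalIntegral.continuous_primitive (fun _ _ => h.intervalIntegrable _ _) 0).comp
            continuous_subtype_val⟩
      map_add' := fun γ η => by
        ext s
        exact intervalIntegral.integral_add
          (Continuous.intervalIntegrable (by fun_prop) _ _)
          (Continuous.intervalIntegrable (by fun_prop) _ _)
      map_smul' := fun c γ => by
        ext s
        exact intervalIntegral.integral_smul c _ }
    1 (fun γ => by
      rw [one_mul]
      refine (ContinuousMap.norm_le _ (norm_nonneg _)).2 fun s => ?_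
      refine (intervalIntegral.norm_integral_le_of_norm_le_const
        (fun r _ => γ.norm_coe_le_norm _)).trans ?_
      have : |(s : ℝ) - 0| ≤ 1 := by rw [sub_zero]; exact abs_le.2 s.2
      exact mul_le_of_le_one_right (norm_nonneg _) this)

theorem norm_primitiveCLM_le : ‖primitiveCLM E‖ ≤ 1 :=
  LinearMap.mkContinuous_norm_le _ zero_le_one _

/-- The Picard operator of `f`, with time rescaled to `[-1, 1]`. -/
noncomputable def picardMap (f : C(E, E)) (p : (E × ℝ) × C(Icc (-1 : ℝ) 1, E)) :
    C(Icc (-1 : ℝ) 1, E) :=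
  ContinuousLinearMap.const ℝ (Icc (-1 : ℝ) 1) p.1.1 + p.1.2 • primitiveCLM E (f.comp p.2)

/-- A fixed point sends s to the solution at time t * s. Rescaling makes t a smooth parameter while
the function space stays fixed. -/
theorem picardMap_apply (f : C(E, E)) (x : E) (t : ℝ) (γ : C(Icc (-1 : ℝ) 1, E))
    (s : Icc (-1 : ℝ) 1) : picardMap f ((x, t), γ) s =
      x + t • ∫ r in (0 : ℝ)..s, f (γ (projIcc (-1) 1 (by norm_num) r)) := rfl

theorem contDiff_picardMap (f : C(E, E)) (hf : ContDiff ℝ ∞ f) : ContDiff ℝ ∞ (picardMap f) := by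
  have h1 := contDiff_postcomp (K := Icc (-1 : ℝ) 1) f hf
  have h2 : ContDiff ℝ ∞ fun p : (E × ℝ) × C(Icc (-1 : ℝ) 1, E) =>
      primitiveCLM E (f.comp p.2) :=
    (primitiveCLM E).contDiff.comp (h1.comp contDiff_snd)
  exact ((ContinuousLinearMap.const ℝ (Icc (-1 : ℝ) 1)).contDiff.comp
    (contDiff_fst.comp contDiff_fst)).add ((contDiff_snd.comp contDiff_fst).smul h2)

/-- The primitive has norm at most 1, so the constant does not involve x; this gives a lifetime
uniform in the initial point. -/
theorem lipschitzWith_picardMap (f : C(E, E)) {L : NNReal} (hL : LipschitzWith L f) (x : E)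
    (t : ℝ) : LipschitzWith (‖t‖₊ * L) (fun γ => picardMap f ((x, t), γ)) := by
  refine LipschitzWith.of_dist_le_mul fun γ η => ?_
  have h1 : picardMap f ((x, t), γ) - picardMap f ((x, t), η)
      = t • primitiveCLM E (f.comp γ - f.comp η) := by
    simp [picardMap, smul_sub]
  have h2 : ‖f.comp γ - f.comp η‖ ≤ L * ‖γ - η‖ := by
    refine (ContinuousMap.norm_le _ (by positivity)).2 fun s => ?_
    have := hL.dist_le_mul (γ s) (η s)
    rw [dist_eq_norm, dist_eq_norm] at this
    refine this.trans ?_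
    gcongr
    exact (γ - η).norm_coe_le_norm s
  rw [dist_eq_norm, dist_eq_norm, h1, norm_smul, NNReal.coe_mul, coe_nnnorm, mul_assoc]
  gcongr
  refine ((primitiveCLM E).le_opNorm _).trans ?_
  calc _ ≤ 1 * ‖f.comp γ - f.comp η‖ := by gcongr; exact norm_primitiveCLM_le
    _ ≤ _ := by rwa [one_mul]

theorem contractingWith_picardMap (f : C(E, E)) {L : NNReal} (hL : LipschitzWith L f) (x : E)
    {t : ℝ} (ht : ‖t‖₊ * L < 1) :
    ContractingWith (‖t‖₊ * L) (fun γ => picardMap f ((x, t), γ)) :=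
  ⟨ht, lipschitzWith_picardMap f hL x t⟩

/-- The implicit function theorem applies to γ - P(p, γ): the partial derivative of P has norm at
most |t| L < 1, so 1 minus it is invertible. Uniqueness of fixed points identifies Γ with the
implicit function, without assuming Γ continuous. -/
theorem contDiffAt_of_fixedPoint_picardMap (f : C(E, E)) (hf : ContDiff ℝ ∞ f) {L : NNReal}
    (hL : LipschitzWith L f) (Γ : E × ℝ → C(Icc (-1 : ℝ) 1, E))
    (hΓ : ∀ p : E × ℝ, ‖p.2‖₊ * L < 1 → picardMap f (p, Γ p) = Γ p)
    (p : E × ℝ) (hp : ‖p.2‖₊ * L < 1) : ContDiffAt ℝ ∞ Γ p := by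
  have hP := contDiff_picardMap f hf
  have hF : ContDiffAt ℝ ∞ (fun q : (E × ℝ) × C(Icc (-1 : ℝ) 1, E) => q.2 - picardMap f q)
      (p, Γ p) := (contDiff_snd.sub hP).contDiffAt
  have hdP : HasFDerivAt (picardMap f) (fderiv ℝ (picardMap f) (p, Γ p)) (p, Γ p) :=
    (hP.differentiable (by simp) _).hasFDerivAt
  have hinr : HasFDerivAt (fun γ : C(Icc (-1 : ℝ) 1, E) => (p, γ))
      (ContinuousLinearMap.inr ℝ (E × ℝ) C(Icc (-1 : ℝ) 1, E)) (Γ p) := hasFDerivAt_prodMk_right _ _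
  have hle := (hdP.comp (Γ p) hinr).le_of_lipschitz (lipschitzWith_picardMap f hL p.1 p.2)
  have hlt : ‖fderiv ℝ (picardMap f) (p, Γ p) ∘L
      ContinuousLinearMap.inr ℝ (E × ℝ) C(Icc (-1 : ℝ) 1, E)‖ < 1 := lt_of_le_of_lt hle hp
  have hinv : (fderiv ℝ (fun q : (E × ℝ) × C(Icc (-1 : ℝ) 1, E) => q.2 - picardMap f q) (p, Γ p)
      ∘L ContinuousLinearMap.inr ℝ (E × ℝ) C(Icc (-1 : ℝ) 1, E)).IsInvertible := by
    have h1 := (hasFDerivAt_snd (𝕜 := ℝ) (p := (p, Γ p))).sub hdP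
    have h2 : fderiv ℝ (fun q : (E × ℝ) × C(Icc (-1 : ℝ) 1, E) => q.2 - picardMap f q) (p, Γ p)
      ∘L ContinuousLinearMap.inr ℝ (E × ℝ) C(Icc (-1 : ℝ) 1, E) = 1 - fderiv ℝ (picardMap f)
        (p, Γ p) ∘L ContinuousLinearMap.inr ℝ (E × ℝ) C(Icc (-1 : ℝ) 1, E) := by
      rw [show fderiv ℝ (fun q : (E × ℝ) × C(Icc (-1 : ℝ) 1, E) => q.2 - picardMap f q) (p, Γ p)
        = _ from h1.fderiv]
      ext; simp
    rw [h2]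
    exact isInvertible_one_sub_of_norm_lt_one _ hlt
  have hn : (∞ : WithTop ℕ∞) ≠ 0 := by simp
  refine (hF.contDiffAt_implicitFunction hn hinv).congr_of_eventuallyEq ?_
  have hopen : ∀ᶠ q : E × ℝ in nhds p, ‖q.2‖₊ * L < 1 :=
    (isOpen_lt (by fun_prop) continuous_const).mem_nhds hp
  filter_upwards [hF.eventually_apply_implicitFunction hn hinv, hopen] with q hq hq'
  simp only [hΓ p hp, sub_self, sub_eq_zero] at hq
  exact (contractingWith_picardMap f hL q.1 hq').fixedPoint_unique' (hΓ q hq') hq.symm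

/-- The flow of a globally Lipschitz smooth vector field is defined and jointly smooth for small
times. -/
theorem exists_contDiffOn_flow (f : E → E) (hf : ContDiff ℝ ∞ f) {L : NNReal}
    (hL : LipschitzWith L f) : ∃ δ > 0, ∃ Fl : E × ℝ → E,
      ContDiffOn ℝ ∞ Fl (univ ×ˢ Ioo (-δ) δ) ∧ (∀ x, Fl (x, 0) = x) ∧
      ∀ x, ∀ t ∈ Ioo (-δ) δ, HasDerivAt (fun s => Fl (x, s)) (f (Fl (x, t))) t := by
  let f' : C(E, E) := ⟨f, hf.continuous⟩
  have hL' : LipschitzWith L f' := hL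
  have hex : ∀ p : E × ℝ, ∃ γ : C(Icc (-1 : ℝ) 1, E), ‖p.2‖₊ * L < 1 →
      picardMap f' (p, γ) = γ := by
    intro p
    by_cases hp : ‖p.2‖₊ * L < 1
    · exact ⟨_, fun _ => (contractingWith_picardMap f' hL' p.1 hp).fixedPoint_isFixedPt⟩
    · exact ⟨0, fun h => absurd h hp⟩
  choose Γ hΓ using hex
  have hone : (1 : ℝ) ∈ Icc (-1 : ℝ) 1 := by norm_num
  have hsmall : ∀ t ∈ Ioo (-((L : ℝ) + 1)⁻¹) ((L : ℝ) + 1)⁻¹, ‖t‖₊ * L < 1 := by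
    intro t ht
    have h1 : |t| < ((L : ℝ) + 1)⁻¹ := abs_lt.2 ht
    rw [← NNReal.coe_lt_coe]
    push_cast
    rw [Real.norm_eq_abs]
    calc |t| * (L : ℝ) ≤ |t| * (L + 1) := by gcongr; linarith
      _ < ((L : ℝ) + 1)⁻¹ * (L + 1) := by gcongr
      _ = 1 := inv_mul_cancel₀ (by positivity)
  have hδ : 0 < ((L : ℝ) + 1)⁻¹ := by positivity
  -- the rescaled solution evaluated at `s` is the solution at the time `t * s`
  have hscale : ∀ x, ∀ t ∈ Ioo (-((L : ℝ) + 1)⁻¹) ((L : ℝ) + 1)⁻¹, ∀ s : Icc (-1 : ℝ) 1,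
      Γ (x, t * s) ⟨1, hone⟩ = Γ (x, t) s := by
    intro x t ht s
    have hs : |(s : ℝ)| ≤ 1 := abs_le.2 s.2
    have hts : t * s ∈ Ioo (-((L : ℝ) + 1)⁻¹) ((L : ℝ) + 1)⁻¹ := by
      rw [mem_Ioo, ← abs_lt, abs_mul]
      exact (mul_le_of_le_one_right (abs_nonneg _) hs).trans_lt (abs_lt.2 ht)
    have hmem : ∀ r : Icc (-1 : ℝ) 1, (s : ℝ) * r ∈ Icc (-1 : ℝ) 1 := by
      intro r
      rw [mem_Icc, ← abs_le, abs_mul]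
      exact mul_le_one₀ hs (abs_nonneg _) (abs_le.2 r.2)
    let η : C(Icc (-1 : ℝ) 1, E) := ⟨fun r => Γ (x, t) ⟨s * r, hmem r⟩, by fun_prop⟩
    have hη : picardMap f' ((x, t * s), η) = η := by
      ext r
      have h1 : η r = Γ (x, t) ⟨s * r, hmem r⟩ := rfl
      rw [h1, ← hΓ (x, t) (hsmall t ht), picardMap_apply, picardMap_apply, mul_smul]
      congr 2
      have h2 := intervalIntegral.smul_integral_comp_mul_left (a := 0) (b := (r : ℝ))
        (fun r : ℝ => f' (Γ (x, t) (projIcc (-1) 1 (by norm_num) r))) (s : ℝ)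
      rw [mul_zero] at h2
      rw [← h2]
      congr 1
      refine intervalIntegral.integral_congr fun q hq => ?_
      have hq1 : q ∈ Icc (-1 : ℝ) 1 :=
        (ordConnected_Icc.uIcc_subset (by norm_num) r.2) hq
      have hq2 := hmem ⟨q, hq1⟩
      simp only [projIcc_of_mem _ hq1]
      rw [projIcc_of_mem _ hq2]
      rfl
    have := (contractingWith_picardMap f' hL' x (hsmall _ hts)).fixedPoint_unique'
      (hΓ (x, t * s) (hsmall _ hts)) hη
    rw [this]
    simp [η]
  refine ⟨_, hδ, fun p => Γ p ⟨1, hone⟩, ?_, ?_, ?_⟩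
  · intro p hp
    have h1 := contDiffAt_of_fixedPoint_picardMap f' hf hL' Γ hΓ p (hsmall p.2 hp.2)
    exact ((ContinuousMap.evalCLM ℝ (⟨1, hone⟩ : Icc (-1 : ℝ) 1)).contDiff.contDiffAt.comp p
      h1).contDiffWithinAt
  · intro x
    have h1 := hΓ (x, 0) (by simp)
    change Γ (x, 0) ⟨1, hone⟩ = x
    rw [← h1, picardMap_apply]
    simp
  · intro x t ht
    -- With T > |t|, all times s near t are read off the single solution Γ (x, T) at s / T, and the
    -- fundamental theorem of calculus differentiates the upper limit.
    obtain ⟨T, hT0, hT, htT⟩ : ∃ T : ℝ, 0 < T ∧ T < ((L : ℝ) + 1)⁻¹ ∧ |t| < T := by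
      obtain ⟨T, h1, h2⟩ := exists_between (abs_lt.2 ht)
      exact ⟨T, (abs_nonneg t).trans_lt h1, h2, h1⟩
    have hTm : T ∈ Ioo (-((L : ℝ) + 1)⁻¹) ((L : ℝ) + 1)⁻¹ := ⟨by linarith, hT⟩
    have hform : ∀ s ∈ Ioo (-T) T, Γ (x, s) ⟨1, hone⟩ =
        x + T • ∫ r in (0 : ℝ)..s / T, f (Γ (x, T) (projIcc (-1) 1 (by norm_num) r)) := by
      intro s hs
      have hs1 : s / T ∈ Icc (-1 : ℝ) 1 := by
        rw [mem_Icc, ← abs_le, abs_div, abs_of_pos hT0, div_le_one hT0]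
        exact (abs_lt.2 hs).le
      have h1 := hscale x T hTm ⟨s / T, hs1⟩
      rw [show T * ((⟨s / T, hs1⟩ : Icc (-1 : ℝ) 1) : ℝ) = s by field_simp] at h1
      rw [h1, ← hΓ (x, T) (hsmall T hTm), picardMap_apply, hΓ (x, T) (hsmall T hTm)]
      rfl
    have ht1 : t / T ∈ Icc (-1 : ℝ) 1 := by
      rw [mem_Icc, ← abs_le, abs_div, abs_of_pos hT0, div_le_one hT0]
      exact htT.le
    have hval : Γ (x, T) (projIcc (-1) 1 (by norm_num) (t / T)) = Γ (x, t) ⟨1, hone⟩ := by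
      rw [projIcc_of_mem _ ht1, ← hscale x T hTm]
      congr 3
      field_simp
    have hc : Continuous fun r : ℝ => f (Γ (x, T) (projIcc (-1) 1 (by norm_num) r)) := by
      have := hf.continuous
      fun_prop
    have h2 := intervalIntegral.integral_hasDerivAt_right (hc.intervalIntegrable 0 (t / T))
      hc.stronglyMeasurable.stronglyMeasurableAtFilter hc.continuousAt
    have h3 := ((h2.scomp t ((hasDerivAt_id t).div_const T)).const_smul T).const_add x
    rw [hval] at h3
    have h4 : T • (1 / T) • f (Γ (x, t) ⟨1, hone⟩) = f (Γ (x, t) ⟨1, hone⟩) := by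
      rw [smul_smul, mul_one_div_cancel hT0.ne', one_smul]
    rw [h4] at h3
    refine h3.congr_of_eventuallyEq ?_
    filter_upwards [isOpen_Ioo.mem_nhds (abs_lt.1 htT)] with s hs using hform s hs

end Flow

/-! ### Velocities of curves and tangency -/

section Velocity

variable {E H P : Type*} [NormedAddCommGroup E] [NormedSpace ℝ E] [TopologicalSpace H]
  (I : ModelWithCorners ℝ E H) [TopologicalSpace P] [ChartedSpace H P]
  {E' H' P' : Type*} [NormedAddCommGroup E'] [NormedSpace ℝ E'] [TopologicalSpace H']
  (I' : ModelWithCorners ℝ E' H') [TopologicalSpace P'] [ChartedSpace H' P']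

/-- The curve `c` in a manifold is differentiable at `t`, with velocity `v`. -/
def HasVelocityAt (c : ℝ → P) (t : ℝ) (v : E) : Prop :=
  HasMFDerivAt 𝓘(ℝ, ℝ) I c t ((1 : ℝ →L[ℝ] ℝ).smulRight v : ℝ →L[ℝ] E)

variable {I I'} {c c' : ℝ → P} {t : ℝ} {v w : E}

theorem HasVelocityAt.continuousAt (h : HasVelocityAt I c t v) : ContinuousAt c t := h.1

theorem HasVelocityAt.mfderiv_apply_one (h : HasVelocityAt I c t v) :
    mfderiv 𝓘(ℝ, ℝ) I c t (1 : ℝ) = v := by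
  rw [HasMFDerivAt.mfderiv h]
  exact one_smul ℝ v

theorem HasMFDerivAt.hasVelocityAt {L : TangentSpace 𝓘(ℝ, ℝ) t →L[ℝ] TangentSpace I (c t)}
    (h : HasMFDerivAt 𝓘(ℝ, ℝ) I c t L) (hv : L (1 : ℝ) = v) : HasVelocityAt I c t v := by
  have e : L = ((1 : ℝ →L[ℝ] ℝ).smulRight v : ℝ →L[ℝ] E) := by
    let L' : ℝ →L[ℝ] E := L
    change L' 1 = v at hv
    change L' = (1 : ℝ →L[ℝ] ℝ).smulRight v
    ext
    simpa using hv
  exact e.subst (motive := fun L' : TangentSpace 𝓘(ℝ, ℝ) t →L[ℝ] TangentSpace I (c t) =>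
    HasMFDerivAt 𝓘(ℝ, ℝ) I c t L') h

theorem MDifferentiableAt.hasVelocityAt (h : MDifferentiableAt 𝓘(ℝ, ℝ) I c t) :
    HasVelocityAt I c t (mfderiv 𝓘(ℝ, ℝ) I c t (1 : ℝ)) :=
  h.hasMFDerivAt.hasVelocityAt rfl

theorem HasVelocityAt.unique (h : HasVelocityAt I c t v) (h' : HasVelocityAt I c t w) :
    v = w := by
  rw [← h.mfderiv_apply_one, ← h'.mfderiv_apply_one]

theorem HasVelocityAt.congr (h : HasVelocityAt I c t v) (hc : c' =ᶠ[𝓝 t] c) :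
    HasVelocityAt I c' t v :=
  HasMFDerivAt.congr_of_eventuallyEq h hc

theorem hasVelocityAt_const (p : P) (t : ℝ) : HasVelocityAt I (fun _ => p) t 0 :=
  (hasMFDerivAt_const (I := 𝓘(ℝ, ℝ)) (I' := I) p t).hasVelocityAt rfl

theorem HasDerivAt.hasVelocityAt {c : ℝ → E} (h : HasDerivAt c v t) :
    HasVelocityAt 𝓘(ℝ, E) c t v := by
  exact h.hasFDerivAt.hasMFDerivAt.hasVelocityAt (one_smul ℝ v)

theorem HasVelocityAt.hasDerivAt {c : ℝ → E} (h : HasVelocityAt 𝓘(ℝ, E) c t v) :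
    HasDerivAt c v t := by
  have h1 : HasFDerivAt c ((1 : ℝ →L[ℝ] ℝ).smulRight v : ℝ →L[ℝ] E) t :=
    HasMFDerivAt.hasFDerivAt h
  simpa using h1.hasDerivAt

/-- The separate point p lets the derivative be taken at a canonical expression such as a unit, even
where c t equals it only propositionally. -/
theorem HasVelocityAt.comp_within {f : P → P'} {S : Set P} {p : P} (h : HasVelocityAt I c t v)
    (hp : c t = p) (hf : MDifferentiableWithinAt I I' f S p) (hS : ∀ᶠ s in 𝓝 t, c s ∈ S) :
    HasVelocityAt I' (fun s => f (c s)) t (mfderivWithin I I' f S p v) := by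
  subst hp
  have h1 := HasMFDerivWithinAt.comp t hf.hasMFDerivWithinAt
    (HasMFDerivAt.hasMFDerivWithinAt (s := c ⁻¹' S) h) subset_rfl
  exact (h1.hasMFDerivAt hS).hasVelocityAt
    (congrArg (mfderivWithin I I' f S (c t)) (one_smul ℝ v))

theorem HasVelocityAt.comp {f : P → P'} {p : P} (h : HasVelocityAt I c t v)
    (hp : c t = p) (hf : MDifferentiableAt I I' f p) :
    HasVelocityAt I' (fun s => f (c s)) t (mfderiv I I' f p v) := by
  have := h.comp_within hp hf.mdifferentiableWithinAt (S := univ) (by simp)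
  rwa [mfderivWithin_univ] at this

theorem HasVelocityAt.prodMk {c' : ℝ → P'} {w : E'} (h : HasVelocityAt I c t v)
    (h' : HasVelocityAt I' c' t w) :
    HasVelocityAt (I.prod I') (fun s => (c s, c' s)) t (v, w) :=
  (HasMFDerivAt.prodMk h h').hasVelocityAt
    (Prod.ext (one_smul ℝ v : _ = v) (one_smul ℝ w : _ = w) : _ = ((v, w) : E × E'))

/-- Two curves are tangent at `t` if they agree there and have the same velocity. -/
def TangentCurves (I : ModelWithCorners ℝ E H) (c c' : ℝ → P) (t : ℝ) : Prop :=
  c t = c' t ∧ ∃ v : E, HasVelocityAt I c t v ∧ HasVelocityAt I c' t v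

theorem HasVelocityAt.tangentCurves (h : HasVelocityAt I c t v) (h' : HasVelocityAt I c' t v)
    (he : c t = c' t) : TangentCurves I c c' t := ⟨he, v, h, h'⟩

/-- Used to exchange a product of curves for a tangent one whose velocity is known, often because it
is constant. -/
theorem TangentCurves.velocity (h : TangentCurves I c c' t) (hv : HasVelocityAt I c' t v) :
    HasVelocityAt I c t v := by
  obtain ⟨_, w, h1, h2⟩ := h
  rwa [← h2.unique hv]

theorem TangentCurves.comp_within {f : P → P'} {S : Set P} (h : TangentCurves I c c' t)
    (hf : MDifferentiableWithinAt I I' f S (c t)) (hS : ∀ᶠ s in 𝓝 t, c s ∈ S)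
    (hS' : ∀ᶠ s in 𝓝 t, c' s ∈ S) :
    TangentCurves I' (fun s => f (c s)) (fun s => f (c' s)) t := by
  obtain ⟨h1, v, h2, h3⟩ := h
  exact ⟨congrArg f h1, _, h2.comp_within rfl hf hS, h3.comp_within h1.symm hf hS'⟩

theorem TangentCurves.comp {f : P → P'} (h : TangentCurves I c c' t)
    (hf : MDifferentiableAt I I' f (c t)) :
    TangentCurves I' (fun s => f (c s)) (fun s => f (c' s)) t :=
  h.comp_within hf.mdifferentiableWithinAt (S := univ) (by simp) (by simp)

theorem TangentCurves.prodMk {d d' : ℝ → P'} (h : TangentCurves I c c' t)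
    (h' : TangentCurves I' d d' t) :
    TangentCurves (I.prod I') (fun s => (c s, d s)) (fun s => (c' s, d' s)) t := by
  obtain ⟨h1, v, h2, h3⟩ := h
  obtain ⟨k1, w, k2, k3⟩ := h'
  exact ⟨Prod.ext h1 k1, (v, w), h2.prodMk k2, h3.prodMk k3⟩

end Velocity

/-! ### Derivatives of charts and stationary curves -/

section Boundaryless

variable {E P : Type*} [NormedAddCommGroup E] [NormedSpace ℝ E]
  [TopologicalSpace P] [ChartedSpace E P]

theorem mdifferentiableAt_chart {e : OpenPartialHomeomorph P E}
    (he : e ∈ IsManifold.maximalAtlas 𝓘(ℝ, E) ∞ P) {p : P} (hp : p ∈ e.source) :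
    MDifferentiableAt 𝓘(ℝ, E) 𝓘(ℝ, E) e p :=
  (contMDiffAt_of_mem_maximalAtlas he hp).mdifferentiableAt (by simp)

theorem mdifferentiableAt_chart_symm {e : OpenPartialHomeomorph P E}
    (he : e ∈ IsManifold.maximalAtlas 𝓘(ℝ, E) ∞ P) {z : E} (hz : z ∈ e.target) :
    MDifferentiableAt 𝓘(ℝ, E) 𝓘(ℝ, E) e.symm z :=
  (contMDiffAt_symm_of_mem_maximalAtlas he hz).mdifferentiableAt (by simp)

/-- Near p the composite `e.symm ∘ e` is the identity, so the derivative of `e.symm` is a left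
inverse. -/
theorem injective_mfderiv_of_mem_maximalAtlas {e : OpenPartialHomeomorph P E}
    (he : e ∈ IsManifold.maximalAtlas 𝓘(ℝ, E) ∞ P) {p : P} (hp : p ∈ e.source) :
    Function.Injective (mfderiv 𝓘(ℝ, E) 𝓘(ℝ, E) e p) := by
  have h1 := (mdifferentiableAt_chart_symm he (e.map_source hp)).hasMFDerivAt.comp p
    (mdifferentiableAt_chart he hp).hasMFDerivAt
  have h2 : HasMFDerivAt 𝓘(ℝ, E) 𝓘(ℝ, E) (e.symm ∘ e) p
      (ContinuousLinearMap.id ℝ (TangentSpace 𝓘(ℝ, E) p)) :=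
    (hasMFDerivAt_id p).congr_of_eventuallyEq (by
      filter_upwards [e.open_source.mem_nhds hp] with q hq using e.left_inv hq)
  have h3 : _ = (ContinuousLinearMap.id ℝ E : E →L[ℝ] E) := hasMFDerivAt_unique h1 h2
  intro v w hvw
  have := congrArg (mfderiv 𝓘(ℝ, E) 𝓘(ℝ, E) e.symm (e p)) hvw
  have hv := DFunLike.congr_fun h3 v
  have hw := DFunLike.congr_fun h3 w
  exact hv.symm.trans (this.trans hw)

theorem injective_mfderiv_chart_symm {e : OpenPartialHomeomorph P E}
    (he : e ∈ IsManifold.maximalAtlas 𝓘(ℝ, E) ∞ P) {z : E} (hz : z ∈ e.target) :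
    Function.Injective (mfderiv 𝓘(ℝ, E) 𝓘(ℝ, E) e.symm z) := by
  have h1 := (mdifferentiableAt_chart he (e.map_target hz)).hasMFDerivAt.comp z
    (mdifferentiableAt_chart_symm he hz).hasMFDerivAt
  have h2 : HasMFDerivAt 𝓘(ℝ, E) 𝓘(ℝ, E) (e ∘ e.symm) z
      (ContinuousLinearMap.id ℝ (TangentSpace 𝓘(ℝ, E) z)) :=
    (hasMFDerivAt_id z).congr_of_eventuallyEq (by
      filter_upwards [e.open_target.mem_nhds hz] with q hq using e.right_inv hq)
  have h3 : _ = (ContinuousLinearMap.id ℝ E : E →L[ℝ] E) := hasMFDerivAt_unique h1 h2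
  intro v w hvw
  have := congrArg (mfderiv 𝓘(ℝ, E) 𝓘(ℝ, E) e (e.symm z)) hvw
  have hv := DFunLike.congr_fun h3 v
  have hw := DFunLike.congr_fun h3 w
  exact hv.symm.trans (this.trans hw)

/-- A curve given in a chart has the velocity prescribed in that chart. -/
theorem hasVelocityAt_symm_of_mem_maximalAtlas {e : OpenPartialHomeomorph P E}
    (he : e ∈ IsManifold.maximalAtlas 𝓘(ℝ, E) ∞ P) {z : ℝ → E} {t : ℝ} {w : E}
    (hz : HasDerivAt z w t) (ht : z t ∈ e.target) {p : P} (hp : e.symm (z t) = p) (v : E)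
    (hv : mfderiv 𝓘(ℝ, E) 𝓘(ℝ, E) e p v = w) :
    HasVelocityAt 𝓘(ℝ, E) (fun s => e.symm (z s)) t v := by
  subst hp
  have h1 := hz.hasVelocityAt.comp rfl (mdifferentiableAt_chart_symm he ht)
  have h2 := h1.comp rfl (mdifferentiableAt_chart he (e.map_target ht))
  have h3 : HasVelocityAt 𝓘(ℝ, E) (fun s => e (e.symm (z s))) t w :=
    hz.hasVelocityAt.congr (by
      filter_upwards [hz.continuousAt.preimage_mem_nhds (e.open_target.mem_nhds ht)] with s hs
        using e.right_inv hs)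
  have h4 := injective_mfderiv_of_mem_maximalAtlas he (e.map_target ht)
    ((h2.unique h3).trans hv.symm)
  rwa [← h4]

/-- A curve whose velocity vanishes is constant; the manifold need not be Hausdorff. -/
theorem eq_of_hasVelocityAt_zero [IsManifold 𝓘(ℝ, E) ∞ P] {J : Set ℝ} (hJ : IsOpen J)
    (hJ' : IsPreconnected J) {c : ℝ → P} (hc : ∀ t ∈ J, HasVelocityAt 𝓘(ℝ, E) c t 0) {t t' : ℝ} (ht : t ∈ J)
    (ht' : t' ∈ J) : c t = c t' := by
  -- Local constancy needs only one chart at a time, and connectedness of J does the rest; no two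
  -- points of P are ever separated.
  have hloc : IsLocallyConstant (J.domRestrict c) := by
    rw [IsLocallyConstant.iff_eventually_eq]
    rintro ⟨r, hr⟩
    suffices h : ∀ᶠ s in 𝓝 r, c s = c r from
      (continuous_subtype_val.tendsto (⟨r, hr⟩ : J)).eventually h
    let e := chartAt E (c r)
    have he := IsManifold.chart_mem_maximalAtlas (I := 𝓘(ℝ, E)) (n := ∞) (c r)
    have h1 : ∀ᶠ s in 𝓝 r, c s ∈ e.source ∧ s ∈ J :=
      ((hc r hr).continuousAt.eventually_mem
        (e.open_source.mem_nhds (mem_chart_source E (c r)))).and (hJ.mem_nhds hr)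
    obtain ⟨δ, hδ, hball⟩ := Metric.eventually_nhds_iff_ball.1 h1
    have hd : ∀ s ∈ Metric.ball r δ, HasDerivAt (fun s => e (c s)) 0 s := by
      intro s hs
      have h2 := (hc s (hball s hs).2).comp rfl
        (mdifferentiableAt_chart he (hball s hs).1)
      exact (h2.hasDerivAt).congr_deriv (map_zero (mfderiv 𝓘(ℝ, E) 𝓘(ℝ, E) e (c s)))
    filter_upwards [Metric.ball_mem_nhds r hδ] with s hs
    have h4 := (convex_ball r δ).norm_image_sub_le_of_norm_hasDerivWithin_le (C := 0)
      (fun x hx => (hd x hx).hasDerivWithinAt) (by simp) (Metric.mem_ball_self hδ) hs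
    rw [zero_mul, norm_le_zero_iff, sub_eq_zero] at h4
    exact e.injOn (hball s hs).1 (hball r (Metric.mem_ball_self hδ)).1 h4
  have : PreconnectedSpace J := isPreconnected_iff_preconnectedSpace.1 hJ'
  exact hloc.apply_eq_of_preconnectedSpace ⟨t, ht⟩ ⟨t', ht'⟩

end Boundaryless

/-! ### Smooth families of tangent vectors -/

section Sections

variable {E H P : Type*} [NormedAddCommGroup E] [NormedSpace ℝ E] [TopologicalSpace H]
  {I : ModelWithCorners ℝ E H} [TopologicalSpace P] [ChartedSpace H P]
  {E' H' P' : Type*} [NormedAddCommGroup E'] [NormedSpace ℝ E'] [TopologicalSpace H']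
  {I' : ModelWithCorners ℝ E' H'} [TopologicalSpace P'] [ChartedSpace H' P']
  {E'' H'' Q : Type*} [NormedAddCommGroup E''] [NormedSpace ℝ E''] [TopologicalSpace H'']
  {J : ModelWithCorners ℝ E'' H''} [TopologicalSpace Q] [ChartedSpace H'' Q]

/-- Pairs of smooth maps into tangent bundles are smooth maps into the tangent bundle of the
product. -/
theorem ContMDiffOn.tangentBundle_prodMk [IsManifold I 1 P] [IsManifold I' 1 P'] {s : Set Q}
    {n : WithTop ℕ∞}
    {X : Q → TangentBundle I P} {Y : Q → TangentBundle I' P'}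
    (hX : ContMDiffOn J I.tangent n X s) (hY : ContMDiffOn J I'.tangent n Y s) :
    ContMDiffOn J (I.prod I').tangent n (fun q =>
      (⟨((X q).1, (Y q).1), ((X q).2, (Y q).2)⟩ : TangentBundle (I.prod I') (P × P'))) s :=
  (contMDiff_equivTangentBundleProd_symm (I := I) (I' := I') (M := P) (M' := P')).comp_contMDiffOn
    (hX.prodMk hY)

theorem contMDiff_tangentBundle_zero [IsManifold I 1 P] {n : WithTop ℕ∞} :
    ContMDiff I I.tangent n (fun p => (⟨p, 0⟩ : TangentBundle I P)) :=
  Bundle.contMDiff_zeroSection ℝ (TangentSpace I : P → Type _)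

theorem contMDiff_tangentBundle_one {n : WithTop ℕ∞} :
    ContMDiff 𝓘(ℝ, ℝ) 𝓘(ℝ, ℝ).tangent n
      (fun t => (⟨t, (1 : ℝ)⟩ : TangentBundle 𝓘(ℝ, ℝ) ℝ)) := by
  have h : ContMDiff 𝓘(ℝ, ℝ) (𝓘(ℝ, ℝ).prod 𝓘(ℝ, ℝ)) n (fun t : ℝ => (t, (1 : ℝ))) :=
    contMDiff_id.prodMk contMDiff_const
  rw [chartedSpaceSelf_prod] at h
  exact (contMDiff_tangentBundleModelSpaceHomeomorph_symm (I := 𝓘(ℝ, ℝ)) (n := n)).comp h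

/-- The velocities of the curves of a smooth family depend smoothly on the parameter. -/
theorem ContMDiffOn.contMDiffOn_velocity [IsManifold I 1 P] [IsManifold I' 1 P'] 
    {s : Set (P × ℝ)} (hs : IsOpen s) {F : P × ℝ → P'}
    (hF : ContMDiffOn (I.prod 𝓘(ℝ, ℝ)) I' ∞ F s) :
    ContMDiffOn (I.prod 𝓘(ℝ, ℝ)) I'.tangent ∞ (fun q => (⟨F q,
      mfderiv 𝓘(ℝ, ℝ) I' (fun t : ℝ => F (q.1, t)) q.2 (1 : ℝ)⟩ : TangentBundle I' P')) s := by
  -- The velocity is the tangent map of F evaluated on the smooth field (0, ∂/∂t).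
  have h1 := hF.contMDiffOn_tangentMapWithin (m := ∞) (by simp) hs.uniqueMDiffOn
  have h2 : ContMDiffOn (I.prod 𝓘(ℝ, ℝ)) (I.prod 𝓘(ℝ, ℝ)).tangent ∞ (fun q : P × ℝ =>
      (⟨(q.1, q.2), (0, 1)⟩ : TangentBundle (I.prod 𝓘(ℝ, ℝ)) (P × ℝ))) s :=
    ContMDiffOn.tangentBundle_prodMk
      ((contMDiff_tangentBundle_zero (I := I)).comp contMDiff_fst).contMDiffOn
      (contMDiff_tangentBundle_one.comp contMDiff_snd).contMDiffOn
  refine (h1.comp h2 (fun q hq => hq)).congr fun q hq => ?_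
  have h3 : MDifferentiableAt (I.prod 𝓘(ℝ, ℝ)) I' F q :=
    (hF.contMDiffAt (hs.mem_nhds hq)).mdifferentiableAt (by simp)
  have h4 : HasVelocityAt (I.prod 𝓘(ℝ, ℝ)) (fun t : ℝ => (q.1, t)) q.2 (0, 1) :=
    (hasVelocityAt_const q.1 q.2).prodMk (hasDerivAt_id q.2).hasVelocityAt
  have h5 := (h4.comp rfl h3).mfderiv_apply_one
  simp only [Function.comp_apply, tangentMapWithin, mfderivWithin_of_isOpen hs hq]
  rw [h5]

end Sections

/-! ### Local flows of time-dependent fields in a vector space -/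

section ModelFlow

variable {E : Type*} [NormedAddCommGroup E] [NormedSpace ℝ E] [FiniteDimensional ℝ E]

/-- A smooth time-dependent vector field on an open subset of a vector space has a smooth local
flow. -/
theorem exists_contDiffOn_local_flow {v : E × ℝ → E} {O : Set (E × ℝ)} (hO : IsOpen O)
    (hv : ContDiffOn ℝ ∞ v O) {z₀ : E} (h0 : (z₀, (0 : ℝ)) ∈ O) :
    ∃ U : Set E, IsOpen U ∧ z₀ ∈ U ∧ ∃ δ > 0, ∃ Fl : E × ℝ → E,
      ContDiffOn ℝ ∞ Fl (U ×ˢ Ioo (-δ) δ) ∧ (∀ z ∈ U, Fl (z, 0) = z) ∧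
      ∀ z ∈ U, ∀ t ∈ Ioo (-δ) δ, (Fl (z, t), t) ∈ O ∧
        HasDerivAt (fun s => Fl (z, s)) (v (Fl (z, t), t)) t := by
  obtain ⟨R, hR, hRO⟩ := Metric.nhds_basis_closedBall.mem_iff.1 (hO.mem_nhds h0)
  -- The suspended field (v, 1) is cut off: compact support makes it globally Lipschitz, and it is
  -- unchanged on the ball of radius R / 2.
  let χ : ContDiffBump (z₀, (0 : ℝ)) := ⟨R / 2, R, by positivity, by linarith⟩
  let f : E × ℝ → E × ℝ := fun q => χ q • (v q, (1 : ℝ))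
  have hf : ContDiff ℝ ∞ f := by
    rw [contDiff_iff_contDiffAt]
    intro q
    by_cases hq : q ∈ O
    · exact χ.contDiff.contDiffAt.smul ((hv.contDiffAt (hO.mem_nhds hq)).prodMk contDiffAt_const)
    · have hq' : q ∉ tsupport χ := fun h => hq (hRO (by rwa [χ.tsupport_eq] at h))
      refine contDiffAt_const (c := (0 : E × ℝ)) |>.congr_of_eventuallyEq ?_
      filter_upwards [notMem_tsupport_iff_eventuallyEq.1 hq'] with y hy
      simp only [f, hy, Pi.zero_apply, zero_smul]
  have hfc : HasCompactSupport f := χ.hasCompactSupport.smul_right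
  obtain ⟨L, hL⟩ := ContDiff.lipschitzWith_of_hasCompactSupport hfc hf (by simp)
  obtain ⟨δ₀, hδ₀, Fl, hFl, hFl0, hFld⟩ := exists_contDiffOn_flow f hf hL
  have hc : ContinuousAt (fun q : E × ℝ => Fl ((q.1, 0), q.2)) (z₀, 0) := by
    have h1 : ContinuousAt Fl ((z₀, (0 : ℝ)), (0 : ℝ)) :=
      (hFl.contDiffAt ((isOpen_univ.prod isOpen_Ioo).mem_nhds
        ⟨mem_univ _, by simpa using hδ₀⟩)).continuousAt
    exact ContinuousAt.comp (f := fun q : E × ℝ => ((q.1, (0 : ℝ)), q.2)) h1 (by fun_prop)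
  have hmem : ∀ᶠ q : E × ℝ in 𝓝 (z₀, 0), Fl ((q.1, 0), q.2) ∈ Metric.ball (z₀, (0 : ℝ)) (R / 2) ∧
      q.2 ∈ Ioo (-δ₀) δ₀ := by
    refine (hc.eventually_mem (Metric.isOpen_ball.mem_nhds ?_)).and
      (continuousAt_snd.eventually_mem (isOpen_Ioo.mem_nhds ?_))
    · simpa [hFl0] using hR
    · simpa using hδ₀
  obtain ⟨U, T, hU, hzU, hT, h0T, hUT⟩ := mem_nhds_prod_iff'.1 hmem
  obtain ⟨δ, hδ, hδT⟩ := Metric.isOpen_iff.1 hT 0 h0T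
  rw [Real.ball_eq_Ioo, zero_sub, zero_add] at hδT
  have hin : ∀ z ∈ U, ∀ t ∈ Ioo (-δ) δ,
      Fl ((z, 0), t) ∈ Metric.ball (z₀, (0 : ℝ)) (R / 2) ∧ t ∈ Ioo (-δ₀) δ₀ :=
    fun z hz t ht => hUT (show (z, t) ∈ U ×ˢ T from ⟨hz, hδT ht⟩)
  have hd : ∀ z ∈ U, ∀ t ∈ Ioo (-δ) δ,
      HasDerivAt (fun s => Fl ((z, 0), s)) (v (Fl ((z, 0), t)), 1) t := by
    intro z hz t ht
    obtain ⟨h1, h2⟩ := hin z hz t ht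
    have h3 := hFld (z, 0) t h2
    have h4 : χ (Fl ((z, 0), t)) = 1 := χ.one_of_mem_closedBall (Metric.ball_subset_closedBall h1)
    simpa only [f, h4, one_smul] using h3
  -- While χ = 1 the time coordinate has derivative 1 and starts at 0, so it is t; this recovers the
  -- non-autonomous equation.
  have hsnd : ∀ z ∈ U, ∀ t ∈ Ioo (-δ) δ, (Fl ((z, 0), t)).2 = t := by
    intro z hz t ht
    have h1 : ∀ t ∈ Ioo (-δ) δ,
        HasVelocityAt 𝓘(ℝ, ℝ) (fun s => (Fl ((z, 0), s)).2 - s) t 0 := by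
      intro t ht
      have h2 : HasDerivAt (fun s => (Fl ((z, 0), s)).2) 1 t :=
        (hasFDerivAt_snd (𝕜 := ℝ) (E := E) (F := ℝ)).comp_hasDerivAt t (hd z hz t ht)
      have h4 := h2.sub (hasDerivAt_id t)
      rw [sub_self] at h4
      exact h4.hasVelocityAt
    have h3 := eq_of_hasVelocityAt_zero isOpen_Ioo isPreconnected_Ioo h1 ht
      (show (0 : ℝ) ∈ Ioo (-δ) δ by simpa using hδ)
    simpa [hFl0, sub_eq_zero] using h3
  refine ⟨U, hU, hzU, δ, hδ, fun q => (Fl ((q.1, 0), q.2)).1, ?_, ?_, ?_⟩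
  · refine contDiff_fst.comp_contDiffOn (hFl.comp (f := fun q : E × ℝ => ((q.1, (0 : ℝ)), q.2))
      (by fun_prop) ?_)
    exact fun q hq => ⟨mem_univ _, (hin q.1 hq.1 q.2 hq.2).2⟩
  · intro z _
    simp [hFl0]
  · intro z hz t ht
    have h1 : ((Fl ((z, 0), t)).1, t) = Fl ((z, 0), t) := Prod.ext rfl (hsnd z hz t ht).symm
    refine ⟨?_, ?_⟩
    · rw [h1]
      refine hRO (Metric.ball_subset_closedBall (Metric.ball_subset_ball ?_ (hin z hz t ht).1))
      linarith
    · rw [h1]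
      exact (hasFDerivAt_fst (𝕜 := ℝ) (E := E) (F := ℝ)).comp_hasDerivAt t (hd z hz t ht)

end ModelFlow

/-! ### Local flows and uniqueness on manifolds -/

section ManifoldFlow

variable {E P : Type*} [NormedAddCommGroup E] [NormedSpace ℝ E] [TopologicalSpace P]
  [ChartedSpace E P] [IsManifold 𝓘(ℝ, E) ∞ P]
  {E'' H'' Q : Type*} [NormedAddCommGroup E''] [NormedSpace ℝ E''] [TopologicalSpace H'']
  {J : ModelWithCorners ℝ E'' H''} [TopologicalSpace Q] [ChartedSpace H'' Q]

/-- The principal part in a chart of a smooth family of tangent vectors is smooth. -/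
theorem ContMDiffOn.mfderiv_chart_apply {e : OpenPartialHomeomorph P E}
    (he : e ∈ IsManifold.maximalAtlas 𝓘(ℝ, E) ∞ P) {X : Q → TangentBundle 𝓘(ℝ, E) P} {s : Set Q}
    (hX : ContMDiffOn J 𝓘(ℝ, E).tangent ∞ X s) (hs : ∀ q ∈ s, (X q).1 ∈ e.source) :
    ContMDiffOn J 𝓘(ℝ, E) ∞
      (fun q => (mfderiv 𝓘(ℝ, E) 𝓘(ℝ, E) e (X q).1 (X q).2 : E)) s := by
  have : IsManifold 𝓘(ℝ, E) 1 P := IsManifold.of_le (n := ∞) (by simp)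
  have h1 := (contMDiffOn_of_mem_maximalAtlas he).contMDiffOn_tangentMapWithin (m := ∞) (by simp)
    e.open_source.uniqueMDiffOn
  have h2 := (contMDiff_snd_tangentBundle_modelSpace E 𝓘(ℝ, E)).comp_contMDiffOn (h1.comp hX hs)
  refine h2.congr fun q hq => ?_
  exact (DFunLike.congr_fun (mfderivWithin_of_isOpen e.open_source (hs q hq)) _).symm

/-- A smooth time-dependent vector field has a smooth local flow. -/
theorem exists_contMDiffOn_local_flow [FiniteDimensional ℝ E]
    {V : ℝ → (p : P) → TangentSpace 𝓘(ℝ, E) p}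
    {O : Set (P × ℝ)} (hO : IsOpen O)
    (hV : ContMDiffOn (𝓘(ℝ, E).prod 𝓘(ℝ, ℝ)) 𝓘(ℝ, E).tangent ∞
      (fun q : P × ℝ => (⟨q.1, V q.2 q.1⟩ : TangentBundle 𝓘(ℝ, E) P)) O)
    {p₀ : P} (h0 : (p₀, (0 : ℝ)) ∈ O) :
    ∃ U : Set P, IsOpen U ∧ p₀ ∈ U ∧ ∃ δ > 0, ∃ Fl : P × ℝ → P,
      ContMDiffOn (𝓘(ℝ, E).prod 𝓘(ℝ, ℝ)) 𝓘(ℝ, E) ∞ Fl (U ×ˢ Ioo (-δ) δ) ∧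
      (∀ p ∈ U, Fl (p, 0) = p) ∧
      ∀ p ∈ U, ∀ t ∈ Ioo (-δ) δ, (Fl (p, t), t) ∈ O ∧
        HasVelocityAt 𝓘(ℝ, E) (fun s => Fl (p, s)) t (V t (Fl (p, t))) := by
  let e := chartAt E p₀
  have he := IsManifold.chart_mem_maximalAtlas (I := 𝓘(ℝ, E)) (n := ∞) p₀
  have hp₀ : p₀ ∈ e.source := mem_chart_source E p₀
  let g : E × ℝ → P × ℝ := fun q => (e.symm q.1, q.2)
  have hgc : ContinuousOn g (e.target ×ˢ univ) :=
    (e.continuousOn_symm.comp continuousOn_fst (fun q hq => hq.1)).prodMk continuousOn_snd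
  let O' : Set (E × ℝ) := (e.target ×ˢ univ) ∩ g ⁻¹' O
  have hO' : IsOpen O' := hgc.isOpen_inter_preimage (e.open_target.prod isOpen_univ) hO
  have hg : ContMDiffOn 𝓘(ℝ, E × ℝ) (𝓘(ℝ, E).prod 𝓘(ℝ, ℝ)) ∞ g (e.target ×ˢ univ) := by
    have h1 : ContMDiffOn 𝓘(ℝ, E × ℝ) 𝓘(ℝ, E) ∞ (fun q : E × ℝ => e.symm q.1)
        (e.target ×ˢ univ) :=
      (contMDiffOn_symm_of_mem_maximalAtlas he).comp
        (contDiff_fst.contMDiff.contMDiffOn) (fun q hq => hq.1)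
    exact h1.prodMk contDiff_snd.contMDiff.contMDiffOn
  have hv : ContDiffOn ℝ ∞ (fun q : E × ℝ =>
      (mfderiv 𝓘(ℝ, E) 𝓘(ℝ, E) e (e.symm q.1) (V q.2 (e.symm q.1)) : E)) O' := by
    have h1 := hV.comp (hg.mono inter_subset_left : ContMDiffOn _ _ ∞ g O') (fun q hq => hq.2)
    exact (h1.mfderiv_chart_apply he (fun q hq => e.map_target hq.1.1)).contDiffOn
  have h0' : (e p₀, (0 : ℝ)) ∈ O' := ⟨⟨e.map_source hp₀, mem_univ _⟩, by
    change (e.symm (e p₀), (0 : ℝ)) ∈ O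
    rwa [e.left_inv hp₀]⟩
  obtain ⟨U, hU, hzU, δ, hδ, Fl, hFl, hFl0, hFld⟩ := exists_contDiffOn_local_flow hO' hv h0'
  refine ⟨e.source ∩ e ⁻¹' U, e.isOpen_inter_preimage hU, ⟨hp₀, hzU⟩, δ, hδ,
    fun q => e.symm (Fl (e q.1, q.2)), ?_, ?_, ?_⟩
  · have h1 : ContMDiffOn (𝓘(ℝ, E).prod 𝓘(ℝ, ℝ)) 𝓘(ℝ, E × ℝ) ∞ (fun q : P × ℝ => (e q.1, q.2))
        ((e.source ∩ e ⁻¹' U) ×ˢ Ioo (-δ) δ) := by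
      have := ((contMDiffOn_of_mem_maximalAtlas he).comp (contMDiffOn_fst
        (s := (e.source ∩ e ⁻¹' U) ×ˢ Ioo (-δ) δ) (J := 𝓘(ℝ, ℝ))) (fun q hq => hq.1.1)).prodMk_space
        contMDiffOn_snd
      exact this
    exact (contMDiffOn_symm_of_mem_maximalAtlas he).comp
      (hFl.contMDiffOn.comp h1 (fun q hq => ⟨hq.1.2, hq.2⟩))
      (fun q hq => (hFld _ hq.1.2 _ hq.2).1.1.1)
  · intro p hp
    simp only [hFl0 _ hp.2, e.left_inv hp.1]
  · intro p hp t ht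
    obtain ⟨h1, h2⟩ := hFld _ hp.2 t ht
    exact ⟨h1.2, hasVelocityAt_symm_of_mem_maximalAtlas he h2 h1.1.1 rfl _ rfl⟩

/-- Uniqueness of the integral curves of a smooth time-dependent vector field on a Hausdorff
manifold. -/
theorem eqOn_of_hasVelocityAt [T2Space P] {W : ℝ → (p : P) → TangentSpace 𝓘(ℝ, E) p}
    {S : Set ℝ} (hS : IsOpen S) (hS' : IsPreconnected S)
    (hW : ContMDiffOn (𝓘(ℝ, E).prod 𝓘(ℝ, ℝ)) 𝓘(ℝ, E).tangent ∞
      (fun q : P × ℝ => (⟨q.1, W q.2 q.1⟩ : TangentBundle 𝓘(ℝ, E) P)) (univ ×ˢ S))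
    [CompleteSpace E] {x y : ℝ → P} (hx : ∀ t ∈ S, HasVelocityAt 𝓘(ℝ, E) x t (W t (x t)))
    (hy : ∀ t ∈ S, HasVelocityAt 𝓘(ℝ, E) y t (W t (y t))) {t₀ : ℝ} (ht₀ : t₀ ∈ S)
    (h0 : x t₀ = y t₀) : EqOn x y S := by
  have : IsManifold 𝓘(ℝ, E) 1 P := IsManifold.of_le (n := ∞) (by simp)
  -- Suspension by (W, 1) turns the equation into an autonomous one, to which local uniqueness of
  -- integral curves applies.
  let v : (q : P × ℝ) → TangentSpace (𝓘(ℝ, E).prod 𝓘(ℝ, ℝ)) q := fun q => (W q.2 q.1, (1 : ℝ))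
  have hv := hW.tangentBundle_prodMk (contMDiff_tangentBundle_one.comp contMDiff_snd).contMDiffOn
  have hcurve : ∀ {z : ℝ → P}, (∀ t ∈ S, HasVelocityAt 𝓘(ℝ, E) z t (W t (z t))) →
      ∀ t ∈ S, IsMIntegralCurveAt (I := 𝓘(ℝ, E).prod 𝓘(ℝ, ℝ)) (fun t => (z t, t)) v t := by
    intro z hz t ht
    filter_upwards [hS.mem_nhds ht] with s hs
    exact (hz s hs).prodMk (hasDerivAt_id s).hasVelocityAt
  have hloc : ∀ t ∈ S, x t = y t → ∀ᶠ s in 𝓝 t, x s = y s := by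
    intro t ht hxy
    have h1 := isMIntegralCurveAt_eventuallyEq_of_contMDiffAt_boundaryless
      (I := 𝓘(ℝ, E).prod 𝓘(ℝ, ℝ)) (γ := fun t => (x t, t)) (γ' := fun t => (y t, t)) (v := v)
      ((hv.contMDiffAt ((isOpen_univ.prod hS).mem_nhds ⟨mem_univ _, ht⟩)).of_le (by simp))
      (hcurve hx t ht) (hcurve hy t ht) (by simp [hxy])
    exact h1.mono fun s hs => congrArg Prod.fst hs
  have hcont : ∀ {z : ℝ → P}, (∀ t ∈ S, HasVelocityAt 𝓘(ℝ, E) z t (W t (z t))) →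
      Continuous (S.domRestrict z) := fun hz =>
    continuousOn_iff_continuous_domRestrict.1 fun t ht => (hz t ht).continuousAt.continuousWithinAt
  have : PreconnectedSpace S := isPreconnected_iff_preconnectedSpace.1 hS'
  -- Closedness is the only step where Hausdorffness is invoked to pass from local to global
  -- agreement.
  have hclopen : IsClopen {t : S | x t = y t} := by
    refine ⟨isClosed_eq (hcont hx) (hcont hy), isOpen_iff_mem_nhds.2 ?_⟩
    rintro ⟨t, ht⟩ hxy
    exact (continuous_subtype_val.tendsto (⟨t, ht⟩ : S)).eventually (hloc t ht hxy)
  have huniv := hclopen.eq_univ ⟨⟨t₀, ht₀⟩, h0⟩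
  intro t ht
  have : (⟨t, ht⟩ : S) ∈ {t : S | x t = y t} := huniv ▸ mem_univ _
  exact this

end ManifoldFlow

/-! ### Inverse function theorem with a parameter -/

section ParametricInverse

variable {E : Type*} [NormedAddCommGroup E] [NormedSpace ℝ E] [FiniteDimensional ℝ E]

/-- Inverse function theorem with a real parameter, in a vector space. -/
theorem exists_contDiffOn_parametric_inverse {ψ : E × ℝ → E} {O : Set (E × ℝ)} (hO : IsOpen O)
    (hψ : ContDiffOn ℝ ∞ ψ O) {z₀ : E} {ε₀ : ℝ} (h0 : (z₀, ε₀) ∈ O) {A : E →L[ℝ] E}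
    (hA : HasFDerivAt (fun z => ψ (z, ε₀)) A z₀) (hinj : Function.Injective A) :
    ∃ O₁ ⊆ O, IsOpen O₁ ∧ (z₀, ε₀) ∈ O₁ ∧ ∃ O₂ : Set (E × ℝ), IsOpen O₂ ∧ ∃ inv : E × ℝ → E,
      ContDiffOn ℝ ∞ inv O₂ ∧ (∀ q ∈ O₂, (inv q, q.2) ∈ O₁ ∧ ψ (inv q, q.2) = q.1) ∧
      ∀ q ∈ O₁, (ψ q, q.2) ∈ O₂ ∧ inv (ψ q, q.2) = q.1 := by
  -- Carrying ε along reduces to the ordinary inverse function theorem. The derivative is block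
  -- triangular with blocks A and 1, hence injective.
  let Θ : E × ℝ → E × ℝ := fun q => (ψ q, q.2)
  have hΘ : ContDiffOn ℝ ∞ Θ O := hψ.prodMk contDiffOn_snd
  have hΘat : ∀ q ∈ O, ContDiffAt ℝ ∞ Θ q := fun q hq => hΘ.contDiffAt (hO.mem_nhds hq)
  have hΘd : ∀ q ∈ O, HasFDerivAt Θ (fderiv ℝ Θ q) q := fun q hq =>
    ((hΘat q hq).differentiableAt (by simp)).hasFDerivAt
  have hinj' : Function.Injective (fderiv ℝ Θ (z₀, ε₀)) := by
    refine (injective_iff_map_eq_zero _).2 ?_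
    rintro ⟨a, r⟩ hv
    have h1 := (hasFDerivAt_snd (𝕜 := ℝ)).comp (z₀, ε₀) (hΘd _ h0)
    have h2 := h1.unique (hasFDerivAt_snd (𝕜 := ℝ) (p := (z₀, ε₀)))
    have h3 := DFunLike.congr_fun h2 (a, r)
    have hr : r = 0 := by simpa [hv] using h3.symm
    subst hr
    have h4 : HasFDerivAt (fun z => Θ (z, ε₀)) _ z₀ :=
      (hΘd _ h0).comp z₀ (hasFDerivAt_prodMk_left (𝕜 := ℝ) z₀ ε₀)
    have h5 := (hasFDerivAt_fst (𝕜 := ℝ)).comp z₀ h4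
    have h6 := DFunLike.congr_fun (h5.unique hA) a
    have h7 : A a = 0 := by simpa [hv] using h6.symm
    rw [(injective_iff_map_eq_zero A).1 hinj a h7]
    rfl
  let L : (E × ℝ) ≃L[ℝ] (E × ℝ) := (LinearEquiv.ofInjectiveEndo
    (fderiv ℝ Θ (z₀, ε₀)).toLinearMap hinj').toContinuousLinearEquiv
  have hL : (L : E × ℝ →L[ℝ] E × ℝ) = fderiv ℝ Θ (z₀, ε₀) := by
    exact ContinuousLinearMap.ext fun _ => rfl
  have hLd : HasFDerivAt Θ (L : E × ℝ →L[ℝ] E × ℝ) (z₀, ε₀) := hL ▸ hΘd _ h0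
  let h := (hΘat _ h0).toOpenPartialHomeomorph Θ hLd (by simp)
  have hcoe : ∀ q, h q = Θ q := fun q => rfl
  -- Restricting to points with invertible derivative makes the inverse smooth on its whole domain,
  -- not only at the image of the base point.
  let O' : Set (E × ℝ) := O ∩ fderiv ℝ Θ ⁻¹' range
    ((↑) : ((E × ℝ) ≃L[ℝ] (E × ℝ)) → ((E × ℝ) →L[ℝ] (E × ℝ)))
  have hO' : IsOpen O' :=
    (hΘ.continuousOn_fderiv_of_isOpen hO (by simp)).isOpen_inter_preimage hO
      ContinuousLinearEquiv.isOpen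
  let k := h.restrOpen O' hO'
  have hk : ∀ q, k q = Θ q := fun q => rfl
  have hks : k.source = h.source ∩ O' := rfl
  have hk0 : (z₀, ε₀) ∈ k.source :=
    ⟨(hΘat _ h0).mem_toOpenPartialHomeomorph_source hLd (by simp), h0, L, hL⟩
  have hsymm : ∀ q ∈ k.target, ψ (k.symm q) = q.1 ∧ (k.symm q).2 = q.2 := by
    intro q hq
    have h1 : Θ (k.symm q) = q := k.right_inv hq
    exact ⟨congrArg Prod.fst h1, (congrArg Prod.snd h1 : (Θ (k.symm q)).2 = q.2)⟩
  refine ⟨k.source, fun q hq => hq.2.1, k.open_source, hk0, k.target, k.open_target,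
    fun q => (k.symm q).1, ?_, ?_, ?_⟩
  · intro q hq
    have h1 := k.map_target hq
    obtain ⟨B, hB⟩ := h1.2.2
    have h2 : ContDiffAt ℝ ∞ k.symm q := k.contDiffAt_symm hq (f₀' := B)
      (by rw [hB]; exact hΘd _ h1.2.1) (hΘat _ h1.2.1)
    exact (contDiff_fst.contDiffAt.comp q h2).contDiffWithinAt
  · intro q hq
    have h1 : ((k.symm q).1, q.2) = k.symm q := Prod.ext rfl (hsymm q hq).2.symm
    rw [h1]
    exact ⟨k.map_target hq, (hsymm q hq).1⟩
  · intro q hq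
    exact ⟨k.map_source hq, congrArg Prod.fst (k.left_inv hq)⟩

variable {P : Type*} [TopologicalSpace P] [ChartedSpace E P] [IsManifold 𝓘(ℝ, E) ∞ P]

/-- Inverse function theorem with a real parameter, on a manifold. -/
theorem exists_contMDiffOn_parametric_inverse {ψ : P × ℝ → P} {O : Set (P × ℝ)} (hO : IsOpen O)
    (hψ : ContMDiffOn (𝓘(ℝ, E).prod 𝓘(ℝ, ℝ)) 𝓘(ℝ, E) ∞ ψ O) {p₀ : P} {ε₀ : ℝ}
    (h0 : (p₀, ε₀) ∈ O)
    (hinj : Function.Injective (mfderiv 𝓘(ℝ, E) 𝓘(ℝ, E) (fun p => ψ (p, ε₀)) p₀)) :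
    ∃ O₁ ⊆ O, IsOpen O₁ ∧ (p₀, ε₀) ∈ O₁ ∧ ∃ O₂ : Set (P × ℝ), IsOpen O₂ ∧ ∃ inv : P × ℝ → P,
      ContMDiffOn (𝓘(ℝ, E).prod 𝓘(ℝ, ℝ)) 𝓘(ℝ, E) ∞ inv O₂ ∧
      (∀ q ∈ O₂, (inv q, q.2) ∈ O₁ ∧ ψ (inv q, q.2) = q.1) ∧
      ∀ q ∈ O₁, (ψ q, q.2) ∈ O₂ ∧ inv (ψ q, q.2) = q.1 := by
  let e := chartAt E p₀
  have he := IsManifold.chart_mem_maximalAtlas (I := 𝓘(ℝ, E)) (n := ∞) p₀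
  have hp₀ : p₀ ∈ e.source := mem_chart_source E p₀
  let e' := chartAt E (ψ (p₀, ε₀))
  have he' := IsManifold.chart_mem_maximalAtlas (I := 𝓘(ℝ, E)) (n := ∞) (ψ (p₀, ε₀))
  have hp₀' : ψ (p₀, ε₀) ∈ e'.source := mem_chart_source E _
  let Oψ : Set (P × ℝ) := O ∩ ψ ⁻¹' e'.source
  have hOψ : IsOpen Oψ := hψ.continuousOn.isOpen_inter_preimage hO e'.open_source
  let g : E × ℝ → P × ℝ := fun q => (e.symm q.1, q.2)
  have hgc : ContinuousOn g (e.target ×ˢ univ) :=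
    (e.continuousOn_symm.comp continuousOn_fst (fun q hq => hq.1)).prodMk continuousOn_snd
  let O' : Set (E × ℝ) := (e.target ×ˢ univ) ∩ g ⁻¹' Oψ
  have hO' : IsOpen O' := hgc.isOpen_inter_preimage (e.open_target.prod isOpen_univ) hOψ
  have hg : ContMDiffOn 𝓘(ℝ, E × ℝ) (𝓘(ℝ, E).prod 𝓘(ℝ, ℝ)) ∞ g (e.target ×ˢ univ) := by
    have h1 : ContMDiffOn 𝓘(ℝ, E × ℝ) 𝓘(ℝ, E) ∞ (fun q : E × ℝ => e.symm q.1)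
        (e.target ×ˢ univ) :=
      (contMDiffOn_symm_of_mem_maximalAtlas he).comp
        (contDiff_fst.contMDiff.contMDiffOn) (fun q hq => hq.1)
    exact h1.prodMk contDiff_snd.contMDiff.contMDiffOn
  have hψ' : ContDiffOn ℝ ∞ (fun q => e' (ψ (g q))) O' :=
    ((contMDiffOn_of_mem_maximalAtlas he').comp (hψ.comp (hg.mono inter_subset_left)
      (fun q hq => hq.2.1)) (fun q hq => hq.2.2)).contDiffOn
  have hz : e p₀ ∈ e.target := e.map_source hp₀
  have hgz : g (e p₀, ε₀) = (p₀, ε₀) := Prod.ext (e.left_inv hp₀) rfl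
  have h0' : (e p₀, ε₀) ∈ O' := ⟨⟨hz, mem_univ _⟩, by
    rw [mem_preimage, hgz]
    exact ⟨h0, hp₀'⟩⟩
  have hψ₀ : MDifferentiableAt 𝓘(ℝ, E) 𝓘(ℝ, E) (fun p => ψ (p, ε₀)) p₀ := by
    have h1 : ContMDiffAt (𝓘(ℝ, E).prod 𝓘(ℝ, ℝ)) 𝓘(ℝ, E) ∞ ψ (p₀, ε₀) :=
      hψ.contMDiffAt (hO.mem_nhds h0)
    exact (h1.comp p₀ (contMDiffAt_id.prodMk contMDiffAt_const)).mdifferentiableAt (by simp)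
  have hd : HasMFDerivAt 𝓘(ℝ, E) 𝓘(ℝ, E) (fun z => e' (ψ (g (z, ε₀)))) (e p₀)
      ((mfderiv 𝓘(ℝ, E) 𝓘(ℝ, E) e' (ψ (p₀, ε₀))).comp
        ((mfderiv 𝓘(ℝ, E) 𝓘(ℝ, E) (fun p => ψ (p, ε₀)) p₀).comp
          (mfderiv 𝓘(ℝ, E) 𝓘(ℝ, E) e.symm (e p₀)))) := by
    have h1 := (mdifferentiableAt_chart_symm he hz).hasMFDerivAt
    have h2 := HasMFDerivAt.comp (g := fun p => ψ (p, ε₀)) (e p₀)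
      (by rw [e.left_inv hp₀]; exact hψ₀.hasMFDerivAt) h1
    refine HasMFDerivAt.comp (g := e') (f := (fun p => ψ (p, ε₀)) ∘ e.symm) (e p₀) ?_ h2
    rw [Function.comp_apply, e.left_inv hp₀]
    exact (mdifferentiableAt_chart he' hp₀').hasMFDerivAt
  have hA := hd.hasFDerivAt
  obtain ⟨O₁, hO₁, hO₁o, hO₁0, O₂, hO₂o, inv, hinv, hr, hl⟩ :=
    exists_contDiffOn_parametric_inverse hO' hψ' h0' hA
      ((injective_mfderiv_of_mem_maximalAtlas he' hp₀').comp
        (hinj.comp (injective_mfderiv_chart_symm he hz)))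
  let a : P × ℝ → E × ℝ := fun q => (e q.1, q.2)
  let a' : P × ℝ → E × ℝ := fun q => (e' q.1, q.2)
  have ha : ContinuousOn a (e.source ×ˢ univ) :=
    (e.continuousOn.comp continuousOn_fst (fun q hq => hq.1)).prodMk continuousOn_snd
  have ha' : ContMDiffOn (𝓘(ℝ, E).prod 𝓘(ℝ, ℝ)) 𝓘(ℝ, E × ℝ) ∞ a' (e'.source ×ˢ univ) :=
    ((contMDiffOn_of_mem_maximalAtlas he').comp (contMDiffOn_fst
        (s := e'.source ×ˢ univ) (J := 𝓘(ℝ, ℝ))) (fun q hq => hq.1)).prodMk_space contMDiffOn_snd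
  have hga : ∀ q ∈ e.source ×ˢ (univ : Set ℝ), g (a q) = q := fun q hq =>
    Prod.ext (e.left_inv hq.1) rfl
  refine ⟨(e.source ×ˢ univ) ∩ a ⁻¹' O₁, ?_, ha.isOpen_inter_preimage
    (e.open_source.prod isOpen_univ) hO₁o, ⟨⟨hp₀, mem_univ _⟩, hO₁0⟩,
    (e'.source ×ˢ univ) ∩ a' ⁻¹' O₂, ha'.continuousOn.isOpen_inter_preimage
    (e'.open_source.prod isOpen_univ) hO₂o, fun q => e.symm (inv (a' q)), ?_, ?_, ?_⟩
  · rintro q ⟨hq1, hq2⟩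
    have := (hO₁ hq2).2.1
    rwa [hga q hq1] at this
  · exact (contMDiffOn_symm_of_mem_maximalAtlas he).comp
      (hinv.contMDiffOn.comp (ha'.mono inter_subset_left) (fun q hq => hq.2))
      (fun q hq => (hO₁ (hr _ hq.2).1).1.1)
  · rintro q ⟨hq1, hq2⟩
    obtain ⟨h1, h2⟩ := hr _ hq2
    have h3 := hO₁ h1
    refine ⟨⟨⟨e.map_target h3.1.1, mem_univ _⟩, ?_⟩, ?_⟩
    · have : a (e.symm (inv (a' q)), q.2) = (inv (a' q), q.2) :=
        Prod.ext (e.right_inv h3.1.1) rfl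
      rw [mem_preimage, this]
      exact h1
    · exact e'.injOn h3.2.2 hq1.1 h2
  · rintro q ⟨hq1, hq2⟩
    obtain ⟨h1, h2⟩ := hl _ hq2
    rw [hga q hq1] at h1 h2
    have h3 := (hO₁ hq2).2.2
    rw [hga q hq1] at h3
    exact ⟨⟨⟨h3, mem_univ _⟩, h1⟩, (congrArg e.symm h2).trans (e.left_inv hq1.1)⟩

end ParametricInverse

/-! ### Groupoid algebra and velocities of products -/

namespace LieGroupoid

variable {EG G EM M : Type*}
  [NormedAddCommGroup EG] [NormedSpace ℝ EG] [TopologicalSpace G] [ChartedSpace EG G]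
  [NormedAddCommGroup EM] [NormedSpace ℝ EM] [TopologicalSpace M] [ChartedSpace EM M]
  (𝓖 : LieGroupoid EG G EM M)

/-- Every tangent space is definitionally the model space, so casts disappear once velocities are
read in `EG`. -/
theorem tangentCast_eq {p q : G} (h : p = q) (v : TangentSpace 𝓘(ℝ, EG) p) :
    (tangentCast h v : EG) = v := by
  subst h
  rfl

theorem contMDiff_source [IsManifold 𝓘(ℝ, EG) ∞ G] [IsManifold 𝓘(ℝ, EM) ∞ M] :
    ContMDiff 𝓘(ℝ, EG) 𝓘(ℝ, EM) ∞ 𝓖.source := 𝓖.submersion_source.contMDiff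

theorem contMDiff_target [IsManifold 𝓘(ℝ, EG) ∞ G] [IsManifold 𝓘(ℝ, EM) ∞ M] :
    ContMDiff 𝓘(ℝ, EG) 𝓘(ℝ, EM) ∞ 𝓖.target := 𝓖.submersion_target.contMDiff

theorem inv_mul_cancel_left {g h : G} (hgh : 𝓖.source g = 𝓖.target h) :
    𝓖.mul (𝓖.inv g) (𝓖.mul g h) = h := by
  rw [← 𝓖.mul_assoc _ _ _ (𝓖.source_inv g) hgh, 𝓖.inv_mul, hgh, 𝓖.unit_mul]

theorem mul_inv_cancel_left {g h : G} (hgh : 𝓖.target g = 𝓖.target h) :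
    𝓖.mul g (𝓖.mul (𝓖.inv g) h) = h := by
  rw [← 𝓖.mul_assoc _ _ _ (𝓖.target_inv g).symm (by rw [𝓖.source_inv, hgh]), 𝓖.mul_inv, hgh,
    𝓖.unit_mul]

theorem mul_inv_cancel_right {g h : G} (hgh : 𝓖.source g = 𝓖.target h) :
    𝓖.mul (𝓖.mul g h) (𝓖.inv h) = g := by
  rw [𝓖.mul_assoc _ _ _ hgh (𝓖.target_inv h).symm, 𝓖.mul_inv, ← hgh, 𝓖.mul_unit]

theorem mul_left_cancel {g h k : G} (hh : 𝓖.source g = 𝓖.target h)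
    (hk : 𝓖.source g = 𝓖.target k) (e : 𝓖.mul g h = 𝓖.mul g k) : h = k := by
  rw [← 𝓖.inv_mul_cancel_left hh, e, 𝓖.inv_mul_cancel_left hk]

theorem mul_inv_rev {g h : G} (hgh : 𝓖.source g = 𝓖.target h) :
    𝓖.inv (𝓖.mul g h) = 𝓖.mul (𝓖.inv h) (𝓖.inv g) := by
  have h1 : 𝓖.source (𝓖.inv h) = 𝓖.target (𝓖.inv g) := by
    rw [𝓖.source_inv, 𝓖.target_inv, hgh]
  have h2 : 𝓖.source (𝓖.mul g h) = 𝓖.target (𝓖.mul (𝓖.inv h) (𝓖.inv g)) := by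
    rw [𝓖.source_mul _ _ hgh, 𝓖.target_mul _ _ h1, 𝓖.target_inv]
  refine 𝓖.mul_left_cancel (g := 𝓖.mul g h) (𝓖.target_inv _).symm h2 ?_
  rw [𝓖.mul_inv, 𝓖.target_mul _ _ hgh, 𝓖.mul_assoc _ _ _ hgh
    (by rw [𝓖.target_mul _ _ h1, 𝓖.target_inv]), 𝓖.mul_inv_cancel_left
    (by rw [𝓖.target_inv, hgh]), 𝓖.mul_inv]

/-- The cancellation that makes quotients of curves `a p` and `a y` independent of `a`. -/
theorem inv_mul_mul_cancel {a p y : G} (hp : 𝓖.source a = 𝓖.target p)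
    (hy : 𝓖.source a = 𝓖.target y) :
    𝓖.mul (𝓖.inv (𝓖.mul a p)) (𝓖.mul a y) = 𝓖.mul (𝓖.inv p) y := by
  rw [𝓖.mul_inv_rev hp, 𝓖.mul_assoc _ _ _ (by rw [𝓖.source_inv, 𝓖.target_inv, hp])
    (by rw [𝓖.source_inv, 𝓖.target_mul _ _ hy]), 𝓖.inv_mul_cancel_left hy]

theorem mdifferentiableWithinAt_mul {g h : G} (hgh : 𝓖.source g = 𝓖.target h) :
    MDifferentiableWithinAt (𝓘(ℝ, EG).prod 𝓘(ℝ, EG)) 𝓘(ℝ, EG) (fun p : G × G => 𝓖.mul p.1 p.2)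
      {p : G × G | 𝓖.source p.1 = 𝓖.target p.2} (g, h) :=
  (𝓖.smooth_mul (g, h) hgh).mdifferentiableWithinAt (by simp)

theorem mdifferentiableAt_inv (g : G) : MDifferentiableAt 𝓘(ℝ, EG) 𝓘(ℝ, EG) 𝓖.inv g :=
  𝓖.smooth_inv.contMDiffAt.mdifferentiableAt (by simp)

-- Multiplication is differentiable only within the composable pairs, so both pairs of curves have
-- to remain composable near t.
variable {𝓖} in
theorem tangentCurves_mul {c c' d d' : ℝ → G} {t : ℝ} (h : TangentCurves 𝓘(ℝ, EG) c c' t)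
    (k : TangentCurves 𝓘(ℝ, EG) d d' t) (hcd : ∀ᶠ s in 𝓝 t, 𝓖.source (c s) = 𝓖.target (d s))
    (hcd' : ∀ᶠ s in 𝓝 t, 𝓖.source (c' s) = 𝓖.target (d' s)) :
    TangentCurves 𝓘(ℝ, EG) (fun s => 𝓖.mul (c s) (d s)) (fun s => 𝓖.mul (c' s) (d' s)) t :=
  (h.prodMk k).comp_within (𝓖.mdifferentiableWithinAt_mul hcd.self_of_nhds) hcd hcd'

theorem tangentCurves_inv {c c' : ℝ → G} {t : ℝ} (h : TangentCurves 𝓘(ℝ, EG) c c' t) :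
    TangentCurves 𝓘(ℝ, EG) (fun s => 𝓖.inv (c s)) (fun s => 𝓖.inv (c' s)) t :=
  h.comp (𝓖.mdifferentiableAt_inv _)

/-- The velocity of `a g` for a curve `a` in a source fibre, starting at a unit. -/
theorem hasVelocityAt_mul_right {a : ℝ → G} {t : ℝ} {g : G} {x : M} (hx : 𝓖.target g = x)
    {A : TangentSpace 𝓘(ℝ, EG) (𝓖.unit x)} (ha : HasVelocityAt 𝓘(ℝ, EG) a t A)
    (ha0 : a t = 𝓖.unit x) (has : ∀ᶠ s in 𝓝 t, 𝓖.source (a s) = x) :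
    HasVelocityAt 𝓘(ℝ, EG) (fun s => 𝓖.mul (a s) g) t (𝓖.rightTranslate g hx A) := by
  have h1 : MDifferentiableWithinAt 𝓘(ℝ, EG) 𝓘(ℝ, EG) (fun k => 𝓖.mul k g)
      {k | 𝓖.source k = x} (𝓖.unit x) := by
    refine MDifferentiableWithinAt.comp (u := {p : G × G | 𝓖.source p.1 = 𝓖.target p.2})
      (I' := 𝓘(ℝ, EG).prod 𝓘(ℝ, EG)) (g := fun p : G × G => 𝓖.mul p.1 p.2)
      (f := fun k => (k, g)) (𝓖.unit x)
      (𝓖.mdifferentiableWithinAt_mul (by rw [𝓖.source_unit, hx]))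
      (mdifferentiableWithinAt_id.prodMk mdifferentiableWithinAt_const)
      (fun k hk => hk.trans hx.symm)
  have h2 := ha.comp_within ha0 h1 has
  unfold rightTranslate
  rwa [← tangentCast_eq (q := g) (by rw [← hx, 𝓖.unit_mul])
    (mfderivWithin 𝓘(ℝ, EG) 𝓘(ℝ, EG) (fun k => 𝓖.mul k g) _ (𝓖.unit x) A)] at h2

/-- The velocity of `g d` for a curve `d` in a target fibre, starting at a unit. -/
theorem hasVelocityAt_mul_left {d : ℝ → G} {t : ℝ} {g : G} {x : M} (hx : 𝓖.source g = x)
    {B : TangentSpace 𝓘(ℝ, EG) (𝓖.inv (𝓖.unit x))} (hd : HasVelocityAt 𝓘(ℝ, EG) d t B)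
    (hd0 : d t = 𝓖.inv (𝓖.unit x)) (hdt : ∀ᶠ s in 𝓝 t, 𝓖.target (d s) = x) :
    HasVelocityAt 𝓘(ℝ, EG) (fun s => 𝓖.mul g (d s)) t (𝓖.leftTranslate g hx B) := by
  have h1 : MDifferentiableWithinAt 𝓘(ℝ, EG) 𝓘(ℝ, EG) (fun k => 𝓖.mul g k)
      {k | 𝓖.target k = x} (𝓖.inv (𝓖.unit x)) := by
    refine MDifferentiableWithinAt.comp (u := {p : G × G | 𝓖.source p.1 = 𝓖.target p.2})
      (I' := 𝓘(ℝ, EG).prod 𝓘(ℝ, EG)) (g := fun p : G × G => 𝓖.mul p.1 p.2)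
      (f := fun k => (g, k)) (𝓖.inv (𝓖.unit x))
      (𝓖.mdifferentiableWithinAt_mul (by rw [𝓖.target_inv, 𝓖.source_unit, hx]))
      (mdifferentiableWithinAt_const.prodMk mdifferentiableWithinAt_id)
      (fun k hk => hx.trans (Eq.symm hk))
  have h2 := hd.comp_within hd0 h1 hdt
  unfold leftTranslate
  rwa [← tangentCast_eq (q := g) (by rw [← hx, 𝓖.inv_unit, 𝓖.mul_unit])
    (mfderivWithin 𝓘(ℝ, EG) 𝓘(ℝ, EG) (fun k => 𝓖.mul g k) _ (𝓖.inv (𝓖.unit x)) B)] at h2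

/-- The velocity of `a g b⁻¹` for curves `a` and `b` in source fibres, starting at units. -/
theorem hasVelocityAt_mul_mul_inv {a b : ℝ → G} {t : ℝ} {g : G} {x y : M} (hx : 𝓖.target g = x)
    (hy : 𝓖.source g = y) {A : TangentSpace 𝓘(ℝ, EG) (𝓖.unit x)}
    {B : TangentSpace 𝓘(ℝ, EG) (𝓖.unit y)}
    (ha : HasVelocityAt 𝓘(ℝ, EG) a t A) (ha0 : a t = 𝓖.unit x)
    (has : ∀ᶠ s in 𝓝 t, 𝓖.source (a s) = x)
    (hb : HasVelocityAt 𝓘(ℝ, EG) b t B) (hb0 : b t = 𝓖.unit y)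
    (hbs : ∀ᶠ s in 𝓝 t, 𝓖.source (b s) = y) :
    HasVelocityAt 𝓘(ℝ, EG) (fun s => 𝓖.mul (𝓖.mul (a s) g) (𝓖.inv (b s))) t
      (𝓖.rightTranslate g hx A +
        𝓖.leftTranslate g hy (mfderiv 𝓘(ℝ, EG) 𝓘(ℝ, EG) 𝓖.inv (𝓖.unit y) B)) := by
  have hag := 𝓖.hasVelocityAt_mul_right hx ha ha0 has
  have hd : HasVelocityAt 𝓘(ℝ, EG) (fun s => 𝓖.inv (b s)) t _ :=
    hb.comp hb0 (𝓖.mdifferentiableAt_inv _)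
  have hd0 : 𝓖.inv (b t) = 𝓖.inv (𝓖.unit y) := by rw [hb0]
  have hgd := 𝓖.hasVelocityAt_mul_left hy hd hd0 (hbs.mono fun s hs => by rw [𝓖.target_inv, hs])
  have hu : 𝓖.source g = 𝓖.target (𝓖.unit y) := by rw [𝓖.target_unit, hy]
  have hag0 : 𝓖.mul (a t) g = g := by rw [ha0, ← hx, 𝓖.unit_mul]
  have hd0' : 𝓖.inv (b t) = 𝓖.unit y := by rw [hd0, 𝓖.inv_unit]
  have hsag : ∀ᶠ s in 𝓝 t, 𝓖.source (𝓖.mul (a s) g) = y :=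
    has.mono fun s hs => by rw [𝓖.source_mul _ _ (hs.trans hx.symm), hy]
  have htd : ∀ᶠ s in 𝓝 t, 𝓖.target (𝓖.inv (b s)) = y :=
    hbs.mono fun s hs => by rw [𝓖.target_inv, hs]
  -- The pairs (a g, b⁻¹), (a g, 1_y) and (g, b⁻¹) all stay composable, so one within-derivative at
  -- (g, 1_y) computes the three velocities, and its linearity adds the last two.
  have h0 := (hag.prodMk hd).comp_within (p := (g, 𝓖.unit y)) (Prod.ext hag0 hd0')
    (𝓖.mdifferentiableWithinAt_mul hu)
    ((hsag.and htd).mono fun s hs => hs.1.trans hs.2.symm)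
  have h1 := (hag.prodMk (hasVelocityAt_const (I := 𝓘(ℝ, EG)) (𝓖.unit y) t)).comp_within
    (p := (g, 𝓖.unit y)) (Prod.ext hag0 rfl) (𝓖.mdifferentiableWithinAt_mul hu)
    (hsag.mono fun s hs => hs.trans (𝓖.target_unit y).symm)
  have h2 := ((hasVelocityAt_const (I := 𝓘(ℝ, EG)) g t).prodMk hd).comp_within
    (p := (g, 𝓖.unit y)) (Prod.ext rfl hd0') (𝓖.mdifferentiableWithinAt_mul hu)
    (htd.mono fun s hs => hy.trans hs.symm)
  have h1' := h1.unique (hag.congr (hsag.mono fun s hs => by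
    change 𝓖.mul (𝓖.mul (a s) g) (𝓖.unit y) = 𝓖.mul (a s) g
    rw [← hs, 𝓖.mul_unit]))
  have h2' := h2.unique hgd
  rw [← h1', ← h2']
  refine (congrArg (HasVelocityAt 𝓘(ℝ, EG) _ t) ?_).mp h0
  let L : EG × EG →L[ℝ] EG := mfderivWithin (𝓘(ℝ, EG).prod 𝓘(ℝ, EG)) 𝓘(ℝ, EG)
    (fun p : G × G => 𝓖.mul p.1 p.2) {p : G × G | 𝓖.source p.1 = 𝓖.target p.2} (g, 𝓖.unit y)
  have hL : ∀ v w : EG, L (v, w) = L (v, 0) + L (0, w) := fun v w => by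
    rw [← map_add, Prod.mk_add_mk, add_zero, zero_add]
  exact hL _ _

/-- If `p' = r_p(A)`, `q' = r_q(B)` and `Φ' = r_Φ(A) + l_Φ(di(B))` then `p⁻¹ Φ q` is stationary. -/
theorem hasVelocityAt_zero_of_conj {p q Φ : ℝ → G} {t : ℝ} {x y : M}
    {a b : ℝ → G} {A : TangentSpace 𝓘(ℝ, EG) (𝓖.unit x)}
    {B : TangentSpace 𝓘(ℝ, EG) (𝓖.unit y)}
    (ha : HasVelocityAt 𝓘(ℝ, EG) a t A) (ha0 : a t = 𝓖.unit x)
    (has : ∀ᶠ s in 𝓝 t, 𝓖.source (a s) = x)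
    (hb : HasVelocityAt 𝓘(ℝ, EG) b t B) (hb0 : b t = 𝓖.unit y)
    (hbs : ∀ᶠ s in 𝓝 t, 𝓖.source (b s) = y)
    (hpx : 𝓖.target (p t) = x) (hqy : 𝓖.target (q t) = y)
    (hΦx : 𝓖.target (Φ t) = x) (hΦy : 𝓖.source (Φ t) = y)
    (hp : HasVelocityAt 𝓘(ℝ, EG) p t (𝓖.rightTranslate (p t) hpx A))
    (hq : HasVelocityAt 𝓘(ℝ, EG) q t (𝓖.rightTranslate (q t) hqy B))
    (hΦ : HasVelocityAt 𝓘(ℝ, EG) Φ t (𝓖.rightTranslate (Φ t) hΦx A +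
        𝓖.leftTranslate (Φ t) hΦy (mfderiv 𝓘(ℝ, EG) 𝓘(ℝ, EG) 𝓖.inv (𝓖.unit y) B)))
    (hpΦ : ∀ᶠ s in 𝓝 t, 𝓖.target (p s) = 𝓖.target (Φ s))
    (hΦq : ∀ᶠ s in 𝓝 t, 𝓖.source (Φ s) = 𝓖.target (q s)) :
    HasVelocityAt 𝓘(ℝ, EG) (fun s => 𝓖.mul (𝓖.inv (p s)) (𝓖.mul (Φ s) (q s))) t 0 := by
  -- Up to tangency, p, q and Φ become a p(t), b q(t) and a Φ(t) b⁻¹. In the product p⁻¹ Φ q the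
  -- factors a and b cancel, leaving a constant.
  have hap : TangentCurves 𝓘(ℝ, EG) p (fun s => 𝓖.mul (a s) (p t)) t :=
    hp.tangentCurves (𝓖.hasVelocityAt_mul_right hpx ha ha0 has)
      (by rw [ha0, ← hpx, 𝓖.unit_mul])
  have hbq : TangentCurves 𝓘(ℝ, EG) q (fun s => 𝓖.mul (b s) (q t)) t :=
    hq.tangentCurves (𝓖.hasVelocityAt_mul_right hqy hb hb0 hbs)
      (by rw [hb0, ← hqy, 𝓖.unit_mul])
  have haΦ : TangentCurves 𝓘(ℝ, EG) Φ (fun s => 𝓖.mul (𝓖.mul (a s) (Φ t)) (𝓖.inv (b s))) t :=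
    hΦ.tangentCurves (𝓖.hasVelocityAt_mul_mul_inv hΦx hΦy ha ha0 has hb hb0 hbs)
      (by rw [ha0, ← hΦx, 𝓖.unit_mul, hb0, 𝓖.inv_unit, ← hΦy, 𝓖.mul_unit])
  have hsab : ∀ᶠ s in 𝓝 t, 𝓖.source (𝓖.mul (𝓖.mul (a s) (Φ t)) (𝓖.inv (b s))) =
      𝓖.target (𝓖.mul (b s) (q t)) := by
    filter_upwards [has, hbs] with s hs hs'
    have h1 : 𝓖.source (a s) = 𝓖.target (Φ t) := hs.trans hΦx.symm
    have h2 : 𝓖.source (𝓖.mul (a s) (Φ t)) = 𝓖.target (𝓖.inv (b s)) := by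
      rw [𝓖.source_mul _ _ h1, 𝓖.target_inv, hΦy, hs']
    rw [𝓖.source_mul _ _ h2, 𝓖.target_mul _ _ (hs'.trans hqy.symm), 𝓖.source_inv]
  have h1 := tangentCurves_mul haΦ hbq hΦq hsab
  have h2 := tangentCurves_mul (𝓖.tangentCurves_inv hap) h1
    (by filter_upwards [hpΦ, hΦq] with s hs hs'
        rw [𝓖.source_inv, 𝓖.target_mul _ _ hs', hs])
    (by filter_upwards [has, hbs, hsab] with s hs hs' hs''
        have h1 : 𝓖.source (a s) = 𝓖.target (Φ t) := hs.trans hΦx.symm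
        have h2 : 𝓖.source (𝓖.mul (a s) (Φ t)) = 𝓖.target (𝓖.inv (b s)) := by
          rw [𝓖.source_mul _ _ h1, 𝓖.target_inv, hΦy, hs']
        rw [𝓖.source_inv, 𝓖.target_mul _ _ hs'', 𝓖.target_mul _ _ h2, 𝓖.target_mul _ _ h1,
          𝓖.target_mul _ _ (hs.trans hpx.symm)])
  refine h2.velocity ((hasVelocityAt_const (𝓖.mul (𝓖.inv (p t)) (𝓖.mul (Φ t) (q t))) t).congr ?_)
  filter_upwards [has, hbs] with s hs hs'
  have h1 : 𝓖.source (a s) = 𝓖.target (Φ t) := hs.trans hΦx.symm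
  have h2 : 𝓖.source (𝓖.mul (a s) (Φ t)) = 𝓖.target (𝓖.inv (b s)) := by
    rw [𝓖.source_mul _ _ h1, 𝓖.target_inv, hΦy, hs']
  have h3 : 𝓖.source (b s) = 𝓖.target (q t) := hs'.trans hqy.symm
  rw [𝓖.mul_assoc _ _ _ h2 (by rw [𝓖.source_inv, 𝓖.target_mul _ _ h3]),
    𝓖.inv_mul_cancel_left h3, 𝓖.mul_assoc _ _ _ h1 (by rw [hΦy, hqy]),
    𝓖.inv_mul_mul_cancel (hs.trans hpx.symm) (by rw [𝓖.target_mul _ _ (by rw [hΦy, hqy]), h1])]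

end LieGroupoid

/-! ### Curves in source fibres and right-invariant fields -/

namespace LieGroupoid

variable {EG G EM M : Type*}
  [NormedAddCommGroup EG] [NormedSpace ℝ EG] [TopologicalSpace G] [ChartedSpace EG G]
  [NormedAddCommGroup EM] [NormedSpace ℝ EM] [TopologicalSpace M] [ChartedSpace EM M]
  (𝓖 : LieGroupoid EG G EM M)
  [IsManifold 𝓘(ℝ, EG) ∞ G] [IsManifold 𝓘(ℝ, EM) ∞ M]

/-- A chart of `G` around `1_{x₀}` in which the affine lines through units in the directions of the
algebroid are contained in source fibres. -/
theorem exists_chart_source (x₀ : M) : ∃ e ∈ IsManifold.maximalAtlas 𝓘(ℝ, EG) ∞ G,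
    𝓖.unit x₀ ∈ e.source ∧ ∀ x, 𝓖.unit x ∈ e.source → ∀ (A : 𝓖.algebroidFiber x) (w : EG),
      mfderiv 𝓘(ℝ, EG) 𝓘(ℝ, EG) e (𝓖.unit x) A = w → ∀ r : ℝ,
      e (𝓖.unit x) + r • w ∈ e.target → 𝓖.source (e.symm (e (𝓖.unit x) + r • w)) = x := by
  -- In submersion charts the source is a linear projection. A direction in the kernel of its
  -- differential has zero projection, so the whole line stays in the fibre.
  have h := 𝓖.submersion_source.isSubmersionAt (𝓖.unit x₀)
  let e := h.domChart
  let e' := h.codChart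
  have he : e ∈ IsManifold.maximalAtlas 𝓘(ℝ, EG) ∞ G := h.domChart_mem_maximalAtlas
  have he' : e' ∈ IsManifold.maximalAtlas 𝓘(ℝ, EM) ∞ M := h.codChart_mem_maximalAtlas
  have hee' : ∀ g ∈ e.source, 𝓖.source g ∈ e'.source := h.source_subset_preimage_source
  have hw : ∀ z ∈ e.target, e' (𝓖.source (e.symm z)) = (h.equiv z).1 := by
    intro z hz
    exact h.writtenInCharts (show z ∈ (h.domChart.extend 𝓘(ℝ, EG)).target by
      simpa [mfld_simps] using hz)
  refine ⟨e, he, h.mem_domChart_source, ?_⟩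
  intro x hx A w hwdef r hr
  have hux : e (𝓖.unit x) ∈ e.target := e.map_source hx
  have hline : HasDerivAt (fun r : ℝ => e (𝓖.unit x) + r • w) w 0 := by
    simpa using ((hasDerivAt_id (0 : ℝ)).smul_const w).const_add (e (𝓖.unit x))
  have h0 : e (𝓖.unit x) + (0 : ℝ) • w ∈ e.target := by simpa using hux
  have h0' : e.symm (e (𝓖.unit x) + (0 : ℝ) • w) = 𝓖.unit x := by simpa using e.left_inv hx
  have h1 := hasVelocityAt_symm_of_mem_maximalAtlas he hline h0 h0'
    (A : TangentSpace 𝓘(ℝ, EG) (𝓖.unit x)) hwdef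
  have h2 := h1.comp h0' ((𝓖.contMDiff_source _).mdifferentiableAt (by simp))
  have h3 : HasVelocityAt 𝓘(ℝ, EM)
      (fun r : ℝ => 𝓖.source (e.symm (e (𝓖.unit x) + r • w))) 0 0 := by
    rwa [show mfderiv 𝓘(ℝ, EG) 𝓘(ℝ, EM) 𝓖.source (𝓖.unit x) A = 0 from A.2] at h2
  have h4 := h3.comp rfl (mdifferentiableAt_chart he'
    (hee' _ (e.map_target h0)))
  have h5 : HasDerivAt (fun r : ℝ => e' (𝓖.source (e.symm (e (𝓖.unit x) + r • w)))) 0 0 :=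
    h4.hasDerivAt.congr_deriv (map_zero (mfderiv 𝓘(ℝ, EM) 𝓘(ℝ, EM) e' _))
  have h6 : HasDerivAt (fun r : ℝ => (h.equiv (e (𝓖.unit x) + r • w)).1) (h.equiv w).1 0 :=
    ((ContinuousLinearMap.fst ℝ EM h.complement).comp
      (h.equiv : EG →L[ℝ] EM × h.complement)).hasFDerivAt.comp_hasDerivAt 0 hline
  -- Both functions express the base coordinate along the line; one derivative is the projection of
  -- w, the other vanishes because A lies in ker ds.
  have h7 : (h.equiv w).1 = 0 := by
    refine h6.unique (h5.congr_of_eventuallyEq ?_)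
    filter_upwards [hline.continuousAt.eventually_mem (e.open_target.mem_nhds h0)] with s hs
      using (hw _ hs).symm
  refine e'.injOn (hee' _ (e.map_target hr)) (by simpa only [𝓖.source_unit] using hee' _ hx) ?_
  have h8 := hw _ hux
  rw [e.left_inv hx, 𝓖.source_unit] at h8
  rw [hw _ hr, map_add, map_smul, Prod.fst_add, Prod.smul_fst, h7, smul_zero, add_zero, h8]

/-- Every element of the algebroid is the velocity of a curve in a source fibre. -/
theorem exists_curve_of_algebroidFiber {x : M} (A : 𝓖.algebroidFiber x) (t : ℝ) :
    ∃ a : ℝ → G, a t = 𝓖.unit x ∧ (∀ᶠ s in 𝓝 t, 𝓖.source (a s) = x) ∧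
      HasVelocityAt 𝓘(ℝ, EG) a t (A : TangentSpace 𝓘(ℝ, EG) (𝓖.unit x)) := by
  obtain ⟨e, he, hx, hs⟩ := 𝓖.exists_chart_source x
  obtain ⟨w, hwdef⟩ : ∃ w : EG, mfderiv 𝓘(ℝ, EG) 𝓘(ℝ, EG) e (𝓖.unit x) A = w := ⟨_, rfl⟩
  have hline : HasDerivAt (fun r : ℝ => e (𝓖.unit x) + (r - t) • w) w t := by
    simpa using (((hasDerivAt_id t).sub_const t).smul_const w).const_add (e (𝓖.unit x))
  have h0 : e (𝓖.unit x) + (t - t) • w ∈ e.target := by simpa using e.map_source hx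
  have h0' : e.symm (e (𝓖.unit x) + (t - t) • w) = 𝓖.unit x := by simpa using e.left_inv hx
  refine ⟨fun r => e.symm (e (𝓖.unit x) + (r - t) • w), h0', ?_,
    hasVelocityAt_symm_of_mem_maximalAtlas he hline h0 h0'
      (A : TangentSpace 𝓘(ℝ, EG) (𝓖.unit x)) hwdef⟩
  filter_upwards [hline.continuousAt.eventually_mem (e.open_target.mem_nhds h0)] with s hs'
    using hs x hx A w hwdef (s - t) hs'

/-- A smooth family of sections of the algebroid is locally the velocity of a smooth family of
curves in the source fibres. -/
theorem exists_smooth_curves {J : Set ℝ} (hJ : IsOpen J)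
    {α : ℝ → (x : M) → 𝓖.algebroidFiber x} (hα : 𝓖.IsSmoothSectionFamily J α) (x₀ : M) :
    ∃ U : Set M, IsOpen U ∧ x₀ ∈ U ∧ ∃ O : Set ((M × ℝ) × ℝ), IsOpen O ∧
      ∃ a : (M × ℝ) × ℝ → G,
        ContMDiffOn ((𝓘(ℝ, EM).prod 𝓘(ℝ, ℝ)).prod 𝓘(ℝ, ℝ)) 𝓘(ℝ, EG) ∞ a O ∧
        (∀ q ∈ O, 𝓖.source (a q) = q.1.1) ∧
        ∀ x ∈ U, ∀ ε ∈ J, ((x, ε), (0 : ℝ)) ∈ O ∧ a ((x, ε), 0) = 𝓖.unit x ∧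
          HasVelocityAt 𝓘(ℝ, EG) (fun r => a ((x, ε), r)) 0
            (α ε x : TangentSpace 𝓘(ℝ, EG) (𝓖.unit x)) := by
  obtain ⟨e, he, hx₀, hs⟩ := 𝓖.exists_chart_source x₀
  let U : Set M := 𝓖.unit ⁻¹' e.source
  have hU : IsOpen U := e.open_source.preimage 𝓖.smooth_unit.continuous
  let w : M × ℝ → EG := fun q => mfderiv 𝓘(ℝ, EG) 𝓘(ℝ, EG) e (𝓖.unit q.1) (α q.2 q.1)
  have hw : ContMDiffOn (𝓘(ℝ, EM).prod 𝓘(ℝ, ℝ)) 𝓘(ℝ, EG) ∞ w (U ×ˢ J) :=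
    (hα.mono (prod_mono_left (subset_univ U))).mfderiv_chart_apply he (fun q hq => hq.1)
  have heu : ContMDiffOn (𝓘(ℝ, EM).prod 𝓘(ℝ, ℝ)) 𝓘(ℝ, EG) ∞ (fun q : M × ℝ => e (𝓖.unit q.1))
      (U ×ˢ J) :=
    (contMDiffOn_of_mem_maximalAtlas he).comp
      (𝓖.smooth_unit.comp contMDiff_fst).contMDiffOn (fun q hq => hq.1)
  -- The curve is a straight line in the chart with the principal part of α as direction, so joint
  -- smoothness in x, ε and r is visible.
  let b : (M × ℝ) × ℝ → EG := fun q => e (𝓖.unit q.1.1) + q.2 • w q.1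
  have hb : ContMDiffOn ((𝓘(ℝ, EM).prod 𝓘(ℝ, ℝ)).prod 𝓘(ℝ, ℝ)) 𝓘(ℝ, EG) ∞ b
      ((U ×ˢ J) ×ˢ univ) :=
    (heu.comp contMDiffOn_fst (fun q hq => hq.1)).add
      (contMDiffOn_snd.smul (hw.comp contMDiffOn_fst (fun q hq => hq.1)))
  have h0 : ∀ x ∈ U, ∀ ε, b ((x, ε), 0) = e (𝓖.unit x) := fun x _ ε => by simp [b]
  refine ⟨U, hU, hx₀, ((U ×ˢ J) ×ˢ univ) ∩ b ⁻¹' e.target,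
    hb.continuousOn.isOpen_inter_preimage ((hU.prod hJ).prod isOpen_univ) e.open_target,
    fun q => e.symm (b q), ?_, ?_, ?_⟩
  · exact (contMDiffOn_symm_of_mem_maximalAtlas he).comp (hb.mono inter_subset_left)
      (fun q hq => hq.2)
  · intro q hq
    exact hs q.1.1 hq.1.1.1 (α q.1.2 q.1.1) _ rfl q.2 hq.2
  · intro x hx ε hε
    have hmem : b ((x, ε), 0) ∈ e.target := by rw [h0 x hx ε]; exact e.map_source hx
    have h0' : e.symm (b ((x, ε), 0)) = 𝓖.unit x := by rw [h0 x hx ε]; exact e.left_inv hx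
    have hline : HasDerivAt (fun r : ℝ => b ((x, ε), r)) (w (x, ε)) 0 := by
      have h1 := ((hasDerivAt_id (0 : ℝ)).smul_const (w (x, ε))).const_add (e (𝓖.unit x))
      rwa [one_smul] at h1
    exact ⟨⟨⟨⟨hx, hε⟩, mem_univ _⟩, hmem⟩, h0',
      hasVelocityAt_symm_of_mem_maximalAtlas he hline hmem h0'
        (α ε x : TangentSpace 𝓘(ℝ, EG) (𝓖.unit x)) rfl⟩

theorem _root_.tangentBundle_mk_eq {E P : Type*} [NormedAddCommGroup E] [NormedSpace ℝ E]
    [TopologicalSpace P] [ChartedSpace E P] {p q : P} (h : p = q)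
    {v : TangentSpace 𝓘(ℝ, E) p} {w : TangentSpace 𝓘(ℝ, E) q} (hv : (v : E) = w) :
    (⟨p, v⟩ : TangentBundle 𝓘(ℝ, E) P) = ⟨q, w⟩ := by
  subst h
  exact congrArg _ hv

/-- The right-invariant time-dependent vector field defined by a smooth family of sections of the
algebroid is smooth. -/
theorem contMDiffOn_rightTranslate {J : Set ℝ} (hJ : IsOpen J)
    {α : ℝ → (x : M) → 𝓖.algebroidFiber x} (hα : 𝓖.IsSmoothSectionFamily J α) :
    ContMDiffOn (𝓘(ℝ, EG).prod 𝓘(ℝ, ℝ)) 𝓘(ℝ, EG).tangent ∞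
      (fun q : G × ℝ => (⟨q.1, 𝓖.rightTranslate q.1 rfl (α q.2 (𝓖.target q.1))⟩ :
        TangentBundle 𝓘(ℝ, EG) G)) (univ ×ˢ J) := by
  have : IsManifold 𝓘(ℝ, EG) 1 G := IsManifold.of_le (n := ∞) (by simp)
  rintro ⟨g₀, ε₀⟩ ⟨-, hε₀⟩
  obtain ⟨U, hU, hxU, O, hO, a, ha, has, ha0⟩ := 𝓖.exists_smooth_curves hJ hα (𝓖.target g₀)
  let T : (G × ℝ) × ℝ → (M × ℝ) × ℝ := fun q => ((𝓖.target q.1.1, q.1.2), q.2)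
  have hT : ContMDiff ((𝓘(ℝ, EG).prod 𝓘(ℝ, ℝ)).prod 𝓘(ℝ, ℝ))
      ((𝓘(ℝ, EM).prod 𝓘(ℝ, ℝ)).prod 𝓘(ℝ, ℝ)) ∞ T :=
    (((𝓖.contMDiff_target.comp contMDiff_fst).prodMk contMDiff_snd).comp contMDiff_fst).prodMk
      contMDiff_snd
  have hOT : IsOpen (T ⁻¹' O) := hO.preimage hT.continuous
  -- A fibrewise within-derivative shows no smoothness in g. It is recovered as the r-velocity at 0
  -- of this jointly smooth map, whose factors are composable on the chosen domain.
  let F : (G × ℝ) × ℝ → G := fun q => 𝓖.mul (a (T q)) q.1.1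
  have hF : ContMDiffOn ((𝓘(ℝ, EG).prod 𝓘(ℝ, ℝ)).prod 𝓘(ℝ, ℝ)) 𝓘(ℝ, EG) ∞ F (T ⁻¹' O) :=
    𝓖.smooth_mul.comp ((ha.comp hT.contMDiffOn (fun q hq => hq)).prodMk
      (contMDiff_fst.comp contMDiff_fst).contMDiffOn) (fun q hq => has _ hq)
  have hV := hF.contMDiffOn_velocity hOT
  let S : Set (G × ℝ) := (𝓖.target ⁻¹' U) ×ˢ J
  have hS : IsOpen S := (hU.preimage 𝓖.contMDiff_target.continuous).prod hJ
  have hz : ContMDiff (𝓘(ℝ, EG).prod 𝓘(ℝ, ℝ)) ((𝓘(ℝ, EG).prod 𝓘(ℝ, ℝ)).prod 𝓘(ℝ, ℝ)) ∞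
      (fun q : G × ℝ => (q, (0 : ℝ))) := contMDiff_id.prodMk contMDiff_const
  have h1 := hV.comp (hz.contMDiffOn (s := S)) (fun q hq => (ha0 _ hq.1 _ hq.2).1)
  refine ContMDiffAt.contMDiffWithinAt ((h1.congr fun q hq => ?_).contMDiffAt
    (hS.mem_nhds ⟨hxU, hε₀⟩))
  obtain ⟨h2, h3, h4⟩ := ha0 _ hq.1 _ hq.2
  have h5 := 𝓖.hasVelocityAt_mul_right (g := q.1) rfl h4 h3 (by
    have hc : ContinuousAt (fun r : ℝ => ((𝓖.target q.1, q.2), r)) 0 := by fun_prop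
    filter_upwards [hc.eventually_mem (hO.mem_nhds h2)] with s hs using has _ hs)
  refine tangentBundle_mk_eq ?_ h5.mfderiv_apply_one.symm
  change q.1 = 𝓖.mul (a ((𝓖.target q.1, q.2), 0)) q.1
  rw [h3, 𝓖.unit_mul]

end LieGroupoid

/-! ### From strong triviality to exactness -/

namespace LieGroupoid

variable {EG G EM M : Type*}
  [NormedAddCommGroup EG] [NormedSpace ℝ EG] [TopologicalSpace G] [ChartedSpace EG G]
  [NormedAddCommGroup EM] [NormedSpace ℝ EM] [TopologicalSpace M] [ChartedSpace EM M]
  (𝓖 : LieGroupoid EG G EM M)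

theorem inv_inv (g : G) : 𝓖.inv (𝓖.inv g) = g := by
  have h1 : 𝓖.source (𝓖.inv g) = 𝓖.target (𝓖.inv (𝓖.inv g)) := (𝓖.target_inv _).symm
  refine 𝓖.mul_left_cancel h1 (𝓖.source_inv g) ?_
  rw [𝓖.mul_inv, 𝓖.inv_mul, 𝓖.target_inv]

theorem target_conj {σ : M → G} (hσ : ∀ x, 𝓖.source (σ x) = x) (g : G) :
    𝓖.target (𝓖.conj σ g) = 𝓖.target (σ (𝓖.target g)) := by
  have h1 := hσ (𝓖.target g)
  unfold conj
  rw [𝓖.target_mul _ _ (by rw [𝓖.source_mul _ _ h1, 𝓖.target_inv, hσ]), 𝓖.target_mul _ _ h1]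

/-- Conjugation by one bisection in terms of conjugation by another. -/
theorem conj_eq_mul_conj_mul {σ ρ : M → G} (hσ : ∀ x, 𝓖.source (σ x) = x)
    (hρ : ∀ x, 𝓖.source (ρ x) = x) (g : G) :
    𝓖.conj ρ g = 𝓖.mul (𝓖.mul (𝓖.mul (ρ (𝓖.target g)) (𝓖.inv (σ (𝓖.target g)))) (𝓖.conj σ g))
      (𝓖.inv (𝓖.mul (ρ (𝓖.source g)) (𝓖.inv (σ (𝓖.source g))))) := by
  have ht := hσ (𝓖.target g)
  have hs := hσ (𝓖.source g)
  have ht' := hρ (𝓖.target g)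
  have hs' := hρ (𝓖.source g)
  unfold conj
  generalize σ (𝓖.target g) = a at *
  generalize σ (𝓖.source g) = b at *
  generalize ρ (𝓖.target g) = c at *
  generalize ρ (𝓖.source g) = d at *
  have h1 : 𝓖.source c = 𝓖.target (𝓖.inv a) := by rw [𝓖.target_inv, ht, ht']
  have h2 : 𝓖.source (𝓖.mul a g) = 𝓖.target (𝓖.inv b) := by
    rw [𝓖.source_mul _ _ ht, 𝓖.target_inv, hs]
  have h3 : 𝓖.source d = 𝓖.target (𝓖.inv b) := by rw [𝓖.target_inv, hs, hs']
  have h4 : 𝓖.source (𝓖.mul c (𝓖.inv a)) = 𝓖.target (𝓖.mul a g) := by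
    rw [𝓖.source_mul _ _ h1, 𝓖.source_inv, 𝓖.target_mul _ _ ht]
  have h5 : 𝓖.source (𝓖.mul c g) = 𝓖.target (𝓖.inv b) := by
    rw [𝓖.source_mul _ _ ht', 𝓖.target_inv, hs]
  rw [𝓖.mul_inv_rev h3, 𝓖.inv_inv, ← 𝓖.mul_assoc _ _ _ h4 h2, 𝓖.mul_assoc _ _ _ h1
    (by rw [𝓖.source_inv, 𝓖.target_mul _ _ ht]), 𝓖.inv_mul_cancel_left ht,
    𝓖.mul_assoc _ _ _ h5 (by rw [𝓖.source_inv, 𝓖.target_mul _ _ (by rw [𝓖.target_inv, hs, hs'])]),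
    𝓖.inv_mul_cancel_left (by rw [𝓖.target_inv, hs, hs'])]

variable {EH H EN N : Type*}
  [NormedAddCommGroup EH] [NormedSpace ℝ EH] [TopologicalSpace H] [ChartedSpace EH H]
  [NormedAddCommGroup EN] [NormedSpace ℝ EN] [TopologicalSpace N] [ChartedSpace EN N]

-- The arrow map determines the base map, so a relation between arrow maps also yields one between
-- base maps.
variable {𝓖} in
theorem IsMorphism.base_eq {𝓗 : LieGroupoid EH H EN N} {Φ : H → G} {φ : N → M}
    (h : IsMorphism 𝓗 𝓖 Φ φ) (y : N) :
    φ y = 𝓖.target (Φ (𝓗.unit y)) := by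
  rw [h.map_target, 𝓗.target_unit]

variable [IsManifold 𝓘(ℝ, EG) ∞ G] [IsManifold 𝓘(ℝ, EM) ∞ M]

/-- The inverses of the base diffeomorphisms of a smooth family of bisections depend smoothly on the
parameter. -/
theorem IsSmoothBisectionFamily.exists_smooth_inverse [FiniteDimensional ℝ EM] {J : Set ℝ}
    (hJ : IsOpen J) {σ : ℝ → M → G} (hσ : 𝓖.IsSmoothBisectionFamily J σ) :
    ∃ τ : M × ℝ → M, ContMDiffOn (𝓘(ℝ, EM).prod 𝓘(ℝ, ℝ)) 𝓘(ℝ, EM) ∞ τ (univ ×ˢ J) ∧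
      ∀ x, ∀ ε ∈ J, 𝓖.target (σ ε (τ (x, ε))) = x ∧ τ (𝓖.target (σ ε x), ε) = x := by
  -- A default diffeomorphism for ε outside J.
  have : Nonempty (M ≃ₘ^∞⟮𝓘(ℝ, EM), 𝓘(ℝ, EM)⟯ M) := ⟨Diffeomorph.refl _ M _⟩
  choose! e he using fun ε hε => (hσ.2 ε hε).2.2
  let ψ : M × ℝ → M := fun q => 𝓖.target (σ q.2 q.1)
  have hψ : ContMDiffOn (𝓘(ℝ, EM).prod 𝓘(ℝ, ℝ)) 𝓘(ℝ, EM) ∞ ψ (univ ×ˢ J) :=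
    𝓖.contMDiff_target.comp_contMDiffOn hσ.1
  have hO : IsOpen ((univ : Set M) ×ˢ J) := isOpen_univ.prod hJ
  refine ⟨fun q => (e q.2).symm q.1, ?_, ?_⟩
  · rintro ⟨x₁, ε₁⟩ ⟨-, hε₁⟩
    have hfun : (fun p => ψ (p, ε₁)) = e ε₁ := funext fun p => (he ε₁ hε₁ p).symm
    -- The global inverses, chosen separately for each ε, coincide locally with a smooth parametric
    -- inverse because each `e ε` is injective.
    obtain ⟨O₁, hO₁, -, h1, O₂, hO₂, inv, hinv, hr, hl⟩ := exists_contMDiffOn_parametric_inverse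
      hO hψ (p₀ := (e ε₁).symm x₁) (ε₀ := ε₁) ⟨mem_univ _, hε₁⟩ (by
        rw [hfun, ← (e ε₁).mfderivToContinuousLinearEquiv_coe (by simp)]
        exact ContinuousLinearEquiv.injective _)
    have h2 : (x₁, ε₁) ∈ O₂ := by
      have := (hl _ h1).1
      rwa [show ψ ((e ε₁).symm x₁, ε₁) = x₁ from
        (congrFun hfun _).trans ((e ε₁).apply_symm_apply x₁)] at this
    refine ContMDiffAt.contMDiffWithinAt ((hinv.congr fun q hq => ?_).contMDiffAt
      (hO₂.mem_nhds h2))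
    obtain ⟨h3, h4⟩ := hr q hq
    have h5 : q.2 ∈ J := (hO₁ h3).2
    have h6 : e q.2 (inv q) = q.1 := (he q.2 h5 _).trans h4
    rw [← h6, Diffeomorph.symm_apply_apply]
  · intro x ε hε
    refine ⟨?_, ?_⟩
    · rw [← he ε hε, Diffeomorph.apply_symm_apply]
    · change (e ε).symm _ = x
      rw [← he ε hε, Diffeomorph.symm_apply_apply]

/-- The logarithmic derivative of a smooth family of bisections. -/
theorem IsSmoothBisectionFamily.exists_section [FiniteDimensional ℝ EM] {J : Set ℝ}
    (hJ : IsOpen J) {σ : ℝ → M → G} (hσ : 𝓖.IsSmoothBisectionFamily J σ) :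
    ∃ α : ℝ → (x : M) → 𝓖.algebroidFiber x, 𝓖.IsSmoothSectionFamily J α ∧
      ∀ ε ∈ J, ∀ x, HasVelocityAt 𝓘(ℝ, EG) (fun l => 𝓖.mul (σ l x) (𝓖.inv (σ ε x))) ε
        (α ε (𝓖.target (σ ε x)) : TangentSpace 𝓘(ℝ, EG) (𝓖.unit (𝓖.target (σ ε x)))) := by
  have hG1 : IsManifold 𝓘(ℝ, EG) 1 G := IsManifold.of_le (n := ∞) (by simp)
  have hM1 : IsManifold 𝓘(ℝ, EM) 1 M := IsManifold.of_le (n := ∞) (by simp)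
  obtain ⟨τ, hτ, hτσ⟩ := hσ.exists_smooth_inverse 𝓖 hJ
  -- Composition with τ indexes by the target: l ↦ F ((x, ε), l) passes through 1_x at l = ε and
  -- stays in the source fibre of x for l in J. Its velocity there is α_ε(x).
  let F : (M × ℝ) × ℝ → G := fun q => 𝓖.mul (σ q.2 (τ q.1)) (𝓖.inv (σ q.1.2 (τ q.1)))
  have hs : ∀ ε ∈ J, ∀ x, 𝓖.source (σ ε x) = x := fun ε hε => (hσ.2 ε hε).2.1
  let O : Set ((M × ℝ) × ℝ) := (univ ×ˢ J) ×ˢ J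
  have hO : IsOpen O := (isOpen_univ.prod hJ).prod hJ
  have hcomp : ∀ q ∈ O, 𝓖.source (σ q.2 (τ q.1)) = 𝓖.target (𝓖.inv (σ q.1.2 (τ q.1))) :=
    fun q hq => by rw [𝓖.target_inv, hs _ hq.2, hs _ hq.1.2]
  have hF : ContMDiffOn ((𝓘(ℝ, EM).prod 𝓘(ℝ, ℝ)).prod 𝓘(ℝ, ℝ)) 𝓘(ℝ, EG) ∞ F O := by
    have hτ1 := hτ.comp (contMDiffOn_fst (s := O) (J := 𝓘(ℝ, ℝ))) (fun q hq => hq.1)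
    have h1 := hσ.1.comp (hτ1.prodMk contMDiffOn_snd) (fun q hq => ⟨mem_univ _, hq.2⟩)
    have h2 := hσ.1.comp (hτ1.prodMk (contMDiff_snd.comp contMDiff_fst).contMDiffOn)
      (fun q hq => ⟨mem_univ _, hq.1.2⟩)
    exact 𝓖.smooth_mul.comp (h1.prodMk (𝓖.smooth_inv.comp_contMDiffOn h2)) hcomp
  have hF0 : ∀ ε ∈ J, ∀ x, F ((x, ε), ε) = 𝓖.unit x := fun ε hε x => by
    change 𝓖.mul (σ ε (τ (x, ε))) (𝓖.inv (σ ε (τ (x, ε)))) = _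
    rw [𝓖.mul_inv, (hτσ x ε hε).1]
  have hsF : ∀ q ∈ O, 𝓖.source (F q) = q.1.1 := fun q hq => by
    rw [𝓖.source_mul _ _ (hcomp q hq), 𝓖.source_inv]
    exact (hτσ q.1.1 q.1.2 hq.1.2).1
  have hvel : ∀ ε ∈ J, ∀ x, HasVelocityAt 𝓘(ℝ, EG) (fun l => F ((x, ε), l)) ε
      (mfderiv 𝓘(ℝ, ℝ) 𝓘(ℝ, EG) (fun l : ℝ => F ((x, ε), l)) ε (1 : ℝ)) := fun ε hε x => by
    have h1 : ContMDiffAt ((𝓘(ℝ, EM).prod 𝓘(ℝ, ℝ)).prod 𝓘(ℝ, ℝ)) 𝓘(ℝ, EG) ∞ F ((x, ε), ε) :=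
      hF.contMDiffAt (hO.mem_nhds ⟨⟨mem_univ _, hε⟩, hε⟩)
    exact MDifferentiableAt.hasVelocityAt ((h1.comp ε
      (contMDiffAt_const.prodMk contMDiffAt_id)).mdifferentiableAt (by simp))
  have hex : ∀ (ε : ℝ) (x : M), ∃ A : 𝓖.algebroidFiber x, ε ∈ J →
      HasVelocityAt 𝓘(ℝ, EG) (fun l => F ((x, ε), l)) ε
        (A : TangentSpace 𝓘(ℝ, EG) (𝓖.unit x)) := by
    intro ε x
    by_cases hε : ε ∈ J
    · refine ⟨⟨mfderiv 𝓘(ℝ, ℝ) 𝓘(ℝ, EG) (fun l : ℝ => F ((x, ε), l)) ε (1 : ℝ), ?_⟩,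
        fun _ => hvel ε hε x⟩
      have h1 := (hvel ε hε x).comp (hF0 ε hε x)
        ((𝓖.contMDiff_source (𝓖.unit x)).mdifferentiableAt (by simp))
      refine h1.unique ((hasVelocityAt_const x ε).congr ?_)
      filter_upwards [hJ.mem_nhds hε] with l hl using hsF _ ⟨⟨mem_univ _, hε⟩, hl⟩
    · exact ⟨0, fun h => absurd h hε⟩
  choose α hα using hex
  refine ⟨α, ?_, ?_⟩
  · have h1 := hF.contMDiffOn_velocity hO
    have h2 : ContMDiff (𝓘(ℝ, EM).prod 𝓘(ℝ, ℝ)) ((𝓘(ℝ, EM).prod 𝓘(ℝ, ℝ)).prod 𝓘(ℝ, ℝ)) ∞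
      (fun q : M × ℝ => (q, q.2)) := contMDiff_id.prodMk contMDiff_snd
    refine (h1.comp (h2.contMDiffOn (s := univ ×ˢ J)) (fun q hq => ⟨hq, hq.2⟩)).congr ?_
    intro q hq
    exact tangentBundle_mk_eq (hF0 q.2 hq.2 q.1).symm
      (hα q.2 q.1 hq.2).mfderiv_apply_one.symm
  · intro ε hε x
    have := hα ε (𝓖.target (σ ε x)) hε
    simpa only [F, (hτσ x ε hε).2] using this

variable {𝓖} {𝓗 : LieGroupoid EH H EN N} {Φ₀ : H → G} {φ₀ : N → M}

/-- Near l = ε, Φ_l(k) is a Φ_ε(k) b⁻¹ with a and b the curves σ_l σ_ε⁻¹ at the base points φ₀(t(k))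
and φ₀(s(k)). The velocity of such a product is exactly δ of the logarithmic derivative of σ. -/
theorem Deformation.StronglyTrivial.cocyclesSmoothlyExactInVariation [FiniteDimensional ℝ EM]
    {D : Deformation 𝓗 𝓖 Φ₀ φ₀} {h₀ : IsMorphism 𝓗 𝓖 Φ₀ φ₀} (h : D.StronglyTrivial h₀) :
    D.CocyclesSmoothlyExactInVariation := by
  obtain ⟨J, hJ, hJD, -, σ, hσ, -, hconj⟩ := h
  have hs : ∀ ε ∈ J, ∀ x, 𝓖.source (σ ε x) = x := fun ε hε => (hσ.2 ε hε).2.1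
  obtain ⟨α, hα, hασ⟩ := hσ.exists_section 𝓖 hJ.1
  have hconj' : ∀ ε ∈ J, ∀ k, D.arrows ε k = 𝓖.conj (σ ε) (Φ₀ k) := hconj
  have hbase : ∀ ε ∈ J, ∀ y, D.base ε y = 𝓖.target (σ ε (φ₀ y)) := fun ε hε y => by
    rw [(D.isMorphism ε (hJD hε)).base_eq, hconj' ε hε, 𝓖.target_conj (hs ε hε), h₀.map_target,
      𝓗.target_unit]
  refine ⟨J, hJ, hJD, fun ε y => α ε (D.base ε y), ⟨α, hα, fun _ _ _ => rfl⟩, ?_⟩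
  intro ε hε k
  have hcurve : ∀ y, HasVelocityAt 𝓘(ℝ, EG)
      (fun l => 𝓖.mul (σ l (φ₀ y)) (𝓖.inv (σ ε (φ₀ y)))) ε
      (α ε (D.base ε y) : TangentSpace 𝓘(ℝ, EG) (𝓖.unit (D.base ε y))) := fun y => by
    rw [hbase ε hε y]
    exact hασ ε hε (φ₀ y)
  have hstart : ∀ y, 𝓖.mul (σ ε (φ₀ y)) (𝓖.inv (σ ε (φ₀ y))) = 𝓖.unit (D.base ε y) := fun y => by
    rw [𝓖.mul_inv, hbase ε hε]
  have hsource : ∀ y, ∀ᶠ l in 𝓝 ε,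
      𝓖.source (𝓖.mul (σ l (φ₀ y)) (𝓖.inv (σ ε (φ₀ y)))) = D.base ε y := fun y => by
    filter_upwards [hJ.1.mem_nhds hε] with l hl
    rw [𝓖.source_mul _ _ (by rw [𝓖.target_inv, hs l hl, hs ε hε]), 𝓖.source_inv, hbase ε hε]
  have hΦ := D.isMorphism ε (hJD hε)
  have h1 := 𝓖.hasVelocityAt_mul_mul_inv (hΦ.map_target k) (hΦ.map_source k)
    (hcurve _) (hstart _) (hsource _) (hcurve _) (hstart _) (hsource _)
  refine HasVelocityAt.mfderiv_apply_one (h1.congr ?_)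
  filter_upwards [hJ.1.mem_nhds hε] with l hl
  rw [hconj' l hl, hconj' ε hε, 𝓖.conj_eq_mul_conj_mul (hs ε hε) (hs l hl), h₀.map_target,
    h₀.map_source]

end LieGroupoid

/-! ### Cutoffs and compactly supported families of diffeomorphisms -/

section CompactSupport

variable {E P : Type*} [NormedAddCommGroup E] [NormedSpace ℝ E] [FiniteDimensional ℝ E]
  [TopologicalSpace P] [ChartedSpace E P] [IsManifold 𝓘(ℝ, E) ∞ P] [T2Space P]

/-- A compact subset of a Hausdorff manifold, which need not be σ-compact, has a smooth compactly
supported bump function. -/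
theorem exists_contMDiff_one_on_compact {K : Set P} (hK : IsCompact K) :
    ∃ (f : P → ℝ) (C : Set P), ContMDiff 𝓘(ℝ, E) 𝓘(ℝ, ℝ) ∞ f ∧ IsCompact C ∧
      (∀ x ∈ K, f x = 1) ∧ ∀ x ∉ C, f x = 0 := by
  let b : ∀ x : P, SmoothBumpFunction 𝓘(ℝ, E) x := fun x => Classical.choice inferInstance
  obtain ⟨t, -, ht⟩ := hK.elim_nhds_subcover (fun x => {z | b x z = 1})
    (fun x _ => (b x).eventuallyEq_one)
  -- The product vanishes as soon as one bump equals 1, and equals 1 off the finite union of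
  -- supports.
  refine ⟨fun z => 1 - ∏ i ∈ t, (1 - b i z), ⋃ i ∈ t, tsupport (b i), ?_, ?_, ?_, ?_⟩
  · exact contMDiff_const.sub (contMDiff_finsetProd fun i _ =>
      contMDiff_const.sub (b i).contMDiff)
  · exact t.isCompact_biUnion fun i _ => (b i).hasCompactSupport
  · intro x hx
    obtain ⟨i, hi, hxi⟩ := mem_iUnion₂.mp (ht hx)
    beta_reduce
    rw [Finset.prod_eq_zero hi (show (1 : ℝ) - b i x = 0 by
      rw [show b i x = 1 from hxi, sub_self]), sub_zero]
  · intro x hx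
    beta_reduce
    rw [Finset.prod_eq_one, sub_self]
    intro i hi
    rw [image_eq_zero_of_notMem_tsupport fun h => hx (mem_iUnion₂.mpr ⟨i, hi, h⟩), sub_zero]

/-- A smooth family of self-maps with uniform compact support, starting at the identity, consists
of diffeomorphisms for small parameters. -/
theorem eventually_diffeomorph_of_compact_support {J : Set ℝ} (hJ : IsOpen J) (h0J : (0 : ℝ) ∈ J)
    {ψ : P × ℝ → P}
    (hψ : ContMDiffOn (𝓘(ℝ, E).prod 𝓘(ℝ, ℝ)) 𝓘(ℝ, E) ∞ ψ (univ ×ˢ J))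
    (h0 : ∀ x, ψ (x, 0) = x) {C : Set P} (hC : IsCompact C)
    (hψC : ∀ ε ∈ J, ∀ x ∉ C, ψ (x, ε) = x) :
    ∀ᶠ ε in 𝓝 0, ∃ e : P ≃ₘ^∞⟮𝓘(ℝ, E), 𝓘(ℝ, E)⟯ P, ∀ x, e x = ψ (x, ε) := by
  have : LocallyCompactSpace P := Manifold.locallyCompact_of_finiteDimensional 𝓘(ℝ, E)
  have hO : IsOpen ((univ : Set P) ×ˢ J) := isOpen_univ.prod hJ
  have hcont : ∀ x, ContinuousAt ψ (x, 0) := fun x =>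
    hψ.continuousOn.continuousAt (hO.mem_nhds ⟨mem_univ _, h0J⟩)
  choose O₁ hO₁ hO₁' hO₁0 O₂ hO₂ inv hinv hr hl using fun x =>
    exists_contMDiffOn_parametric_inverse hO hψ (p₀ := x) (ε₀ := 0) ⟨mem_univ _, h0J⟩ (by
      rw [show (fun p => ψ (p, 0)) = id from funext h0, mfderiv_id]
      exact Function.injective_id)
  have hO₂0 : ∀ x, (x, (0 : ℝ)) ∈ O₂ x := fun x => by
    have := (hl x _ (hO₁0 x)).1
    rwa [h0] at this
  -- C' is a buffer: for small ε the image of C stays inside it, so points of C cannot collide with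
  -- fixed points outside C'.
  obtain ⟨C', hC', hCC'⟩ := exists_compact_superset hC
  have hsurj : ∀ᶠ ε in 𝓝 (0 : ℝ), ∀ y ∈ C, ∃ x, (y, ε) ∈ O₂ x := by
    refine hC.eventually_forall_of_forall_eventually fun y _ => ?_
    filter_upwards [continuous_swap.continuousAt.eventually_mem
      ((hO₂ y).mem_nhds (hO₂0 y))] with z hz using ⟨y, hz⟩
  have hmaps : ∀ᶠ ε in 𝓝 (0 : ℝ), ∀ x ∈ C, ψ (x, ε) ∈ interior C' := by
    refine hC.eventually_forall_of_forall_eventually fun x hx => ?_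
    have h1 : ContinuousAt (fun z : ℝ × P => ψ (z.2, z.1)) (0, x) :=
      ContinuousAt.comp (g := ψ) (f := fun z : ℝ × P => (z.2, z.1)) (hcont x) (by fun_prop)
    exact h1.eventually_mem (isOpen_interior.mem_nhds (by rw [h0]; exact hCC' hx))
  have hinj : ∀ᶠ ε in 𝓝 (0 : ℝ), ∀ z ∈ C' ×ˢ C', ψ (z.1, ε) = ψ (z.2, ε) → z.1 = z.2 := by
    refine (hC'.prod hC').eventually_forall_of_forall_eventually
      (P := fun (ε : ℝ) (z : P × P) => ψ (z.1, ε) = ψ (z.2, ε) → z.1 = z.2) ?_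
    rintro ⟨x, x'⟩ -
    have h1 : ContinuousAt (fun z : ℝ × P × P => (z.2.1, z.1)) (0, x, x') := by fun_prop
    have h2 : ContinuousAt (fun z : ℝ × P × P => (z.2.2, z.1)) (0, x, x') := by fun_prop
    -- Near the diagonal a local left inverse gives injectivity; away from it distinct images stay
    -- apart since P is Hausdorff. Compactness of C' ×ˢ C' makes ε uniform.
    by_cases hxx : x = x'
    · subst hxx
      filter_upwards [h1.eventually_mem ((hO₁' x).mem_nhds (hO₁0 x)),
        h2.eventually_mem ((hO₁' x).mem_nhds (hO₁0 x))] with z hz hz' heq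
      exact (hl x _ hz).2.symm.trans
        ((congrArg (fun y => inv x (y, z.1)) heq).trans (hl x _ hz').2)
    · have h3 : ContinuousAt (fun z : ℝ × P × P => ψ (z.2.1, z.1)) (0, x, x') :=
        ContinuousAt.comp (g := ψ) (hcont x) h1
      have h4 : ContinuousAt (fun z : ℝ × P × P => ψ (z.2.2, z.1)) (0, x, x') :=
        ContinuousAt.comp (g := ψ) (hcont x') h2
      have h5 : ψ (x, 0) ≠ ψ (x', 0) := by rwa [h0, h0]
      filter_upwards [(h3.prodMk h4).eventually_mem
        (isClosed_diagonal.isOpen_compl.mem_nhds h5)] with z hz heq using absurd heq hz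
  filter_upwards [hJ.mem_nhds h0J, hsurj, hmaps, hinj] with ε hε hsurj hmaps hinj
  have hsub : C ⊆ C' := hCC'.trans interior_subset
  have hinC : ∀ x ∈ C, ∀ x', ψ (x, ε) = ψ (x', ε) → x' ∈ C' := fun x hx x' heq => by
    by_contra hx'
    have h1 := hmaps x hx
    rw [heq, hψC ε hε x' fun h => hx' (hsub h)] at h1
    exact hx' (interior_subset h1)
  have hI : Function.Injective fun x => ψ (x, ε) := by
    intro x x' heq
    by_cases hx : x ∈ C
    · exact hinj (x, x') ⟨hsub hx, hinC x hx x' heq⟩ heq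
    · by_cases hx' : x' ∈ C
      · exact hinj (x, x') ⟨hinC x' hx' x heq.symm, hsub hx'⟩ heq
      · simpa only [hψC ε hε _ hx, hψC ε hε _ hx'] using heq
  have hS : Function.Surjective fun x => ψ (x, ε) := by
    intro y
    by_cases hy : y ∈ C
    · obtain ⟨x, hx⟩ := hsurj y hy
      exact ⟨_, (hr x _ hx).2⟩
    · exact ⟨y, hψC ε hε y hy⟩
  let e : P ≃ P := Equiv.ofBijective _ ⟨hI, hS⟩
  have he : ∀ {x y}, ψ (x, ε) = y → e.symm y = x := fun h => e.symm_apply_eq.mpr h.symm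
  have hε' : ContMDiff 𝓘(ℝ, E) (𝓘(ℝ, E).prod 𝓘(ℝ, ℝ)) ∞ (fun x : P => (x, ε)) :=
    contMDiff_id.prodMk contMDiff_const
  refine ⟨⟨e, ?_, ?_⟩, fun x => rfl⟩
  · exact contMDiffOn_univ.mp (hψ.comp hε'.contMDiffOn (fun x _ => ⟨mem_univ _, hε⟩))
  · intro y
    by_cases hy : y ∈ C
    · obtain ⟨x, hx⟩ := hsurj y hy
      have h1 : ContMDiffAt 𝓘(ℝ, E) 𝓘(ℝ, E) ∞ (fun z => inv x (z, ε)) y :=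
        ((hinv x).contMDiffAt ((hO₂ x).mem_nhds hx)).comp y hε'.contMDiffAt
      refine h1.congr_of_eventuallyEq ?_
      filter_upwards [hε'.continuous.continuousAt.eventually_mem ((hO₂ x).mem_nhds hx)] with z hz
        using he (hr x _ hz).2
    · refine contMDiffAt_id.congr_of_eventuallyEq ?_
      filter_upwards [hC.isClosed.isOpen_compl.mem_nhds hy] with z hz using he (hψC ε hε z hz)

end CompactSupport

/-! ### The anchor and integration of sections to bisections -/

namespace LieGroupoid

variable {EG G EM M : Type*}
  [NormedAddCommGroup EG] [NormedSpace ℝ EG] [TopologicalSpace G] [ChartedSpace EG G]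
  [NormedAddCommGroup EM] [NormedSpace ℝ EM] [TopologicalSpace M] [ChartedSpace EM M]
  (𝓖 : LieGroupoid EG G EM M)

/-- The anchor `A_G → TM` of the Lie algebroid, the differential of the target map. -/
noncomputable def anchor {x : M} (A : 𝓖.algebroidFiber x) : TangentSpace 𝓘(ℝ, EM) x :=
  tangentCast (𝓖.target_unit x) (mfderiv 𝓘(ℝ, EG) 𝓘(ℝ, EM) 𝓖.target (𝓖.unit x) A)

/-- Supplies the integral curves at units outside the support of α. -/
theorem hasVelocityAt_const_of_section_eq_zero {ε : ℝ} {α : ℝ → (x : M) → 𝓖.algebroidFiber x}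
    (g : G) (h : α ε (𝓖.target g) = 0) :
    HasVelocityAt 𝓘(ℝ, EG) (fun _ : ℝ => g) ε
      (𝓖.rightTranslate g rfl (α ε (𝓖.target g))) := by
  have h1 := 𝓖.hasVelocityAt_mul_right (a := fun _ => 𝓖.unit (𝓖.target g)) (g := g) rfl
    (hasVelocityAt_const (𝓖.unit (𝓖.target g)) ε) rfl
    (Filter.Eventually.of_forall fun _ => 𝓖.source_unit _)
  rw [h]
  exact h1.congr (Filter.Eventually.of_forall fun _ => (𝓖.unit_mul g).symm)

variable [IsManifold 𝓘(ℝ, EG) ∞ G]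

/-- This permits cutting off sections. Smoothness is read in a trivialization of the tangent bundle,
which is linear on fibres. -/
theorem IsSmoothSectionFamily.smul {J : Set ℝ} {α : ℝ → (x : M) → 𝓖.algebroidFiber x}
    (hα : 𝓖.IsSmoothSectionFamily J α) {f : M → ℝ} (hf : ContMDiff 𝓘(ℝ, EM) 𝓘(ℝ, ℝ) ∞ f) :
    𝓖.IsSmoothSectionFamily J (fun ε x => f x • α ε x) := by
  have : IsManifold 𝓘(ℝ, EG) 1 G := IsManifold.of_le (n := ∞) (by simp)
  intro p hp
  obtain ⟨h1, h2⟩ := Bundle.contMDiffWithinAt_totalSpace.mp (hα p hp)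
  refine Bundle.contMDiffWithinAt_totalSpace.mpr ⟨h1, ?_⟩
  have h3 := ((hf.comp contMDiff_fst).contMDiffOn (s := univ ×ˢ J) p hp).smul h2
  let e := trivializationAt EG (TangentSpace 𝓘(ℝ, EG)) (𝓖.unit p.1)
  have h4 : ∀ q : M × ℝ, 𝓖.unit q.1 ∈ e.baseSet →
      (e ⟨𝓖.unit q.1, ((f q.1 • α q.2 q.1 : 𝓖.algebroidFiber q.1) :
        TangentSpace 𝓘(ℝ, EG) (𝓖.unit q.1))⟩).2 = f q.1 •
        (e ⟨𝓖.unit q.1, (α q.2 q.1 : TangentSpace 𝓘(ℝ, EG) (𝓖.unit q.1))⟩).2 :=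
    fun q hq => (e.linear ℝ hq).2 _ _
  have h5 : 𝓖.unit p.1 ∈ e.baseSet := FiberBundle.mem_baseSet_trivializationAt' _
  refine h3.congr_of_eventuallyEq ?_ (h4 p h5)
  filter_upwards [nhdsWithin_le_nhds ((𝓖.smooth_unit.continuous.comp
    continuous_fst).continuousAt.eventually_mem (e.open_baseSet.mem_nhds h5))]
    with q hq using h4 q hq

variable [IsManifold 𝓘(ℝ, EM) ∞ M]

theorem IsSmoothSectionFamily.contMDiffOn_anchor {J : Set ℝ}
    {α : ℝ → (x : M) → 𝓖.algebroidFiber x} (hα : 𝓖.IsSmoothSectionFamily J α) :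
    ContMDiffOn (𝓘(ℝ, EM).prod 𝓘(ℝ, ℝ)) 𝓘(ℝ, EM).tangent ∞
      (fun q : M × ℝ => (⟨q.1, 𝓖.anchor (α q.2 q.1)⟩ : TangentBundle 𝓘(ℝ, EM) M))
      (univ ×ˢ J) := by
  have : IsManifold 𝓘(ℝ, EG) 1 G := IsManifold.of_le (n := ∞) (by simp)
  have : IsManifold 𝓘(ℝ, EM) 1 M := IsManifold.of_le (n := ∞) (by simp)
  refine ((𝓖.contMDiff_target.contMDiff_tangentMap (m := ∞) (by simp)).comp_contMDiffOn hα).congr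
    fun q _ => tangentBundle_mk_eq (𝓖.target_unit _).symm (tangentCast_eq _ _)

variable {𝓖} in
/-- The target of a solution of `Φ' = r_Φ(A) + l_Φ(di(B))` moves with velocity the anchor of
`A`. -/
theorem hasVelocityAt_target_of_coboundary {Φ : ℝ → G} {t : ℝ} {x y : M}
    {A : 𝓖.algebroidFiber x} {B : 𝓖.algebroidFiber y} (hx : 𝓖.target (Φ t) = x)
    (hy : 𝓖.source (Φ t) = y)
    (hΦ : HasVelocityAt 𝓘(ℝ, EG) Φ t (𝓖.rightTranslate (Φ t) hx A +
      𝓖.leftTranslate (Φ t) hy (mfderiv 𝓘(ℝ, EG) 𝓘(ℝ, EG) 𝓖.inv (𝓖.unit y) B))) :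
    HasVelocityAt 𝓘(ℝ, EM) (fun s => 𝓖.target (Φ s)) t (𝓖.anchor A) := by
  obtain ⟨a, ha0, has, ha⟩ := 𝓖.exists_curve_of_algebroidFiber A t
  obtain ⟨b, hb0, hbs, hb⟩ := 𝓖.exists_curve_of_algebroidFiber B t
  -- The target of a Φ b⁻¹ is the target of a, so the term coming from B contributes nothing.
  have h1 : TangentCurves 𝓘(ℝ, EG) Φ (fun s => 𝓖.mul (𝓖.mul (a s) (Φ t)) (𝓖.inv (b s))) t :=
    hΦ.tangentCurves (𝓖.hasVelocityAt_mul_mul_inv hx hy ha ha0 has hb hb0 hbs)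
      (by rw [ha0, ← hx, 𝓖.unit_mul, hb0, 𝓖.inv_unit, ← hy, 𝓖.mul_unit])
  have hd : ∀ g, MDifferentiableAt 𝓘(ℝ, EG) 𝓘(ℝ, EM) 𝓖.target g := fun g =>
    (𝓖.contMDiff_target g).mdifferentiableAt (by simp)
  refine (h1.comp (hd _)).velocity ?_
  have h2 := ha.comp ha0 (hd (𝓖.unit x))
  have h3 : HasVelocityAt 𝓘(ℝ, EM) (fun s => 𝓖.target (a s)) t (𝓖.anchor A) := by
    rwa [← tangentCast_eq (𝓖.target_unit x)
      (mfderiv 𝓘(ℝ, EG) 𝓘(ℝ, EM) 𝓖.target (𝓖.unit x) A)] at h2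
  refine h3.congr ?_
  filter_upwards [has, hbs] with s hs hs'
  have h4 : 𝓖.source (a s) = 𝓖.target (Φ t) := hs.trans hx.symm
  rw [𝓖.target_mul _ _ (by rw [𝓖.source_mul _ _ h4, 𝓖.target_inv, hy, hs']), 𝓖.target_mul _ _ h4]

variable {𝓖} in
theorem hasVelocityAt_target_of_rightTranslate {c : ℝ → G} {t : ℝ} {x : M}
    {A : 𝓖.algebroidFiber x} (hx : 𝓖.target (c t) = x)
    (hc : HasVelocityAt 𝓘(ℝ, EG) c t (𝓖.rightTranslate (c t) hx A)) :
    HasVelocityAt 𝓘(ℝ, EM) (fun s => 𝓖.target (c s)) t (𝓖.anchor A) := by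
  obtain ⟨a, ha0, has, ha⟩ := 𝓖.exists_curve_of_algebroidFiber A t
  have h1 : TangentCurves 𝓘(ℝ, EG) c (fun s => 𝓖.mul (a s) (c t)) t :=
    hc.tangentCurves (𝓖.hasVelocityAt_mul_right hx ha ha0 has) (by rw [ha0, ← hx, 𝓖.unit_mul])
  have hd : ∀ g, MDifferentiableAt 𝓘(ℝ, EG) 𝓘(ℝ, EM) 𝓖.target g := fun g =>
    (𝓖.contMDiff_target g).mdifferentiableAt (by simp)
  refine (h1.comp (hd _)).velocity ?_
  have h2 := ha.comp ha0 (hd (𝓖.unit x))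
  have h3 : HasVelocityAt 𝓘(ℝ, EM) (fun s => 𝓖.target (a s)) t (𝓖.anchor A) := by
    rwa [← tangentCast_eq (𝓖.target_unit x)
      (mfderiv 𝓘(ℝ, EG) 𝓘(ℝ, EM) 𝓖.target (𝓖.unit x) A)] at h2
  refine h3.congr ?_
  filter_upwards [has] with s hs
  rw [𝓖.target_mul _ _ (hs.trans hx.symm)]

-- To first order the curve is a(s) c(t), whose source is that of the fixed factor c(t).
variable {𝓖} in
theorem hasVelocityAt_source_of_rightTranslate {c : ℝ → G} {t : ℝ} {x : M}
    {A : 𝓖.algebroidFiber x} (hx : 𝓖.target (c t) = x)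
    (hc : HasVelocityAt 𝓘(ℝ, EG) c t (𝓖.rightTranslate (c t) hx A)) :
    HasVelocityAt 𝓘(ℝ, EM) (fun s => 𝓖.source (c s)) t 0 := by
  obtain ⟨a, ha0, has, ha⟩ := 𝓖.exists_curve_of_algebroidFiber A t
  have h1 : TangentCurves 𝓘(ℝ, EG) c (fun s => 𝓖.mul (a s) (c t)) t :=
    hc.tangentCurves (𝓖.hasVelocityAt_mul_right hx ha ha0 has) (by rw [ha0, ← hx, 𝓖.unit_mul])
  refine (h1.comp ((𝓖.contMDiff_source _).mdifferentiableAt (by simp))).velocity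
    ((hasVelocityAt_const (𝓖.source (c t)) t).congr ?_)
  filter_upwards [has] with s hs
  rw [𝓖.source_mul _ _ (hs.trans hx.symm)]

/-- The quotient of two solutions of `c' = r_c(A)` with the same target is stationary. -/
theorem hasVelocityAt_inv_mul_zero {c c' : ℝ → G} {t : ℝ} {x : M}
    {A : 𝓖.algebroidFiber x} (hx : 𝓖.target (c t) = x) (hx' : 𝓖.target (c' t) = x)
    (hc : HasVelocityAt 𝓘(ℝ, EG) c t (𝓖.rightTranslate (c t) hx A))
    (hc' : HasVelocityAt 𝓘(ℝ, EG) c' t (𝓖.rightTranslate (c' t) hx' A))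
    (hcc' : ∀ᶠ s in 𝓝 t, 𝓖.target (c s) = 𝓖.target (c' s)) :
    HasVelocityAt 𝓘(ℝ, EG) (fun s => 𝓖.mul (𝓖.inv (c s)) (c' s)) t 0 := by
  obtain ⟨a, ha0, has, ha⟩ := 𝓖.exists_curve_of_algebroidFiber A t
  have h1 : TangentCurves 𝓘(ℝ, EG) c (fun s => 𝓖.mul (a s) (c t)) t :=
    hc.tangentCurves (𝓖.hasVelocityAt_mul_right hx ha ha0 has) (by rw [ha0, ← hx, 𝓖.unit_mul])
  have h1' : TangentCurves 𝓘(ℝ, EG) c' (fun s => 𝓖.mul (a s) (c' t)) t :=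
    hc'.tangentCurves (𝓖.hasVelocityAt_mul_right hx' ha ha0 has) (by rw [ha0, ← hx', 𝓖.unit_mul])
  have h2 := tangentCurves_mul (𝓖.tangentCurves_inv h1) h1'
    (hcc'.mono fun s hs => by rw [𝓖.source_inv, hs])
    (has.mono fun s hs => by
      rw [𝓖.source_inv, 𝓖.target_mul _ _ (hs.trans hx.symm), 𝓖.target_mul _ _ (hs.trans hx'.symm)])
  refine h2.velocity ((hasVelocityAt_const (𝓖.mul (𝓖.inv (c t)) (c' t)) t).congr ?_)
  filter_upwards [has] with s hs
  exact 𝓖.inv_mul_mul_cancel (hs.trans hx.symm) (hs.trans hx'.symm)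

/-- Uniqueness of integral curves of right-invariant vector fields; the space of arrows need not be
Hausdorff. -/
theorem eqOn_of_hasVelocityAt_rightTranslate [T2Space M] [CompleteSpace EM] {S : Set ℝ}
    (hS : IsOpen S) (hS' : IsPreconnected S) {α : ℝ → (x : M) → 𝓖.algebroidFiber x}
    (hα : 𝓖.IsSmoothSectionFamily S α) {c c' : ℝ → G}
    (hc : ∀ t ∈ S, HasVelocityAt 𝓘(ℝ, EG) c t
      (𝓖.rightTranslate (c t) rfl (α t (𝓖.target (c t)))))
    (hc' : ∀ t ∈ S, HasVelocityAt 𝓘(ℝ, EG) c' t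
      (𝓖.rightTranslate (c' t) rfl (α t (𝓖.target (c' t)))))
    {t₀ : ℝ} (ht₀ : t₀ ∈ S) (h0 : c t₀ = c' t₀) : EqOn c c' S := by
  -- Hausdorffness is used only on the base. Once the targets agree, c⁻¹ c' is defined and
  -- stationary, hence constantly a unit.
  have htarget : EqOn (fun s => 𝓖.target (c s)) (fun s => 𝓖.target (c' s)) S :=
    eqOn_of_hasVelocityAt hS hS' (W := fun ε x => 𝓖.anchor (α ε x)) (hα.contMDiffOn_anchor 𝓖)
      (fun t ht => hasVelocityAt_target_of_rightTranslate rfl (hc t ht))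
      (fun t ht => hasVelocityAt_target_of_rightTranslate rfl (hc' t ht)) ht₀ (congrArg _ h0)
  intro t ht
  have hsource : 𝓖.source (c t) = 𝓖.source (c t₀) :=
    eq_of_hasVelocityAt_zero (c := fun s => 𝓖.source (c s)) hS hS'
      (fun s hs => hasVelocityAt_source_of_rightTranslate rfl (hc s hs)) ht ht₀
  have hk : 𝓖.mul (𝓖.inv (c t)) (c' t) = 𝓖.mul (𝓖.inv (c t₀)) (c' t₀) :=
    eq_of_hasVelocityAt_zero (c := fun s => 𝓖.mul (𝓖.inv (c s)) (c' s)) hS hS' (fun s hs => by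
      have h1 : ∀ x (hx : 𝓖.target (c' s) = x), HasVelocityAt 𝓘(ℝ, EG) c' s
          (𝓖.rightTranslate (c' s) hx (α s x)) := by
        rintro _ rfl
        exact hc' s hs
      refine 𝓖.hasVelocityAt_inv_mul_zero rfl (htarget hs).symm (hc s hs) (h1 _ _) ?_
      filter_upwards [hS.mem_nhds hs] with r hr using htarget hr) ht ht₀
  refine 𝓖.mul_left_cancel (g := 𝓖.inv (c t)) (𝓖.source_inv _)
    ((𝓖.source_inv _).trans (htarget ht)) ?_
  rw [hk, ← h0, 𝓖.inv_mul, 𝓖.inv_mul, hsource]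

/-- The local flow of a smooth family of sections of the algebroid, through the units. -/
theorem exists_local_flow_unit [FiniteDimensional ℝ EG] {J : Set ℝ} (hJ : IsOpen J)
    (h0J : (0 : ℝ) ∈ J) {α : ℝ → (x : M) → 𝓖.algebroidFiber x}
    (hα : 𝓖.IsSmoothSectionFamily J α) (x₀ : M) :
    ∃ U : Set M, IsOpen U ∧ x₀ ∈ U ∧ ∃ δ > 0, ∃ σ : M × ℝ → G,
      ContMDiffOn (𝓘(ℝ, EM).prod 𝓘(ℝ, ℝ)) 𝓘(ℝ, EG) ∞ σ (U ×ˢ Ioo (-δ) δ) ∧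
      (∀ x ∈ U, σ (x, 0) = 𝓖.unit x) ∧ ∀ x ∈ U, ∀ ε ∈ Ioo (-δ) δ, ε ∈ J ∧
        HasVelocityAt 𝓘(ℝ, EG) (fun l => σ (x, l)) ε
          (𝓖.rightTranslate (σ (x, ε)) rfl (α ε (𝓖.target (σ (x, ε))))) := by
  obtain ⟨U, hU, hxU, δ, hδ, Fl, hFl, hFl0, hvel⟩ := exists_contMDiffOn_local_flow
    (isOpen_univ.prod hJ) (V := fun ε g => 𝓖.rightTranslate g rfl (α ε (𝓖.target g)))
    (𝓖.contMDiffOn_rightTranslate hJ hα) (p₀ := 𝓖.unit x₀) ⟨mem_univ _, h0J⟩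
  have hu : ContMDiff (𝓘(ℝ, EM).prod 𝓘(ℝ, ℝ)) (𝓘(ℝ, EG).prod 𝓘(ℝ, ℝ)) ∞
      (fun q : M × ℝ => (𝓖.unit q.1, q.2)) :=
    (𝓖.smooth_unit.comp contMDiff_fst).prodMk contMDiff_snd
  refine ⟨𝓖.unit ⁻¹' U, hU.preimage 𝓖.smooth_unit.continuous, hxU, δ, hδ,
    fun q => Fl (𝓖.unit q.1, q.2), hFl.comp hu.contMDiffOn (fun q hq => hq),
    fun x hx => hFl0 _ hx, fun x hx ε hε => ?_⟩
  exact ⟨(hvel _ hx ε hε).1.2, (hvel _ hx ε hε).2⟩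

/-- A compactly supported smooth family of sections of the algebroid integrates, for small
parameters, to a smooth family of bisections. -/
theorem exists_bisectionFamily_of_compact_support [T2Space M] [FiniteDimensional ℝ EG]
    [FiniteDimensional ℝ EM] {J : Set ℝ} (hJ : IsOpen J)
    (h0J : (0 : ℝ) ∈ J) {α : ℝ → (x : M) → 𝓖.algebroidFiber x}
    (hα : 𝓖.IsSmoothSectionFamily J α) {C : Set M} (hC : IsCompact C)
    (hαC : ∀ ε, ∀ x ∉ C, α ε x = 0) :
    ∃ δ > 0, ∃ σ : ℝ → M → G, Ioo (-δ) δ ⊆ J ∧ 𝓖.IsSmoothBisectionFamily (Ioo (-δ) δ) σ ∧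
      σ 0 = 𝓖.unit ∧ ∀ x, ∀ ε ∈ Ioo (-δ) δ, HasVelocityAt 𝓘(ℝ, EG) (fun l => σ l x) ε
        (𝓖.rightTranslate (σ ε x) rfl (α ε (𝓖.target (σ ε x)))) := by
  have : CompleteSpace EM := FiniteDimensional.complete ℝ EM
  choose U hU hxU δ hδ σ hσ hσ0 hvel using 𝓖.exists_local_flow_unit hJ h0J hα
  -- Finitely many local flows cover C, so the least of their lifetimes serves every x; off C the
  -- unit is stationary.
  obtain ⟨t, -, ht⟩ := hC.elim_nhds_subcover U (fun x _ => (hU x).mem_nhds (hxU x))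
  obtain ⟨η, hη, hηJ⟩ : ∃ η > 0, Ioo (-η) η ⊆ J := by
    obtain ⟨η, hη, h⟩ := Metric.isOpen_iff.mp hJ 0 h0J
    rw [Real.ball_eq_Ioo, zero_sub, zero_add] at h
    exact ⟨η, hη, h⟩
  obtain ⟨d, hd, hdη, hdt⟩ : ∃ d > 0, d ≤ η ∧ ∀ i ∈ t, d ≤ δ i := by
    clear ht
    classical
    induction t using Finset.induction_on with
    | empty => exact ⟨η, hη, le_rfl, by simp⟩
    | insert i t _ ih =>
      obtain ⟨d, hd, hdη, hdt⟩ := ih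
      refine ⟨min d (δ i), lt_min hd (hδ i), (min_le_left _ _).trans hdη, ?_⟩
      intro j hj
      rcases Finset.mem_insert.mp hj with rfl | hj
      · exact min_le_right _ _
      · exact (min_le_left _ _).trans (hdt j hj)
  have hIoo : ∀ {a b : ℝ}, a ≤ b → Ioo (-a) a ⊆ Ioo (-b) b := fun h =>
    Ioo_subset_Ioo (neg_le_neg h) h
  have hdJ : Ioo (-d) d ⊆ J := (hIoo hdη).trans hηJ
  have h0d : (0 : ℝ) ∈ Ioo (-d) d := ⟨neg_neg_of_pos hd, hd⟩
  have hex : ∀ x, ∃ c : ℝ → G, c 0 = 𝓖.unit x ∧ ∀ ε ∈ Ioo (-d) d, HasVelocityAt 𝓘(ℝ, EG) c ε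
      (𝓖.rightTranslate (c ε) rfl (α ε (𝓖.target (c ε)))) := by
    intro x
    by_cases hx : x ∈ C
    · obtain ⟨i, hi, hxi⟩ := mem_iUnion₂.mp (ht hx)
      exact ⟨fun l => σ i (x, l), hσ0 i x hxi, fun ε hε =>
        (hvel i x hxi ε (hIoo (hdt i hi) hε)).2⟩
    · exact ⟨fun _ => 𝓖.unit x, rfl, fun ε _ => 𝓖.hasVelocityAt_const_of_section_eq_zero _
        (hαC ε _ (by rwa [𝓖.target_unit]))⟩
  choose c hc0 hc using hex
  have hαd : 𝓖.IsSmoothSectionFamily (Ioo (-d) d) α := hα.mono (prod_mono_right hdJ)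
  have huniq : ∀ x (c' : ℝ → G), c' 0 = 𝓖.unit x → (∀ ε ∈ Ioo (-d) d, HasVelocityAt 𝓘(ℝ, EG) c' ε
      (𝓖.rightTranslate (c' ε) rfl (α ε (𝓖.target (c' ε))))) → EqOn (c x) c' (Ioo (-d) d) :=
    fun x c' h0 hc' => 𝓖.eqOn_of_hasVelocityAt_rightTranslate isOpen_Ioo isPreconnected_Ioo hαd
      (hc x) hc' h0d ((hc0 x).trans h0.symm)
  have hcC : ∀ x ∉ C, EqOn (c x) (fun _ => 𝓖.unit x) (Ioo (-d) d) := fun x hx =>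
    huniq x _ rfl fun ε _ => 𝓖.hasVelocityAt_const_of_section_eq_zero _
        (hαC ε _ (by rwa [𝓖.target_unit]))
  -- The curves were chosen pointwise. Uniqueness matches them with a smooth local flow near points
  -- of C, and with the unit map on the open complement.
  have hsmooth : ContMDiffOn (𝓘(ℝ, EM).prod 𝓘(ℝ, ℝ)) 𝓘(ℝ, EG) ∞ (fun p : M × ℝ => c p.1 p.2)
      (univ ×ˢ Ioo (-d) d) := by
    rintro ⟨x, ε⟩ ⟨-, hε⟩
    refine ContMDiffAt.contMDiffWithinAt ?_
    by_cases hx : x ∈ C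
    · obtain ⟨i, hi, hxi⟩ := mem_iUnion₂.mp (ht hx)
      have h1 := (hσ i).mono (prod_mono_right (s := U i) (hIoo (hdt i hi)))
      refine (h1.congr ?_).contMDiffAt (((hU i).prod isOpen_Ioo).mem_nhds ⟨hxi, hε⟩)
      rintro ⟨z, l⟩ ⟨hz, hl⟩
      exact huniq z (fun l => σ i (z, l)) (hσ0 i z hz)
        (fun ε hε => (hvel i z hz ε (hIoo (hdt i hi) hε)).2) hl
    · have h1 : ContMDiffOn (𝓘(ℝ, EM).prod 𝓘(ℝ, ℝ)) 𝓘(ℝ, EG) ∞ (fun p : M × ℝ => 𝓖.unit p.1)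
          (Cᶜ ×ˢ Ioo (-d) d) := (𝓖.smooth_unit.comp contMDiff_fst).contMDiffOn
      refine (h1.congr ?_).contMDiffAt
        ((hC.isClosed.isOpen_compl.prod isOpen_Ioo).mem_nhds ⟨hx, hε⟩)
      rintro ⟨z, l⟩ ⟨hz, hl⟩
      exact hcC z hz hl
  have hsource : ∀ x, ∀ ε ∈ Ioo (-d) d, 𝓖.source (c x ε) = x := fun x ε hε => by
    have h1 : 𝓖.source (c x ε) = 𝓖.source (c x 0) :=
      eq_of_hasVelocityAt_zero (c := fun s => 𝓖.source (c x s)) isOpen_Ioo isPreconnected_Ioo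
        (fun s hs => hasVelocityAt_source_of_rightTranslate rfl (hc x s hs)) hε h0d
    rw [h1, hc0, 𝓖.source_unit]
  -- The maps t ∘ σ_ε start at the identity and fix every point off C, so they are diffeomorphisms
  -- after a further shrinking of the interval.
  have hdiffeo := eventually_diffeomorph_of_compact_support isOpen_Ioo h0d
    (ψ := fun q : M × ℝ => 𝓖.target (c q.1 q.2)) (𝓖.contMDiff_target.comp_contMDiffOn hsmooth)
    (fun x => by rw [hc0, 𝓖.target_unit]) hC (fun ε hε x hx => by
      change 𝓖.target (c x ε) = x
      rw [hcC x hx hε, 𝓖.target_unit])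
  obtain ⟨η', hη', hdiffeo⟩ := Metric.eventually_nhds_iff_ball.mp hdiffeo
  rw [Real.ball_eq_Ioo, zero_sub, zero_add] at hdiffeo
  have hm : Ioo (-min d η') (min d η') ⊆ Ioo (-d) d := hIoo (min_le_left _ _)
  refine ⟨min d η', lt_min hd hη', fun ε x => c x ε, hm.trans hdJ,
    ⟨hsmooth.mono (prod_mono_right hm), fun ε hε => ⟨?_, fun x => hsource x ε (hm hε),
      hdiffeo ε (hIoo (min_le_right _ _) hε)⟩⟩, funext hc0, fun x ε hε => hc x ε (hm hε)⟩
  exact contMDiffOn_univ.mp (hsmooth.comp (contMDiff_id.prodMk contMDiff_const).contMDiffOn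
    (fun x _ => ⟨mem_univ _, hm hε⟩))

end LieGroupoid

/-! ### From exactness to strong triviality -/

namespace LieGroupoid

variable {EG G EM M EH H EN N : Type*}
  [NormedAddCommGroup EG] [NormedSpace ℝ EG] [TopologicalSpace G] [ChartedSpace EG G]
  [NormedAddCommGroup EM] [NormedSpace ℝ EM] [TopologicalSpace M] [ChartedSpace EM M]
  [NormedAddCommGroup EH] [NormedSpace ℝ EH] [TopologicalSpace H] [ChartedSpace EH H]
  [NormedAddCommGroup EN] [NormedSpace ℝ EN] [TopologicalSpace N] [ChartedSpace EN N]
  {𝓗 : LieGroupoid EH H EN N} {𝓖 : LieGroupoid EG G EM M} {Φ₀ : H → G} {φ₀ : N → M}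

theorem Deformation.hasVelocityAt_cocycle (D : Deformation 𝓗 𝓖 Φ₀ φ₀) {ε : ℝ} (hε : ε ∈ D.I)
    (h : H) : HasVelocityAt 𝓘(ℝ, EG) (fun l => D.arrows l h) ε (D.cocycle ε h) := by
  have h1 : ContMDiffAt (𝓘(ℝ, EH).prod 𝓘(ℝ, ℝ)) 𝓘(ℝ, EG) ∞
      (fun p : H × ℝ => D.arrows p.2 p.1) (h, ε) :=
    D.smooth_arrows.contMDiffAt ((isOpen_univ.prod D.isOpenInterval.1).mem_nhds ⟨mem_univ _, hε⟩)
  exact MDifferentiableAt.hasVelocityAt ((h1.comp ε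
    (contMDiffAt_const.prodMk contMDiffAt_id)).mdifferentiableAt (by simp))

/-- The points of the base visited by a deformation in a compact time interval form a compact
set. -/
theorem Deformation.isCompact_image_base [CompactSpace N] (D : Deformation 𝓗 𝓖 Φ₀ φ₀) {S : Set ℝ}
    (hS : IsCompact S) (hSI : S ⊆ D.I) :
    IsCompact ((fun p : N × ℝ => D.base p.2 p.1) '' (univ ×ˢ S)) :=
  (isCompact_univ.prod hS).image_of_continuousOn
    (D.smooth_base.continuousOn.mono (prod_mono_right hSI))

variable [IsManifold 𝓘(ℝ, EG) ∞ G] [IsManifold 𝓘(ℝ, EM) ∞ M]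

/-- Compactness of N allows α to be cut off without changing its pullbacks φ_ε^* α_ε. The bisections
obtained by integrating it then undo the deformation. -/
theorem Deformation.CocyclesSmoothlyExactInVariation.stronglyTrivial [T2Space M]
    [FiniteDimensional ℝ EG] [FiniteDimensional ℝ EM] [CompactSpace N]
    {D : Deformation 𝓗 𝓖 Φ₀ φ₀} (h₀ : IsMorphism 𝓗 𝓖 Φ₀ φ₀)
    (hD : D.CocyclesSmoothlyExactInVariation) : D.StronglyTrivial h₀ := by
  have : CompleteSpace EM := FiniteDimensional.complete ℝ EM
  obtain ⟨J, hJ, hJI, β, ⟨α₁, hα₁, hβ⟩, hX⟩ := hD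
  -- A closed time interval makes the set of visited base points compact.
  obtain ⟨η, hη, hηJ⟩ := Metric.nhds_basis_closedBall.mem_iff.mp (hJ.1.mem_nhds hJ.2.2)
  obtain ⟨f, C, hf, hC, hfK, hfC⟩ := exists_contMDiff_one_on_compact (E := EM)
    (D.isCompact_image_base (isCompact_closedBall (0 : ℝ) η) (hηJ.trans hJI))
  let α : ℝ → (x : M) → 𝓖.algebroidFiber x := fun ε x => f x • α₁ ε x
  have hη' : Metric.ball (0 : ℝ) η ⊆ J := Metric.ball_subset_closedBall.trans hηJ
  have hα : 𝓖.IsSmoothSectionFamily (Metric.ball 0 η) α :=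
    IsSmoothSectionFamily.smul 𝓖 (hα₁.mono (prod_mono_right hη')) hf
  have hβα : ∀ ε ∈ Metric.ball (0 : ℝ) η, ∀ y, β ε y = α ε (D.base ε y) := fun ε hε y => by
    rw [hβ ε (hη' hε), show α ε (D.base ε y) = f (D.base ε y) • α₁ ε (D.base ε y) from rfl,
      hfK _ ⟨(y, ε), ⟨mem_univ _, Metric.ball_subset_closedBall hε⟩, rfl⟩, one_smul]
  obtain ⟨δ, hδ, σ, hδη, hσ, hσ0, hσv⟩ := 𝓖.exists_bisectionFamily_of_compact_support
    Metric.isOpen_ball (Metric.mem_ball_self hη) hα hC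
    (fun ε x hx => by rw [show α ε x = f x • α₁ ε x from rfl, hfC x hx, zero_smul])
  have h0δ : (0 : ℝ) ∈ Ioo (-δ) δ := ⟨neg_neg_of_pos hδ, hδ⟩
  have hδJ : Ioo (-δ) δ ⊆ J := hδη.trans hη'
  have hδI : Ioo (-δ) δ ⊆ D.I := hδJ.trans hJI
  have hΦ : ∀ ε (hε : ε ∈ Ioo (-δ) δ) k, HasVelocityAt 𝓘(ℝ, EG) (fun l => D.arrows l k) ε
      (coboundary (D.isMorphism ε (hδI hε)) (fun y => α ε (D.base ε y)) k) := fun ε hε k => by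
    rw [← show β ε = fun y => α ε (D.base ε y) from funext (hβα ε (hδη hε)), ← hX ε (hδJ hε) k]
    exact D.hasVelocityAt_cocycle (hδI hε) k
  -- Both curves integrate the anchor of α: the first since σ solves the right-invariant equation,
  -- the second by applying the cocycle equation at the unit over y. They start at φ₀ y.
  have hbase : ∀ y, EqOn (fun ε => 𝓖.target (σ ε (φ₀ y))) (fun ε => D.base ε y) (Ioo (-δ) δ) := by
    intro y
    refine eqOn_of_hasVelocityAt isOpen_Ioo isPreconnected_Ioo (W := fun ε x => 𝓖.anchor (α ε x))
      (IsSmoothSectionFamily.contMDiffOn_anchor 𝓖 (hα.mono (prod_mono_right hδη)))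
      (fun ε hε => hasVelocityAt_target_of_rightTranslate rfl (hσv (φ₀ y) ε hε)) ?_ h0δ ?_
    · intro ε hε
      have h1 := hasVelocityAt_target_of_coboundary _ _ (hΦ ε hε (𝓗.unit y))
      rw [𝓗.target_unit] at h1
      refine h1.congr ?_
      filter_upwards [isOpen_Ioo.mem_nhds hε] with l hl
        using (D.isMorphism l (hδI hl)).base_eq y
    · rw [hσ0, 𝓖.target_unit, D.base_zero]
  refine ⟨Ioo (-δ) δ, ⟨isOpen_Ioo, ordConnected_Ioo, h0δ⟩, hδI, subset_univ _, σ, hσ, hσ0, ?_⟩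
  intro ε hε k
  change D.arrows ε k = 𝓖.conj (σ ε) (Φ₀ k)
  have hs : ∀ ε ∈ Ioo (-δ) δ, ∀ x, 𝓖.source (σ ε x) = x := fun ε hε => (hσ.2 ε hε).2.1
  have hσv' : ∀ ε ∈ Ioo (-δ) δ, ∀ y x (hx : 𝓖.target (σ ε (φ₀ y)) = x),
      HasVelocityAt 𝓘(ℝ, EG) (fun l => σ l (φ₀ y)) ε
        (𝓖.rightTranslate (σ ε (φ₀ y)) hx (α ε x)) := by
    rintro ε hε y _ rfl
    exact hσv (φ₀ y) ε hε
  have ht : ∀ ε ∈ Ioo (-δ) δ, 𝓖.target (σ ε (φ₀ (𝓗.target k))) = 𝓖.target (D.arrows ε k) :=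
    fun ε hε => (hbase _ hε).trans ((D.isMorphism ε (hδI hε)).map_target k).symm
  have ht' : ∀ ε ∈ Ioo (-δ) δ, 𝓖.source (D.arrows ε k) = 𝓖.target (σ ε (φ₀ (𝓗.source k))) :=
    fun ε hε => ((D.isMorphism ε (hδI hε)).map_source k).trans (hbase _ hε).symm
  -- The conjugate of Φ_l back by σ_l is stationary, so it keeps its value Φ₀ k at l = 0; solving
  -- for Φ_ε k yields the claim.
  have hconst := eq_of_hasVelocityAt_zero isOpen_Ioo isPreconnected_Ioo
    (c := fun l => 𝓖.mul (𝓖.inv (σ l (φ₀ (𝓗.target k))))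
      (𝓖.mul (D.arrows l k) (σ l (φ₀ (𝓗.source k))))) (fun l hl => by
    obtain ⟨a, ha0, has, ha⟩ :=
      𝓖.exists_curve_of_algebroidFiber (α l (D.base l (𝓗.target k))) l
    obtain ⟨b, hb0, hbs, hb⟩ :=
      𝓖.exists_curve_of_algebroidFiber (α l (D.base l (𝓗.source k))) l
    refine 𝓖.hasVelocityAt_zero_of_conj ha ha0 has hb hb0 hbs (hbase _ hl) (hbase _ hl) _ _
      (hσv' l hl _ _ _) (hσv' l hl _ _ _) (hΦ l hl k) ?_ ?_
    · filter_upwards [isOpen_Ioo.mem_nhds hl] with r hr using ht r hr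
    · filter_upwards [isOpen_Ioo.mem_nhds hl] with r hr using ht' r hr) hε h0δ
  have h1 : 𝓖.mul (𝓖.inv (σ ε (φ₀ (𝓗.target k)))) (𝓖.mul (D.arrows ε k) (σ ε (φ₀ (𝓗.source k)))) =
      Φ₀ k := by
    refine hconst.trans ?_
    rw [hσ0, D.arrows_zero, 𝓖.inv_unit, ← h₀.map_source, 𝓖.mul_unit, ← h₀.map_target, 𝓖.unit_mul]
  unfold conj
  rw [h₀.map_target, h₀.map_source, ← h1, 𝓖.mul_inv_cancel_left
    (by rw [𝓖.target_mul _ _ (ht' ε hε), ht ε hε]), 𝓖.mul_inv_cancel_right (ht' ε hε)]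

end LieGroupoid

theorem mainTheorem9
    {EH H EN N EG G EM M : Type*}
    [NormedAddCommGroup EH] [NormedSpace ℝ EH] [FiniteDimensional ℝ EH]
    [TopologicalSpace H] [ChartedSpace EH H] [IsManifold 𝓘(ℝ, EH) ∞ H]
    [NormedAddCommGroup EN] [NormedSpace ℝ EN] [FiniteDimensional ℝ EN]
    [TopologicalSpace N] [ChartedSpace EN N] [IsManifold 𝓘(ℝ, EN) ∞ N] [T2Space N]
    [NormedAddCommGroup EG] [NormedSpace ℝ EG] [FiniteDimensional ℝ EG]
    [TopologicalSpace G] [ChartedSpace EG G] [IsManifold 𝓘(ℝ, EG) ∞ G]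
    [NormedAddCommGroup EM] [NormedSpace ℝ EM] [FiniteDimensional ℝ EM]
    [TopologicalSpace M] [ChartedSpace EM M] [IsManifold 𝓘(ℝ, EM) ∞ M] [T2Space M]
    (𝓗 : LieGroupoid EH H EN N) (𝓖 : LieGroupoid EG G EM M)
    (Φ₀ : H → G) (φ₀ : N → M) (h₀ : LieGroupoid.IsMorphism 𝓗 𝓖 Φ₀ φ₀)
    (hN : CompactSpace N)
    (D : LieGroupoid.Deformation 𝓗 𝓖 Φ₀ φ₀) :
    D.StronglyTrivial h₀ ↔ D.CocyclesSmoothlyExactInVariation :=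
  ⟨fun h => h.cocyclesSmoothlyExactInVariation, fun h => h.stronglyTrivial h₀⟩
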